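/- Let $b$ be a rational function, analytic in the open unit disc $\mathbb D$, with $\sup_{\mathbb D}|b|=1$, which is not inner (i.e. not a finite Blaschke product or a unimodular constant). Let $\mathscr H(b)$ be the de Branges–Rovnyak space of $b$, i.e. the range of $(I-T_bT_b^*)^{1/2}$ on $H^2$ with the range norm. Let $\tilde a$ be the Pythagorean mate of $b$: the rational function without poles in $\overline{\mathbb D}$ and without zeros in $\mathbb D$ such that $|\tilde a|^2+|b|^2=1$ on the unit circle $\mathbb T$ and $\tilde a(0)>0$. Let $\zeta_1,\dots,\zeta_n$ be the distinct zeros of $\tilde a$ on $\mathbb T$, with multiplicities $m_1,\dots,m_n$, and put $a(z)=\prod_{i=1}^n(z-\zeta_i)^{m_i}$ and $N=\sum_i m_i$. Then $\mathscr H(b)=aH^2\oplus\mathscr P_{N-1}$, where $\mathscr P_{N-1}$ is the space of polynomials of degree at most $N-1$, and $\|ag+p\|^2:=\|g\|_{H^2}^2+\|p\|_{H^2}^2$ ($g\in H^2$, $p\in\mathscr P_{N-1}$) defines an equivalent Hilbert norm on $\mathscr H(b)$. Let $\varphi:\mathbb D\to\mathbb D$ be analytic and let $u$ be a function on $\mathbb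 D$ such that (H1) $u\in\mathscr H(b)$, and (H2) $u\varphi\in\mathscr H(b)$. Let $J$ be the set of all $j$ such that $u^{(\ell)}(\zeta_j)\ne0$ for some $0\le\ell\le m_j-1$ and $\varphi(\zeta_j)\in\mathbb D$, where the values at $\zeta_j$ are non-tangential limits (those of $u^{(\ell)}$ exist for all $\ell\le m_j-1$, and that of $\varphi$ exists as soon as one of them is not $0$). Put $$w=\frac{u\cdot (a\circ\varphi)\cdot\prod_{j\in J}(\varphi-\varphi(\zeta_j))^{m_j}}{a}\quad\text{on }\mathbb D,$$ and write $W_{v,\varphi}f=v\cdot (f\circ\varphi)$. Then the following are equivalent: (i) $W_{u,\varphi}$ is a (bounded) Hilbert–Schmidt operator from $\mathscr H(b)$ to itself, for the usual norm of $\mathscr H(b)$; (i') the same for the equivalent norm $\|ag+p\|^2=\|g\|_{H^2}^2+\|p\|_{H^2}^2$; (ii) $W_{w,\varphi}$ is a (bounded) Hilbert–Schmidt operator from $H^2$ to itself; (iii) $\displaystyle\int_{\mathbb T}\frac{|w(\zeta)|^2}{1-|\varphi(\zeta)|^2}\,dm(\zeta)<\infty$, where $m$ is normalized Lebesgue measure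 on $\mathbb T$, $w(\zeta)$ and $\varphi(\zeta)$ are the boundary values (radial limits), and the integrand is read as $+\infty$ where $|\varphi(\zeta)|=1$ and $w(\zeta)\ne0$, and as $0$ where $w(\zeta)=0$. -/

import Mathlib

open Set Filter Topology MeasureTheory Polynomial

noncomputable section

/-- The open unit disc of the complex plane. -/
abbrev disc : Set ℂ := Metric.ball (0 : ℂ) 1

/-! ### The Hardy space -/

/-- The Hardy space `H²` of the disc, as the Hilbert space of square-summable sequences of
Taylor coefficients. -/
abbrev H2 : Type := lp (fun _ : ℕ => ℂ) 2

/-- The analytic function on the disc with Taylor coefficients `f`. -/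
def H2.fn (f : H2) (z : ℂ) : ℂ := ∑' n : ℕ, f n * z ^ n

open Classical in
/-- The analytic Toeplitz operator `T_b`, i.e. the operator of multiplication by `b` on `H²`.
It exists, and is unique, as soon as `b` is bounded and analytic on the disc; for functions `b`
that are not multipliers of `H²` the value is `0` by convention. -/
def toeplitz (b : ℂ → ℂ) : H2 →L[ℂ] H2 :=
  if h : ∃ T : H2 →L[ℂ] H2, ∀ f : H2, ∀ z ∈ disc, (T f).fn z = b z * f.fn z
  then h.choose else 0

/-! ### The de Branges–Rovnyak space -/

/-- The positive square root of a positive operator on a Hilbert space. -/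
def opSqrt {H : Type} [NormedAddCommGroup H] [InnerProductSpace ℂ H] [CompleteSpace H]
    (T : H →L[ℂ] H) : H →L[ℂ] H := CFC.sqrt T

/-- The defect operator `(I - T_b T_b^*)^{1/2}` on `H²`. -/
def defect (b : ℂ → ℂ) : H2 →L[ℂ] H2 :=
  opSqrt (1 - toeplitz b * (toeplitz b).adjoint)

/-- The de Branges–Rovnyak space `H(b)` with its usual Hilbert space structure. It is the range of
`D = (I - T_b T_b^*)^{1/2}` with the range norm, which makes `D` a partial isometry from `H²` onto
`H(b)`: the element `D h`, with `h` orthogonal to the kernel of `D`, is represented by `h`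
and has norm `‖h‖`. -/
abbrev Hb (b : ℂ → ℂ) : Type := ((defect b).ker)ᗮ

/-- The function on the disc that is given by an element of `H(b)`. -/
def Hb.fn {b : ℂ → ℂ} (f : Hb b) (z : ℂ) : ℂ := (defect b (f : H2)).fn z

/-- The function `f`, considered on the disc only, belongs to `H(b)`. -/
def MemHb (b f : ℂ → ℂ) : Prop := ∃ g : Hb b, ∀ z ∈ disc, f z = g.fn z

/-! ### Rational symbols and the Pythagorean mate -/

/-- The function defined by a rational fraction. -/
def ratFn (r : RatFunc ℂ) (z : ℂ) : ℂ := r.eval (RingHom.id ℂ) z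

/-- `A` is the Pythagorean mate of the rational function `b`: the outer function with
`|A|² + |b|² = 1` on the circle and `A(0) > 0`. A rational function without
poles in the closed disc is outer exactly when it has no zeros in the open disc. -/
structure IsPythagoreanMate (b A : RatFunc ℂ) : Prop where
  no_poles : ∀ z : ℂ, ‖z‖ ≤ 1 → A.denom.eval z ≠ 0
  no_zeros : ∀ z ∈ disc, ratFn A z ≠ 0
  pos_zero : 0 < (ratFn A 0).re ∧ (ratFn A 0).im = 0
  sq_add_sq : ∀ z : ℂ, ‖z‖ = 1 → ‖ratFn A z‖ ^ 2 + ‖ratFn b z‖ ^ 2 = 1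

/-- The zeros of `A` on the unit circle. -/
def circleZeros (A : RatFunc ℂ) : Finset ℂ := by
  classical exact A.num.roots.toFinset.filter (fun ζ => ‖ζ‖ = 1)

/-- The multiplicity of `ζ` as a zero of `A`. -/
def zeroMult (A : RatFunc ℂ) (ζ : ℂ) : ℕ := A.num.rootMultiplicity ζ

/-- The polynomial `a(z) = ∏ (z - ζ)^{m(ζ)}`, over the zeros `ζ` of `A` on the circle. -/
def aFn (A : RatFunc ℂ) (z : ℂ) : ℂ := ∏ ζ ∈ circleZeros A, (z - ζ) ^ zeroMult A ζ

/-- The degree `N` of `a`. -/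
def aDeg (A : RatFunc ℂ) : ℕ := ∑ ζ ∈ circleZeros A, zeroMult A ζ

/-- The Hilbert space of pairs `(g, p)`, with `g` in `H²` and `p` a polynomial of degree less
than `N` (given by its coefficients), with the norm `‖(g, p)‖² = ‖g‖² + ‖p‖²`, where both norms on
the right are those of `H²`. -/
abbrev HbSum (A : RatFunc ℂ) : Type := WithLp 2 (H2 × EuclideanSpace ℂ (Fin (aDeg A)))

/-- The function `a g + p` on the disc. Through this map `HbSum A` is the space
`H(b) = a H² ⊕ P_{N-1}` with the norm `‖a g + p‖² = ‖g‖² + ‖p‖²`. -/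
def HbSum.fn {A : RatFunc ℂ} (f : HbSum A) (z : ℂ) : ℂ :=
  aFn A z * f.fst.fn z + ∑ k : Fin (aDeg A), f.snd k * z ^ (k : ℕ)

/-! ### Boundary values -/

/-- Non-tangential approach to the point `ζ` of the unit circle from within the disc: a function
converges along this filter iff it converges, to the same limit, in every Stolz region at `ζ`. -/
def nonTangential (ζ : ℂ) : Filter ℂ :=
  ⨆ M : ℝ, 𝓝[{z : ℂ | ‖z‖ < 1 ∧ ‖z - ζ‖ < M * (1 - ‖z‖)}] ζ

/-- The non-tangential limit of `f` at `ζ`. -/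
def ntLim (f : ℂ → ℂ) (ζ : ℂ) : ℂ := limUnder (nonTangential ζ) f

/-- The boundary function (radial limit) of `f`, at the point `ζ` of the unit circle. -/
def boundaryFn (f : ℂ → ℂ) (ζ : ℂ) : ℂ :=
  limUnder (𝓝[<] (1 : ℝ)) (fun r : ℝ => f ((r : ℂ) * ζ))

/-! ### The associated weight -/

/-- The zeros `ζ` of `A` on the circle, say of multiplicity `m`, where some derivative of `u` of
order at most `m - 1` does not vanish and where `φ(ζ)` lies in the open disc. -/
def innerZeros (A : RatFunc ℂ) (u φ : ℂ → ℂ) : Finset ℂ := by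
  classical exact (circleZeros A).filter (fun ζ =>
    (∃ l < zeroMult A ζ, ntLim (iteratedDeriv l u) ζ ≠ 0) ∧ ntLim φ ζ ∈ disc)

/-- The weight `w = u · (a ∘ φ) · ∏ (φ - φ(ζ))^{m(ζ)} / a`, the product being over `innerZeros`. -/
def weight (A : RatFunc ℂ) (u φ : ℂ → ℂ) (z : ℂ) : ℂ :=
  u z * aFn A (φ z) * (∏ ζ ∈ innerZeros A u φ, (φ z - ntLim φ ζ) ^ zeroMult A ζ) / aFn A z

/-! ### Hilbert–Schmidt operators -/

/-- A bounded operator `T` is Hilbert–Schmidt: `∑ ‖T eᵢ‖² < ∞` for an orthonormal basis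
(equivalently, for every one). -/
def IsHilbertSchmidt {E : Type} [NormedAddCommGroup E] [InnerProductSpace ℂ E]
    (T : E →L[ℂ] E) : Prop :=
  ∃ (s : Set E) (e : HilbertBasis s ℂ E), Summable (fun i => ‖T (e i)‖ ^ 2)

/-- Let the Hilbert space `E` be a space of functions on the disc through `fn`. The weighted
composition operator `f ↦ u · (f ∘ φ)` is a Hilbert–Schmidt operator from `E` to `E`. -/
def IsHSWeightedComp {E : Type} [NormedAddCommGroup E] [InnerProductSpace ℂ E]
    (fn : E → ℂ → ℂ) (u φ : ℂ → ℂ) : Prop :=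
  ∃ T : E →L[ℂ] E, (∀ f : E, ∀ z ∈ disc, fn (T f) z = u z * fn f (φ z)) ∧ IsHilbertSchmidt T

/-- The integral `∫ |w|² / (1 - |φ|²) dm` over the unit circle, for the boundary functions of `w`
and `φ` and normalized Lebesgue measure `m`, with values in `[0, ∞]`. The integrand is infinite
where `|φ| = 1` and `w ≠ 0`, and it is zero where `w = 0`. -/
def hsIntegral (w φ : ℂ → ℂ) : ENNReal :=
  (ENNReal.ofReal (2 * Real.pi))⁻¹ * ∫⁻ t in Ioc (0 : ℝ) (2 * Real.pi),
    ENNReal.ofReal (‖boundaryFn w (Complex.exp (t * Complex.I))‖ ^ 2) /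
      ENNReal.ofReal (1 - ‖boundaryFn φ (Complex.exp (t * Complex.I))‖ ^ 2)

end

/-- Hilbert–Schmidt maps between two Hilbert spaces. -/
def HSMap {E F : Type} [NormedAddCommGroup E] [InnerProductSpace ℂ E]
    [NormedAddCommGroup F] [InnerProductSpace ℂ F] (T : E →L[ℂ] F) : Prop :=
  ∃ (s : Set E) (e : HilbertBasis s ℂ E), Summable (fun i => ‖T (e i)‖ ^ 2)

section HS

variable {E F G : Type} [NormedAddCommGroup E] [InnerProductSpace ℂ E]
  [NormedAddCommGroup F] [InnerProductSpace ℂ F] [NormedAddCommGroup G] [InnerProductSpace ℂ G]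

theorem HilbertBasis.enorm_sq_eq {ι : Type*} (e : HilbertBasis ι ℂ E) (x : E) :
    ‖x‖ₑ ^ 2 = ∑' i, ‖inner ℂ (e i) x‖ₑ ^ 2 := by
  have h := e.hasSum_inner_mul_inner x x
  have h2 : HasSum (fun i => ‖inner ℂ (e i) x‖ ^ 2) (‖x‖ ^ 2) := by
    have h3 := Complex.hasSum_re h
    have h4 : (inner ℂ x x).re = ‖x‖ ^ 2 := by
      rw [inner_self_eq_norm_sq_to_K]; norm_cast
    rw [h4] at h3
    convert h3 using 2 with i
    rw [← inner_conj_symm x (e i), mul_comm, RCLike.mul_conj]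
    norm_cast
  have h5 : ∀ y : ℝ, 0 ≤ y → ‖y‖ₑ ^ 2 = ENNReal.ofReal (y ^ 2) := by
    intro y hy
    rw [Real.enorm_eq_ofReal hy, ENNReal.ofReal_pow hy]
  have h6 : ‖x‖ₑ ^ 2 = ENNReal.ofReal (‖x‖ ^ 2) := by rw [← h5 _ (norm_nonneg _), enorm_norm]
  rw [h6, ← h2.tsum_eq, ENNReal.ofReal_tsum_of_nonneg (fun _ => by positivity) h2.summable]
  congr 1 with i
  rw [← h5 _ (norm_nonneg _), enorm_norm]

theorem summable_norm_sq_iff {H ι : Type*} [NormedAddCommGroup H] (v : ι → H) :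
    Summable (fun i => ‖v i‖ ^ 2) ↔ ∑' i, ‖v i‖ₑ ^ 2 ≠ ⊤ := by
  have : ∀ i, ‖v i‖ₑ ^ 2 = ((‖v i‖₊ ^ 2 : NNReal) : ENNReal) := fun i => by
    rw [enorm_eq_nnnorm]; norm_cast
  simp_rw [this]
  rw [ENNReal.tsum_coe_ne_top_iff_summable, ← NNReal.summable_coe]
  simp

theorem HSMap.comp_left {T : E →L[ℂ] F} (h : HSMap T) (S : F →L[ℂ] G) : HSMap (S ∘L T) := by
  obtain ⟨s, e, h⟩ := h
  refine ⟨s, e, Summable.of_nonneg_of_le (fun _ => by positivity) (fun i => ?_)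
    (h.mul_left (‖S‖ ^ 2))⟩
  rw [← mul_pow]
  exact pow_le_pow_left₀ (norm_nonneg _) (S.le_opNorm _) 2

variable [CompleteSpace E] [CompleteSpace F]

theorem tsum_enorm_sq_adjoint {ι κ : Type*} (e : HilbertBasis ι ℂ E) (f : HilbertBasis κ ℂ F)
    (T : E →L[ℂ] F) : ∑' i, ‖T (e i)‖ₑ ^ 2 = ∑' j, ‖T.adjoint (f j)‖ₑ ^ 2 := by
  simp_rw [f.enorm_sq_eq, e.enorm_sq_eq]
  rw [ENNReal.tsum_comm]
  congr 1 with j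
  congr 1 with i
  rw [ContinuousLinearMap.adjoint_inner_right, ← ofReal_norm, ← ofReal_norm, norm_inner_symm]

theorem HSMap.summable {ι : Type*} {T : E →L[ℂ] F} (h : HSMap T) (e : HilbertBasis ι ℂ E) :
    Summable (fun i => ‖T (e i)‖ ^ 2) := by
  obtain ⟨s, e', h⟩ := h
  obtain ⟨t, f, -⟩ := exists_hilbertBasis ℂ F
  rw [summable_norm_sq_iff] at h ⊢
  rwa [tsum_enorm_sq_adjoint e f, ← tsum_enorm_sq_adjoint e' f]

theorem HSMap.adjoint {T : E →L[ℂ] F} (h : HSMap T) : HSMap T.adjoint := by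
  obtain ⟨s, e, h⟩ := h
  obtain ⟨t, f, -⟩ := exists_hilbertBasis ℂ F
  refine ⟨t, f, ?_⟩
  rw [summable_norm_sq_iff] at h ⊢
  rwa [← tsum_enorm_sq_adjoint e f]

theorem HSMap.of_basis {ι : Type*} {T : E →L[ℂ] F} (e : HilbertBasis ι ℂ E)
    (h : Summable (fun i => ‖T (e i)‖ ^ 2)) : HSMap T := by
  obtain ⟨s, e', -⟩ := exists_hilbertBasis ℂ E
  obtain ⟨t, f, -⟩ := exists_hilbertBasis ℂ F
  refine ⟨s, e', ?_⟩
  rw [summable_norm_sq_iff] at h ⊢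
  rwa [tsum_enorm_sq_adjoint e' f, ← tsum_enorm_sq_adjoint e f]

theorem HSMap.comp_right [CompleteSpace G] {T : E →L[ℂ] F} (h : HSMap T) (R : G →L[ℂ] E) :
    HSMap (T ∘L R) := by
  have := (h.adjoint.comp_left R.adjoint).adjoint
  rwa [← ContinuousLinearMap.adjoint_comp, ContinuousLinearMap.adjoint_adjoint] at this

theorem HSMap.add {S T : E →L[ℂ] F} (hS : HSMap S) (hT : HSMap T) : HSMap (S + T) := by
  obtain ⟨s, e, hS⟩ := hS
  have hT := hT.summable e
  refine ⟨s, e, Summable.of_nonneg_of_le (fun _ => by positivity) (fun i => ?_)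
    ((hS.add hT).mul_left 2)⟩
  have h1 := norm_add_le (S (e i)) (T (e i))
  have h2 := pow_le_pow_left₀ (norm_nonneg _) h1 2
  simp only [add_apply]
  nlinarith [sq_nonneg (‖S (e i)‖ - ‖T (e i)‖)]

theorem HSMap.of_finiteDimensional [FiniteDimensional ℂ F] (T : E →L[ℂ] F) : HSMap T := by
  have : HSMap T.adjoint :=
    HSMap.of_basis (stdOrthonormalBasis ℂ F).toHilbertBasis (Summable.of_finite)
  simpa using this.adjoint

theorem exists_rightInverse_of_surjective (Y : E →L[ℂ] F) (hY : Function.Surjective Y) :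
    ∃ R : F →L[ℂ] E, ∀ y, Y (R y) = y := by
  let K := (Y.ker)ᗮ
  let Y' : K →L[ℂ] F := Y ∘L K.subtypeL
  have hinj : Function.Injective Y' := by
    rw [injective_iff_map_eq_zero]
    intro x hx
    have h1 : (x : E) ∈ Y.ker := hx
    have h2 := Submodule.inner_right_of_mem_orthogonal h1 x.2
    exact Subtype.ext (inner_self_eq_zero.1 h2)
  have hsurj : Function.Surjective Y' := by
    intro y
    obtain ⟨x, rfl⟩ := hY y
    refine ⟨⟨x - Y.ker.starProjection x, Submodule.sub_starProjection_mem_orthogonal x⟩, ?_⟩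
    have : Y (Y.ker.starProjection x) = 0 := Submodule.starProjection_apply_mem Y.ker x
    simp [Y', this]
  let e := ContinuousLinearEquiv.ofBijective Y' (LinearMap.ker_eq_bot.2 hinj)
    (LinearMap.range_eq_top.2 hsurj)
  refine ⟨K.subtypeL ∘L e.symm.toContinuousLinearMap, fun y => ?_⟩
  exact e.apply_symm_apply y

theorem HSMap.of_comp_surjective [CompleteSpace G] {T : E →L[ℂ] F} {Y : G →L[ℂ] E}
    (hY : Function.Surjective Y) (h : HSMap (T ∘L Y)) : HSMap T := by
  obtain ⟨R, hR⟩ := exists_rightInverse_of_surjective Y hY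
  have := h.comp_right R
  convert this using 1
  ext x
  simp [hR]

end HS

/-- A Hilbert space of functions on the disc with continuous point evaluations, given by `fn`. -/
structure IsFunSpace {E : Type} [NormedAddCommGroup E] [InnerProductSpace ℂ E]
    (fn : E → ℂ → ℂ) : Prop where
  add : ∀ f g : E, ∀ z ∈ disc, fn (f + g) z = fn f z + fn g z
  smul : ∀ (c : ℂ) (f : E), ∀ z ∈ disc, fn (c • f) z = c * fn f z
  bound : ∀ z ∈ disc, ∃ C : ℝ, ∀ f : E, ‖fn f z‖ ≤ C * ‖f‖
  inj : ∀ f : E, (∀ z ∈ disc, fn f z = 0) → f = 0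

namespace IsFunSpace

variable {E F : Type} [NormedAddCommGroup E] [InnerProductSpace ℂ E]
  [NormedAddCommGroup F] [InnerProductSpace ℂ F] {fn : E → ℂ → ℂ} {gn : F → ℂ → ℂ}

theorem sub (h : IsFunSpace fn) (f g : E) {z : ℂ} (hz : z ∈ disc) :
    fn (f - g) z = fn f z - fn g z := by
  have h1 := h.smul (-1) g z hz
  have h2 := h.add f ((-1 : ℂ) • g) z hz
  rw [h1] at h2
  rw [sub_eq_add_neg, ← neg_one_smul ℂ g, h2]; ring

theorem ext (h : IsFunSpace fn) {f g : E} (hfg : ∀ z ∈ disc, fn f z = fn g z) : f = g := by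
  rw [← sub_eq_zero]
  exact h.inj _ fun z hz => by rw [h.sub f g hz, hfg z hz, sub_self]

theorem zero (h : IsFunSpace fn) {z : ℂ} (hz : z ∈ disc) : fn 0 z = 0 := by
  simpa using h.smul 0 0 z hz

/-- The evaluation functional at a point. -/
theorem exists_eval (h : IsFunSpace fn) {z : ℂ} (hz : z ∈ disc) :
    ∃ ℓ : E →L[ℂ] ℂ, ∀ f, ℓ f = fn f z := by
  obtain ⟨C, hC⟩ := h.bound z hz
  exact ⟨LinearMap.mkContinuous
    { toFun := fun f => fn f z, map_add' := fun f g => h.add f g z hz,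
      map_smul' := fun c f => h.smul c f z hz } C hC, fun f => rfl⟩

theorem continuous (h : IsFunSpace fn) {z : ℂ} (hz : z ∈ disc) : Continuous fun f => fn f z := by
  obtain ⟨ℓ, hℓ⟩ := h.exists_eval hz
  simpa [← hℓ] using ℓ.continuous

theorem sum (h : IsFunSpace fn) {ι : Type*} (s : Finset ι) (f : ι → E) {z : ℂ} (hz : z ∈ disc) :
    fn (∑ i ∈ s, f i) z = ∑ i ∈ s, fn (f i) z := by
  obtain ⟨ℓ, hℓ⟩ := h.exists_eval hz
  simp [← hℓ]

/-- By the closed graph theorem, a weighted composition map between spaces of functions is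
bounded. -/
theorem exists_weightedComp [CompleteSpace E] [CompleteSpace F] (hE : IsFunSpace fn)
    (hF : IsFunSpace gn) {u φ : ℂ → ℂ} (hφ : MapsTo φ disc disc)
    (H : ∀ f : E, ∃ g : F, ∀ z ∈ disc, gn g z = u z * fn f (φ z)) :
    ∃ T : E →L[ℂ] F, ∀ f : E, ∀ z ∈ disc, gn (T f) z = u z * fn f (φ z) := by
  choose g hg using H
  let L : E →ₗ[ℂ] F :=
    { toFun := g
      map_add' := fun f₁ f₂ => hF.ext fun z hz => by
        rw [hF.add _ _ z hz, hg _ z hz, hg _ z hz, hg _ z hz, hE.add _ _ _ (hφ hz)]; ring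
      map_smul' := fun c f => hF.ext fun z hz => by
        rw [RingHom.id_apply, hF.smul _ _ z hz, hg _ z hz, hg _ z hz, hE.smul _ _ _ (hφ hz)]
        ring }
  refine ⟨ContinuousLinearMap.ofSeqClosedGraph (g := L) ?_, fun f z hz => hg f z hz⟩
  intro s x y hx hy
  refine hF.ext fun z hz => ?_
  have h1 := ((hF.continuous hz).tendsto y).comp hy
  have h2 := (((hE.continuous (hφ hz)).tendsto x).comp hx).const_mul (u z)
  have h3 : gn (L x) z = u z * fn x (φ z) := hg x z hz
  rw [h3]
  refine tendsto_nhds_unique h1 (h2.congr fun n => ?_)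
  exact (hg (s n) z hz).symm

end IsFunSpace

theorem mem_disc {z : ℂ} : z ∈ disc ↔ ‖z‖ < 1 := mem_ball_zero_iff

namespace H2

theorem norm_sq_eq (f : H2) : ‖f‖ ^ 2 = ∑' n, ‖f n‖ ^ 2 := by
  have := lp.norm_rpow_eq_tsum (p := 2) (by norm_num) f
  simpa using this

theorem summable_norm_sq (f : H2) : Summable fun n => ‖f n‖ ^ 2 := by
  have := (lp.memℓp f).summable (by norm_num)
  simpa using this

theorem exists_of_summable (c : ℕ → ℂ) (h : Summable fun n => ‖c n‖ ^ 2) :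
    ∃ f : H2, ∀ n, f n = c n :=
  ⟨⟨c, memℓp_gen (by simpa using h)⟩, fun _ => rfl⟩

/-- The reproducing kernel of `H²` at `z`. -/
noncomputable def kernel (z : disc) : H2 :=
  ⟨fun n => starRingEnd ℂ (z : ℂ) ^ n, memℓp_gen (by
    have h : ‖(z : ℂ)‖ < 1 := mem_disc.1 z.2
    have := summable_geometric_of_lt_one (sq_nonneg ‖(z : ℂ)‖) (by nlinarith [norm_nonneg (z : ℂ)])
    simpa [← pow_mul, mul_comm] using this)⟩

theorem kernel_apply (z : disc) (n : ℕ) : kernel z n = starRingEnd ℂ (z : ℂ) ^ n := rfl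

theorem fn_eq_inner (f : H2) (z : disc) : f.fn z = inner ℂ (kernel z) f := by
  rw [lp.inner_eq_tsum, H2.fn]
  congr 1 with n
  simp [kernel_apply]

theorem norm_kernel_sq (z : disc) : ‖kernel z‖ ^ 2 = (1 - ‖(z : ℂ)‖ ^ 2)⁻¹ := by
  have h : ‖(z : ℂ)‖ < 1 := mem_disc.1 z.2
  rw [norm_sq_eq, ← tsum_geometric_of_lt_one (sq_nonneg ‖(z : ℂ)‖) (by nlinarith [norm_nonneg (z : ℂ)])]
  congr 1 with n
  simp [kernel_apply, ← pow_mul, mul_comm]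

theorem norm_fn_sq_le (f : H2) {z : ℂ} (hz : z ∈ disc) :
    ‖f.fn z‖ ^ 2 ≤ ‖f‖ ^ 2 * (1 - ‖z‖ ^ 2)⁻¹ := by
  have h1 := norm_inner_le_norm (𝕜 := ℂ) (kernel ⟨z, hz⟩) f
  rw [← norm_kernel_sq ⟨z, hz⟩, ← mul_pow, mul_comm ‖f‖]
  exact pow_le_pow_left₀ (norm_nonneg _) (by rw [← fn_eq_inner] at h1; exact h1) 2

theorem hasSum_fn (f : H2) {z : ℂ} (hz : z ∈ disc) : HasSum (fun n => f n * z ^ n) (f.fn z) := by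
  have := lp.hasSum_inner (𝕜 := ℂ) (kernel ⟨z, hz⟩) f
  rw [← fn_eq_inner] at this
  refine Eq.mp (congrArg (fun g : ℕ → ℂ => HasSum g _) (funext fun n => ?_)) this
  simp [kernel_apply]

theorem hasFPowerSeriesOnBall (f : H2) :
    HasFPowerSeriesOnBall f.fn (FormalMultilinearSeries.ofScalars ℂ (fun n => f n)) 0 1 := by
  have h : 1 ≤ (FormalMultilinearSeries.ofScalars ℂ (fun n => f n)).radius := by
    have := FormalMultilinearSeries.le_radius_of_bound
      (FormalMultilinearSeries.ofScalars ℂ (fun n => f n)) (r := 1) ‖f‖ (fun n => by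
        simpa using lp.norm_apply_le_norm (by norm_num) f n)
    simpa using this
  have h2 := (FormalMultilinearSeries.ofScalars ℂ (fun n => f n)).hasFPowerSeriesOnBall
    (lt_of_lt_of_le (by norm_num) h)
  have h3 := h2.mono (by norm_num) h
  refine h3.congr fun z _ => ?_
  simp [H2.fn, FormalMultilinearSeries.sum, mul_comm]

theorem differentiableOn (f : H2) : DifferentiableOn ℂ f.fn disc := by
  have := f.hasFPowerSeriesOnBall.differentiableOn
  rwa [← ENNReal.ofReal_one, Metric.eball_ofReal] at this

theorem ext_of_fn {f g : H2} (h : ∀ z ∈ disc, f.fn z = g.fn z) : f = g := by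
  have h1 := f.hasFPowerSeriesOnBall
  have h2 := g.hasFPowerSeriesOnBall
  have h3 : HasFPowerSeriesOnBall f.fn (FormalMultilinearSeries.ofScalars ℂ (fun n => g n)) 0 1 := by
    refine h2.congr fun z hz => (h z ?_).symm
    rwa [← ENNReal.ofReal_one, Metric.eball_ofReal] at hz
  have h4 := h1.hasFPowerSeriesAt.eq_formalMultilinearSeries h3.hasFPowerSeriesAt
  ext n
  have := congrArg (fun p => p.coeff n) h4
  simpa using this

theorem fn_add (f g : H2) {z : ℂ} (hz : z ∈ disc) : (f + g).fn z = f.fn z + g.fn z := by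
  rw [fn_eq_inner _ ⟨z, hz⟩, fn_eq_inner _ ⟨z, hz⟩, fn_eq_inner _ ⟨z, hz⟩, inner_add_right]

theorem fn_smul (c : ℂ) (f : H2) (z : ℂ) : (c • f).fn z = c * f.fn z := by
  simp only [H2.fn, lp.coeFn_smul, Pi.smul_apply, smul_eq_mul, mul_assoc]
  exact tsum_mul_left

theorem isFunSpace : IsFunSpace H2.fn where
  add f g z hz := fn_add f g hz
  smul c f z _ := fn_smul c f z
  bound z hz := ⟨‖kernel ⟨z, hz⟩‖, fun f => by
    rw [fn_eq_inner _ ⟨z, hz⟩]; exact norm_inner_le_norm _ _⟩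
  inj f hf := ext_of_fn fun z hz => by rw [hf z hz]; simp [H2.fn]

/-- A polynomial, as an element of `H²`. -/
noncomputable def ofPoly : ℂ[X] →ₗ[ℂ] H2 where
  toFun p := ⟨fun n => p.coeff n, by
    refine (memℓp_zero ?_).of_exponent_ge (zero_le)
    refine (Finset.range (p.natDegree + 1)).finite_toSet.subset fun n hn => ?_
    simp only [Finset.coe_range, mem_Iio]
    by_contra h
    exact hn (coeff_eq_zero_of_natDegree_lt (by omega))⟩
  map_add' p q := by ext n; exact coeff_add p q n
  map_smul' c p := by ext n; exact coeff_smul c p n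

theorem ofPoly_apply (p : ℂ[X]) (n : ℕ) : ofPoly p n = p.coeff n := rfl

theorem fn_ofPoly (p : ℂ[X]) (z : ℂ) : (ofPoly p).fn z = p.eval z := by
  rw [H2.fn, eval_eq_sum_range]
  rw [tsum_eq_sum (s := Finset.range (p.natDegree + 1))]
  · rfl
  · intro n hn
    rw [ofPoly_apply, coeff_eq_zero_of_natDegree_lt (by simpa using hn), zero_mul]

/-- The monomials form an orthonormal basis. -/
noncomputable def basis : HilbertBasis ℕ ℂ H2 := HilbertBasis.ofRepr (LinearIsometryEquiv.refl ℂ H2)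

theorem basis_apply (n : ℕ) : basis n = ofPoly (X ^ n) := by
  ext k
  rw [ofPoly_apply, coeff_X_pow, ← HilbertBasis.repr_symm_single]
  change (lp.single 2 n (1 : ℂ) : ℕ → ℂ) k = _
  rw [lp.single_apply, Pi.single_apply]

theorem hasSum_ofPoly (f : H2) : HasSum (fun n => f n • ofPoly (X ^ n)) f := by
  have := basis.hasSum_repr f
  simp only [basis_apply] at this
  exact this

theorem fn_basis (n : ℕ) (z : ℂ) : (basis n).fn z = z ^ n := by
  rw [basis_apply, fn_ofPoly]; simp

theorem norm_ofPoly_sq (p : ℂ[X]) {d : ℕ} (hd : p.natDegree < d) :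
    ‖ofPoly p‖ ^ 2 = ∑ n ∈ Finset.range d, ‖p.coeff n‖ ^ 2 := by
  rw [norm_sq_eq, tsum_eq_sum (s := Finset.range d)]
  · rfl
  · intro n hn
    rw [ofPoly_apply, coeff_eq_zero_of_natDegree_lt (by simp at hn; omega)]; simp

theorem dense_ofPoly : DenseRange ofPoly := by
  intro f
  refine mem_closure_of_tendsto (hasSum_ofPoly f) (Eventually.of_forall fun s => ?_)
  exact ⟨∑ n ∈ s, f n • X ^ n, by simp⟩

end H2

/-- Taylor expansion on the disc. -/
theorem exists_taylor {F : ℂ → ℂ} (hF : DifferentiableOn ℂ F disc) :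
    ∃ c : ℕ → ℂ, ∀ z ∈ disc, HasSum (fun n => c n * z ^ n) (F z) := by
  refine ⟨fun n => (n.factorial : ℂ)⁻¹ * iteratedDeriv n F 0, fun z hz => ?_⟩
  have := Complex.hasSum_taylorSeries_on_ball hF hz
  refine Eq.mp (congrArg (fun g : ℕ → ℂ => HasSum g _) (funext fun n => ?_)) this
  simp only [sub_zero, smul_eq_mul]; ring

section PoissonKernel

/-- The Poisson kernel of the disc at radius `r`, in angular form. -/
noncomputable def poissonAngular (r t : ℝ) : ℝ := (1 - r ^ 2) / (1 - 2 * r * Real.cos t + r ^ 2)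

/-- Minus the angular derivative of the Poisson kernel. -/
noncomputable def poissonAngularDeriv (r t : ℝ) : ℝ :=
  (1 - r ^ 2) * (2 * r * Real.sin t) / (1 - 2 * r * Real.cos t + r ^ 2) ^ 2

theorem poisson_denom_pos {r : ℝ} (hr : r < 1) (hr0 : 0 ≤ r) (t : ℝ) :
    0 < 1 - 2 * r * Real.cos t + r ^ 2 := by
  nlinarith [Real.cos_le_one t, sq_nonneg (1 - r), mul_nonneg hr0 (sub_nonneg.2 (Real.cos_le_one t))]

theorem hasDerivAt_poissonAngular {r : ℝ} (hr : r < 1) (hr0 : 0 ≤ r) (t : ℝ) :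
    HasDerivAt (poissonAngular r) (-poissonAngularDeriv r t) t := by
  have h1 : HasDerivAt (fun t => 1 - 2 * r * Real.cos t + r ^ 2) (2 * r * Real.sin t) t := by
    have := ((Real.hasDerivAt_cos t).const_mul (2 * r)).const_sub 1 |>.add_const (r ^ 2)
    exact this.congr_deriv (by ring)
  have h2 := (hasDerivAt_const t (1 - r ^ 2)).div h1 (poisson_denom_pos hr hr0 t).ne'
  exact h2.congr_deriv (by rw [poissonAngularDeriv]; ring)

theorem continuous_poissonAngularDeriv {r : ℝ} (hr : r < 1) (hr0 : 0 ≤ r) :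
    Continuous (poissonAngularDeriv r) := by
  unfold poissonAngularDeriv
  refine Continuous.div (by fun_prop) (by fun_prop) fun t => ?_
  exact pow_ne_zero _ (poisson_denom_pos hr hr0 t).ne'

theorem integral_poissonAngular {r : ℝ} (hr : r < 1) (hr0 : 0 ≤ r) (k : ℕ) :
    ∫ t in (-Real.pi)..Real.pi, (poissonAngular r t : ℂ) * Complex.exp (k * t * Complex.I)
      = 2 * Real.pi * (r : ℂ) ^ k := by
  have hd : DiffContOnCl ℂ (fun z : ℂ => z ^ k) (Metric.ball 0 1) :=
    (differentiable_pow k).diffContOnCl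
  have h := hd.circleAverage_poissonKernel_smul' (w := (r : ℂ)) (by simpa [abs_of_nonneg hr0] using hr)
  rw [Real.circleAverage_eq_integral_add (-Real.pi),
    intervalIntegral.integral_comp_add_right (fun x => (fun z : ℂ =>
      ((‖z - 0‖ ^ 2 - ‖(r : ℂ) - 0‖ ^ 2) / ‖z - 0 - ((r : ℂ) - 0)‖ ^ 2) • z ^ k) (circleMap 0 1 x))] at h
  have e1 : (0 : ℝ) + -Real.pi = -Real.pi := by ring
  have e2 : 2 * Real.pi + -Real.pi = Real.pi := by ring
  rw [e1, e2] at h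
  have h3 : ∀ x : ℝ, (fun z : ℂ => ((‖z - 0‖ ^ 2 - ‖(r : ℂ) - 0‖ ^ 2) / ‖z - 0 - ((r : ℂ) - 0)‖ ^ 2) • z ^ k)
      (circleMap 0 1 x) = (poissonAngular r x : ℂ) * Complex.exp (k * x * Complex.I) := by
    intro x
    have e3 : circleMap 0 1 x = Complex.exp (x * Complex.I) := by simp [circleMap]
    have e4 : ‖Complex.exp (x * Complex.I) - (r : ℂ)‖ ^ 2 = 1 - 2 * r * Real.cos x + r ^ 2 := by
      rw [← Complex.normSq_eq_norm_sq, Complex.normSq_apply, Complex.sub_re, Complex.sub_im,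
        Complex.exp_ofReal_mul_I_re, Complex.exp_ofReal_mul_I_im, Complex.ofReal_re, Complex.ofReal_im]
      nlinarith [Real.sin_sq_add_cos_sq x]
    simp only [sub_zero, e3, e4, Complex.norm_exp_ofReal_mul_I]
    rw [← Complex.exp_nat_mul, Complex.real_smul, poissonAngular]
    congr 2
    · simp
    · ring
  simp_rw [h3] at h
  rw [Complex.real_smul] at h
  have hpi : (Real.pi : ℂ) ≠ 0 := by exact_mod_cast Real.pi_ne_zero
  rw [← h]
  push_cast
  rw [← mul_assoc, mul_inv_cancel₀ (mul_ne_zero two_ne_zero hpi), one_mul]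

theorem integral_poissonAngularDeriv {r : ℝ} (hr : r < 1) (hr0 : 0 ≤ r) (k : ℕ) :
    ∫ t in (-Real.pi)..Real.pi, (poissonAngularDeriv r t : ℂ) * Complex.exp (k * t * Complex.I)
      = 2 * Real.pi * (Complex.I * k * (r : ℂ) ^ k) := by
  have hu : ∀ x ∈ uIcc (-Real.pi) Real.pi,
      HasDerivAt (fun t : ℝ => (poissonAngular r t : ℂ)) (-(poissonAngularDeriv r x : ℝ) : ℂ) x := by
    intro x _
    have := (hasDerivAt_poissonAngular hr hr0 x).ofReal_comp
    simpa using this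
  have hv : ∀ x ∈ uIcc (-Real.pi) Real.pi, HasDerivAt (fun t : ℝ => Complex.exp (k * t * Complex.I))
      (Complex.exp (k * x * Complex.I) * (k * Complex.I)) x := by
    intro x _
    have h1 : HasDerivAt (fun t : ℝ => (k : ℂ) * t * Complex.I) (k * Complex.I) x := by
      have := ((Complex.ofRealCLM.hasDerivAt (x := x)).const_mul (k : ℂ)).mul_const Complex.I
      simpa using this
    exact h1.cexp
  have hc := continuous_poissonAngularDeriv hr hr0
  have h := intervalIntegral.integral_mul_deriv_eq_deriv_mul hu hv
    (Continuous.intervalIntegrable (by fun_prop) _ _)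
    (Continuous.intervalIntegrable (by fun_prop) _ _)
  have e1 : poissonAngular r (-Real.pi) = poissonAngular r Real.pi := by simp [poissonAngular]
  have e2 : Complex.exp (k * (-Real.pi : ℝ) * Complex.I) = Complex.exp (k * Real.pi * Complex.I) := by
    rw [Complex.exp_eq_exp_iff_exists_int]
    exact ⟨-k, by push_cast; ring⟩
  rw [e1, e2, sub_self, zero_sub] at h
  have h2 := integral_poissonAngular hr hr0 k
  calc _ = ∫ t in (-Real.pi)..Real.pi, (poissonAngular r t : ℂ) *
        (Complex.exp (k * t * Complex.I) * (k * Complex.I)) := by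
        rw [h, ← intervalIntegral.integral_neg]; simp
    _ = (∫ t in (-Real.pi)..Real.pi, (poissonAngular r t : ℂ) *
        Complex.exp (k * t * Complex.I)) * (k * Complex.I) := by
        rw [← intervalIntegral.integral_mul_const]; simp only [mul_assoc]
    _ = _ := by rw [h2]; ring

/-- The coefficientwise form of the convolution with the derivative of the Poisson kernel. -/
theorem integral_poissonAngularDeriv_mul {r : ℝ} (hr : r < 1) (hr0 : 0 ≤ r) {c : ℕ → ℂ}
    (hc : Summable fun k => ‖c k‖) :
    ∫ t in (-Real.pi)..Real.pi, (poissonAngularDeriv r t : ℂ) *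
        (∑' k, c k * Complex.exp (k * t * Complex.I))
      = 2 * Real.pi * ∑' k, c k * (Complex.I * k * (r : ℂ) ^ k) := by
  have hcont := continuous_poissonAngularDeriv hr hr0
  obtain ⟨B, hB⟩ := (isCompact_uIcc (a := -Real.pi) (b := Real.pi)).exists_bound_of_continuousOn
    hcont.continuousOn
  have h := intervalIntegral.hasSum_integral_of_dominated_convergence (μ := volume)
    (a := -Real.pi) (b := Real.pi)
    (F := fun k t => (poissonAngularDeriv r t : ℂ) * (c k * Complex.exp (k * t * Complex.I)))
    (f := fun t => (poissonAngularDeriv r t : ℂ) * (∑' k, c k * Complex.exp (k * t * Complex.I)))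
    (fun k _ => B * ‖c k‖)
    (fun k => (Continuous.aestronglyMeasurable (by fun_prop)))
    (fun k => Eventually.of_forall fun t ht => by
      rw [norm_mul, norm_mul, Complex.norm_real]
      have : ‖Complex.exp (k * t * Complex.I)‖ = 1 := by
        have := Complex.norm_exp_ofReal_mul_I (k * t)
        push_cast at this; exact this
      rw [this, mul_one]
      exact mul_le_mul_of_nonneg_right (hB t (uIoc_subset_uIcc ht)) (norm_nonneg _))
    (Eventually.of_forall fun t _ => hc.mul_left B)
    (by simp)
    (Eventually.of_forall fun t _ => by
      refine (Summable.hasSum ?_).mul_left _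
      refine Summable.of_norm (hc.congr fun k => ?_)
      rw [norm_mul]
      have := Complex.norm_exp_ofReal_mul_I (k * t)
      push_cast at this; rw [this, mul_one])
  rw [← h.tsum_eq, ← tsum_mul_left]
  congr 1 with k
  have := integral_poissonAngularDeriv hr hr0 k
  calc _ = c k * ∫ t in (-Real.pi)..Real.pi, (poissonAngularDeriv r t : ℂ) * Complex.exp (k * t * Complex.I) := by
        rw [← intervalIntegral.integral_const_mul]; congr 1 with t; ring
    _ = _ := by rw [this]; ring

theorem integral_poissonAngularDeriv_mul_sin {r : ℝ} (hr : r < 1) (hr0 : 0 ≤ r) :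
    ∫ t in (-Real.pi)..Real.pi, poissonAngularDeriv r t * Real.sin t = 2 * Real.pi * r := by
  have h := integral_poissonAngularDeriv hr hr0 1
  have hc := continuous_poissonAngularDeriv hr hr0
  have h2 := intervalIntegral.intervalIntegral_im (a := -Real.pi) (b := Real.pi) (μ := volume)
    (f := fun t : ℝ => (poissonAngularDeriv r t : ℂ) * Complex.exp ((1 : ℕ) * t * Complex.I))
    (Continuous.intervalIntegrable (by fun_prop) _ _)
  rw [h] at h2
  convert h2 using 1
  · refine intervalIntegral.integral_congr fun t _ => ?_
    simp only [Nat.cast_one, one_mul, RCLike.im_eq_complex_im, Complex.im_ofReal_mul,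
      Complex.exp_ofReal_mul_I_im]
  · simp only [RCLike.im_eq_complex_im]
    have : 2 * (Real.pi : ℂ) * (Complex.I * (1 : ℕ) * (r : ℂ) ^ 1) = ((2 * Real.pi * r : ℝ) : ℂ) * Complex.I := by
      push_cast; ring
    rw [this]; simp

theorem tendsto_poissonAngularDeriv {c : ℕ → ℂ} (hc : Summable fun k => ‖c k‖) {h' : ℂ}
    (hd : HasDerivAt (fun t : ℝ => ∑' k, c k * Complex.exp (k * t * Complex.I)) h' 0) :
    Tendsto (fun r : ℝ => ∑' k, c k * (Complex.I * k * (r : ℂ) ^ k)) (𝓝[<] 1) (𝓝 h') := by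
  set h : ℝ → ℂ := fun t : ℝ => ∑' k, c k * Complex.exp (k * t * Complex.I) with hh
  have hnorm : ∀ (k : ℕ) (t : ℝ), ‖Complex.exp (k * t * Complex.I)‖ = 1 := fun k t => by
    have := Complex.norm_exp_ofReal_mul_I (k * t)
    push_cast at this; exact this
  have hcont : Continuous h := by
    refine continuous_tsum (fun k => by fun_prop) hc fun k t => ?_
    rw [norm_mul, hnorm, mul_one]
  set ψ : ℝ → ℂ := fun t => h t - h 0 - h' * Real.sin t with hψ
  have hψc : Continuous ψ := by fun_prop
  obtain ⟨M, hM⟩ := (isCompact_uIcc (a := -Real.pi) (b := Real.pi)).exists_bound_of_continuousOn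
    hψc.continuousOn
  have hM0 : 0 ≤ M := (norm_nonneg _).trans (hM 0 (by
    rw [uIcc_of_le (by linarith [Real.pi_pos])]; constructor <;> linarith [Real.pi_pos]))
  have hψo : HasDerivAt ψ 0 0 := by
    have hs : HasDerivAt (fun t : ℝ => h' * (Real.sin t : ℂ)) h' 0 := by
      have := ((Real.hasDerivAt_sin 0).ofReal_comp).const_mul h'
      simpa using this
    have := (hd.sub_const (h 0)).sub hs
    rwa [sub_self] at this
  have key : ∀ r : ℝ, 0 ≤ r → r < 1 → ∫ t in (-Real.pi)..Real.pi, (poissonAngularDeriv r t : ℂ) * ψ t =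
      2 * Real.pi * (∑' k, c k * (Complex.I * k * (r : ℂ) ^ k) - h' * r) := by
    intro r hr0 hr
    have hQ := continuous_poissonAngularDeriv hr hr0
    have e0 := integral_poissonAngularDeriv hr hr0 0
    have e1 := integral_poissonAngularDeriv_mul hr hr0 hc
    have e2 := congrArg (fun x : ℝ => (x : ℂ)) (integral_poissonAngularDeriv_mul_sin hr hr0)
    simp only [← intervalIntegral.integral_ofReal] at e2
    simp only [CharP.cast_eq_zero, zero_mul, Complex.exp_zero, mul_one, mul_zero] at e0
    have : ∀ t, (poissonAngularDeriv r t : ℂ) * ψ t = (poissonAngularDeriv r t : ℂ) * h t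
        - (poissonAngularDeriv r t : ℂ) * h 0 -
        h' * ((poissonAngularDeriv r t * Real.sin t : ℝ) : ℂ) := by
      intro t; simp only [hψ]; push_cast; ring
    simp_rw [this]
    rw [intervalIntegral.integral_sub (Continuous.intervalIntegrable (by fun_prop) _ _)
      (Continuous.intervalIntegrable (by fun_prop) _ _),
      intervalIntegral.integral_sub (Continuous.intervalIntegrable (by fun_prop) _ _)
      (Continuous.intervalIntegrable (by fun_prop) _ _), e1, intervalIntegral.integral_mul_const, e0,
      intervalIntegral.integral_const_mul, e2]
    push_cast; ring
  have hbound : Tendsto (fun r : ℝ => ∑' k, c k * (Complex.I * k * (r : ℂ) ^ k) - h' * r) (𝓝[<] 1) (𝓝 0) := by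
    rw [Metric.tendsto_nhds]
    intro ε hε
    have h1 := hψo.isLittleO
    simp only [sub_zero, smul_zero] at h1
    have h2 := h1.def (c := ε / 8) (by positivity)
    obtain ⟨δ₀, hδ₀, h3⟩ := Metric.eventually_nhds_iff.1 h2
    set δ := min (δ₀ / 2) 1 with hδ
    have hδpos : 0 < δ := by positivity
    have hδ1 : δ ≤ 1 := min_le_right _ _
    have hδ2 : δ < δ₀ := lt_of_le_of_lt (min_le_left _ _) (by linarith)
    have hψδ : ∀ t, |t| ≤ δ → ‖ψ t‖ ≤ ε / 4 * |Real.sin t| := by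
      intro t ht
      have h4 := h3 (y := t) (by rw [Real.dist_eq, sub_zero]; linarith)
      have h5 : ψ 0 = 0 := by simp [hψ]
      rw [h5, sub_zero, Real.norm_eq_abs] at h4
      have h6 : |t| / 2 ≤ |Real.sin t| := by
        have h7 := Real.mul_abs_le_abs_sin (x := t) (by linarith [Real.pi_gt_three])
        have h8 : (1 : ℝ) / 2 ≤ 2 / Real.pi := by
          rw [div_le_div_iff₀ (by norm_num) Real.pi_pos]; linarith [Real.pi_le_four]
        calc |t| / 2 = 1 / 2 * |t| := by ring
          _ ≤ 2 / Real.pi * |t| := mul_le_mul_of_nonneg_right h8 (abs_nonneg _)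
          _ ≤ _ := h7
      calc ‖ψ t‖ ≤ ε / 8 * |t| := h4
        _ ≤ _ := by nlinarith
    set q := 1 - Real.cos δ with hq
    have hqpos : 0 < q := by
      have := Real.cos_lt_cos_of_nonneg_of_le_pi le_rfl (by linarith [Real.pi_gt_three]) hδpos
      rw [Real.cos_zero] at this
      linarith
    have hlim : Tendsto (fun r : ℝ => ε / 4 + M * (2 * (1 - r ^ 2) / q ^ 2)) (𝓝[<] 1) (𝓝 (ε / 4 + M * (2 * (1 - 1 ^ 2) / q ^ 2))) := by
      refine tendsto_nhdsWithin_of_tendsto_nhds (Continuous.tendsto ?_ 1)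
      fun_prop
    have hlim2 := hlim.eventually_lt_const (u := ε / 2) (by norm_num; linarith)
    have h12 : ∀ᶠ r : ℝ in 𝓝[<] 1, 1 / 2 < r :=
      eventually_nhdsWithin_of_eventually_nhds (lt_mem_nhds (by norm_num))
    filter_upwards [hlim2, h12, self_mem_nhdsWithin] with r hr1 hr2 hr3
    have hr3 : r < 1 := hr3
    have hr0 : 0 ≤ r := by linarith
    have hQ := continuous_poissonAngularDeriv hr3 hr0
    have hK := key r hr0 hr3
    have hr2' : 0 ≤ 1 - r ^ 2 := by nlinarith
    have hpt : ∀ t ∈ Icc (-Real.pi) Real.pi, ‖(poissonAngularDeriv r t : ℂ) * ψ t‖ ≤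
        ε / 4 * (poissonAngularDeriv r t * Real.sin t) + M * (2 * (1 - r ^ 2) / q ^ 2) := by
      intro t ht
      have hQs : 0 ≤ poissonAngularDeriv r t * Real.sin t := by
        rw [poissonAngularDeriv, div_mul_eq_mul_div]
        refine div_nonneg ?_ (sq_nonneg _)
        have : (1 - r ^ 2) * (2 * r * Real.sin t) * Real.sin t =
          (1 - r ^ 2) * (2 * r) * (Real.sin t) ^ 2 := by ring
        rw [this]; positivity
      rw [norm_mul, Complex.norm_real, Real.norm_eq_abs]
      rcases le_total |t| δ with htd | htd
      · have h4 := hψδ t htd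
        have h5 : |poissonAngularDeriv r t| * ‖ψ t‖ ≤ ε / 4 * (poissonAngularDeriv r t * Real.sin t) := by
          rw [← abs_of_nonneg hQs, abs_mul]
          calc _ ≤ |poissonAngularDeriv r t| * (ε / 4 * |Real.sin t|) :=
                mul_le_mul_of_nonneg_left h4 (abs_nonneg _)
            _ = _ := by ring
        have : 0 ≤ M * (2 * (1 - r ^ 2) / q ^ 2) := by positivity
        linarith
      · have h4 : Real.cos t ≤ Real.cos δ := by
          rw [← Real.cos_abs t]
          exact Real.cos_le_cos_of_nonneg_of_le_pi hδpos.le (abs_le.2 ht) htd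
        have h5 : q ≤ 1 - 2 * r * Real.cos t + r ^ 2 := by
          rw [hq]; nlinarith [sq_nonneg (1 - r), Real.cos_le_one t]
        have h6 : |poissonAngularDeriv r t| ≤ 2 * (1 - r ^ 2) / q ^ 2 := by
          rw [poissonAngularDeriv, abs_div, abs_sq (1 - 2 * r * Real.cos t + r ^ 2)]
          refine div_le_div₀ (by positivity) ?_ (by positivity) (pow_le_pow_left₀ hqpos.le h5 2)
          rw [abs_mul, abs_mul, abs_of_nonneg hr2', abs_of_nonneg (by positivity)]
          have := Real.abs_sin_le_one t
          calc (1 - r ^ 2) * (2 * r * |Real.sin t|) ≤ (1 - r ^ 2) * 2 :=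
                mul_le_mul_of_nonneg_left (by nlinarith [abs_nonneg (Real.sin t)]) hr2'
            _ = _ := by ring
        have h7 := mul_le_mul h6 (hM t (by rwa [uIcc_of_le (by linarith [Real.pi_pos])]))
          (norm_nonneg _) (by positivity)
        have : 0 ≤ ε / 4 * (poissonAngularDeriv r t * Real.sin t) := by positivity
        linarith
    have hI := intervalIntegral.norm_integral_le_of_norm_le (μ := volume)
      (a := -Real.pi) (b := Real.pi)
      (f := fun t => (poissonAngularDeriv r t : ℂ) * ψ t)
      (g := fun t => ε / 4 * (poissonAngularDeriv r t * Real.sin t) + M * (2 * (1 - r ^ 2) / q ^ 2))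
      (by linarith [Real.pi_pos])
      (Eventually.of_forall fun t ht => hpt t (Ioc_subset_Icc_self ht))
      (Continuous.intervalIntegrable (by fun_prop) _ _)
    rw [hK, intervalIntegral.integral_add (Continuous.intervalIntegrable (by fun_prop) _ _)
      (by simp), intervalIntegral.integral_const_mul,
      integral_poissonAngularDeriv_mul_sin hr3 hr0, intervalIntegral.integral_const, norm_mul] at hI
    have e5 : ‖(2 * Real.pi : ℂ)‖ = 2 * Real.pi := by
      rw [norm_mul, Complex.norm_real, Real.norm_eq_abs, abs_of_pos Real.pi_pos]; simp
    rw [e5, smul_eq_mul] at hI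
    rw [dist_zero_right]
    have hp := Real.pi_pos
    have : 2 * Real.pi * ‖∑' k, c k * (Complex.I * k * (r : ℂ) ^ k) - h' * r‖ < 2 * Real.pi * ε := by
      have h9 : 2 * Real.pi * (ε / 4 * r + M * (2 * (1 - r ^ 2) / q ^ 2)) < 2 * Real.pi * ε := by
        refine mul_lt_mul_of_pos_left ?_ (by positivity)
        nlinarith
      nlinarith
    exact lt_of_mul_lt_mul_left this (by positivity)
  have hr : Tendsto (fun r : ℝ => h' * (r : ℂ)) (𝓝[<] 1) (𝓝 h') := by
    have : Tendsto (fun r : ℝ => h' * (r : ℂ)) (𝓝[<] 1) (𝓝 (h' * (1 : ℝ))) :=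
      tendsto_nhdsWithin_of_tendsto_nhds (Continuous.tendsto (by fun_prop) 1)
    simpa using this
  simpa using hbound.add hr

end PoissonKernel

/-- Arc length measure on the circle, in the angular coordinate. -/
noncomputable abbrev arcMeasure : Measure ℝ := volume.restrict (Ioc (0 : ℝ) (2 * Real.pi))

theorem norm_exp_nat_mul_I (n : ℕ) (t : ℝ) : ‖Complex.exp (n * t * Complex.I)‖ = 1 := by
  have := Complex.norm_exp_ofReal_mul_I (n * t)
  push_cast at this; exact this

theorem memLp_exp (n : ℕ) : MemLp (fun t : ℝ => Complex.exp (n * t * Complex.I)) 2 arcMeasure :=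
  MemLp.of_bound (Continuous.aestronglyMeasurable (by fun_prop)) 1
    (Eventually.of_forall fun t => (norm_exp_nat_mul_I n t).le)

/-- The exponential `t ↦ exp (i n t)` in `L²` of the circle. -/
noncomputable def expLp (n : ℕ) : Lp ℂ 2 arcMeasure := (memLp_exp n).toLp

theorem coeFn_expLp (n : ℕ) : expLp n =ᵐ[arcMeasure] fun t => Complex.exp (n * t * Complex.I) :=
  (memLp_exp n).coeFn_toLp

theorem inner_expLp (m n : ℕ) : inner ℂ (expLp m) (expLp n) = if m = n then 2 * Real.pi else 0 := by
  rw [L2.inner_def]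
  have h : ∫ t, inner ℂ (expLp m t) (expLp n t) ∂arcMeasure =
      ∫ t in (0 : ℝ)..(2 * Real.pi), Complex.exp (((n : ℂ) - m) * Complex.I * t) := by
    rw [intervalIntegral.integral_of_le (by positivity)]
    refine integral_congr_ae ?_
    filter_upwards [coeFn_expLp m, coeFn_expLp n] with t h1 h2
    rw [h1, h2, RCLike.inner_apply, ← Complex.exp_conj, ← Complex.exp_add]
    congr 1
    simp only [map_mul, Complex.conj_I, map_natCast, Complex.conj_ofReal]
    ring
  rw [h]
  split_ifs with hmn
  · simp [hmn]
  · have hne : ((n : ℂ) - m) * Complex.I ≠ 0 :=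
      mul_ne_zero (sub_ne_zero.2 fun h => hmn (by exact_mod_cast h.symm)) Complex.I_ne_zero
    rw [integral_exp_mul_complex hne]
    have : Complex.exp (((n : ℂ) - m) * Complex.I * (2 * Real.pi : ℝ)) = 1 := by
      rw [Complex.exp_eq_one_iff]
      exact ⟨n - m, by push_cast; ring⟩
    rw [this]; simp

theorem H2.exists_sum_expLp (f : H2) : ∃ g : Lp ℂ 2 arcMeasure,
    HasSum (fun n => f n • expLp n) g ∧ ‖g‖ ^ 2 = 2 * Real.pi * ‖f‖ ^ 2 := by
  set s : ℝ := Real.sqrt (2 * Real.pi) with hs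
  have hs2 : s ^ 2 = 2 * Real.pi := Real.sq_sqrt (by positivity)
  have hs0 : 0 < s := Real.sqrt_pos.2 (by positivity)
  have hs0' : (s : ℂ) ≠ 0 := by exact_mod_cast hs0.ne'
  have ho : Orthonormal ℂ fun n => (s : ℂ)⁻¹ • expLp n := by
    rw [orthonormal_iff_ite]
    intro m n
    rw [inner_smul_left, inner_smul_right, inner_expLp]
    have h2 : (s : ℂ) ^ 2 = (2 * Real.pi : ℝ) := by rw [← Complex.ofReal_pow, hs2]
    split_ifs with h
    · rw [← h2, map_inv₀, Complex.conj_ofReal]; field_simp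
    · simp
  have h1 := ho.orthogonalFamily.hasSum_linearIsometry f
  refine ⟨(s : ℂ) • ho.orthogonalFamily.linearIsometry f, ?_, ?_⟩
  · have h2 := h1.const_smul (s : ℂ)
    refine Eq.mp (congrArg (fun g : ℕ → _ => HasSum g _) (funext fun n => ?_)) h2
    rw [LinearIsometry.toSpanSingleton_apply, smul_smul, smul_smul]
    congr 1
    field_simp
  · rw [norm_smul, LinearIsometry.norm_map, mul_pow, Complex.norm_real, Real.norm_eq_abs, sq_abs, hs2]

theorem H2.summable_primitive (f : H2) : Summable fun n : ℕ => ‖f n‖ / (n + 1) := by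
  have h2 : Summable fun n : ℕ => (1 / ((n : ℝ) + 1) ^ 2) := by
    have := (summable_nat_add_iff 1).2 (Real.summable_one_div_nat_pow.2 (show 1 < 2 by norm_num))
    simpa using this
  refine Summable.of_nonneg_of_le (fun n => by positivity) (fun n => ?_) (f.summable_norm_sq.add h2)
  have h3 : (0 : ℝ) < n + 1 := by positivity
  have : ‖f n‖ / (n + 1) = ‖f n‖ * (1 / (n + 1)) := by ring
  rw [this, ← one_div_pow]
  nlinarith [sq_nonneg (‖f n‖ - 1 / ((n : ℝ) + 1)), sq_nonneg (‖f n‖ + 1 / ((n : ℝ) + 1))]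

/-- The boundary values of the primitive `∑ fₙ zⁿ⁺¹ / (n + 1)` of `f`. -/
noncomputable def H2.primitive (f : H2) (t : ℝ) : ℂ :=
  ∑' n : ℕ, f n / (n + 1) * Complex.exp ((n + 1 : ℕ) * t * Complex.I)

theorem H2.summable_primitive_term (f : H2) (t : ℝ) :
    Summable fun n : ℕ => f n / (n + 1) * Complex.exp ((n + 1 : ℕ) * t * Complex.I) := by
  refine Summable.of_norm (f.summable_primitive.congr fun n => ?_)
  rw [norm_mul, norm_exp_nat_mul_I, norm_div, mul_one]
  have := Complex.norm_natCast (n + 1)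
  push_cast at this
  rw [this]

theorem integral_exp_succ (n : ℕ) (θ : ℝ) :
    ∫ t in (0 : ℝ)..θ, Complex.I * Complex.exp ((n + 1 : ℕ) * t * Complex.I) =
      (Complex.exp ((n + 1 : ℕ) * θ * Complex.I) - 1) / (n + 1) := by
  have hne : ((n + 1 : ℕ) : ℂ) * Complex.I ≠ 0 :=
    mul_ne_zero (by exact_mod_cast n.succ_ne_zero) Complex.I_ne_zero
  have h := integral_exp_mul_complex (a := 0) (b := θ) hne
  rw [intervalIntegral.integral_const_mul]
  have : ∀ t : ℝ, ((n + 1 : ℕ) : ℂ) * t * Complex.I = ((n + 1 : ℕ) : ℂ) * Complex.I * t := fun t => by ring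
  simp_rw [this]
  rw [h]
  have h1 : (n : ℂ) + 1 ≠ 0 := by exact_mod_cast n.succ_ne_zero
  have h2 := Complex.I_ne_zero
  push_cast
  simp only [mul_zero, Complex.exp_zero]
  field_simp

theorem H2.primitive_eq_integral (f : H2) {g : Lp ℂ 2 arcMeasure}
    (hg : HasSum (fun n => f n • expLp n) g) {θ : ℝ} (h0 : 0 ≤ θ) (h1 : θ ≤ 2 * Real.pi) :
    ∫ t in (0 : ℝ)..θ, Complex.I * Complex.exp (t * Complex.I) * g t = f.primitive θ - f.primitive 0 := by
  have hmem : MemLp ((Ioc 0 θ).indicator fun t : ℝ => starRingEnd ℂ (Complex.I * Complex.exp (t * Complex.I)))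
      2 arcMeasure := by
    refine MemLp.of_bound (AEStronglyMeasurable.indicator
      (Continuous.aestronglyMeasurable (by fun_prop)) measurableSet_Ioc) 1 (Eventually.of_forall fun t => ?_)
    refine (norm_indicator_le_norm_self _ _).trans ?_
    rw [RCLike.norm_conj, norm_mul, Complex.norm_I, Complex.norm_exp_ofReal_mul_I, one_mul]
  have hin : ∀ v : Lp ℂ 2 arcMeasure, inner ℂ hmem.toLp v =
      ∫ t in (0 : ℝ)..θ, Complex.I * Complex.exp (t * Complex.I) * v t := by
    intro v
    rw [L2.inner_def, intervalIntegral.integral_of_le h0]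
    have hsub : Ioc 0 θ ⊆ Ioc 0 (2 * Real.pi) := Ioc_subset_Ioc_right h1
    have hre : volume.restrict (Ioc 0 θ) = arcMeasure.restrict (Ioc 0 θ) :=
      (Measure.restrict_restrict_of_subset hsub).symm
    rw [hre]
    refine Eq.trans (integral_congr_ae ?_) (integral_indicator measurableSet_Ioc)
    filter_upwards [hmem.coeFn_toLp] with t ht
    rw [ht, RCLike.inner_apply]
    by_cases hmt : t ∈ Ioc 0 θ
    · rw [indicator_of_mem hmt, indicator_of_mem hmt, Complex.conj_conj]; ring
    · rw [indicator_of_notMem hmt, indicator_of_notMem hmt]; simp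
  rw [← hin]
  have h2 := hg.mapL (innerSL ℂ hmem.toLp)
  have h3 : ∀ n : ℕ, innerSL ℂ hmem.toLp (f n • expLp n) =
      f n / (n + 1) * Complex.exp ((n + 1 : ℕ) * θ * Complex.I) -
      f n / (n + 1) * Complex.exp ((n + 1 : ℕ) * (0 : ℝ) * Complex.I) := by
    intro n
    rw [innerSL_apply_apply, inner_smul_right, hin]
    have : ∫ t in (0 : ℝ)..θ, Complex.I * Complex.exp (t * Complex.I) * expLp n t =
        ∫ t in (0 : ℝ)..θ, Complex.I * Complex.exp ((n + 1 : ℕ) * t * Complex.I) := by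
      rw [intervalIntegral.integral_of_le h0, intervalIntegral.integral_of_le h0]
      refine integral_congr_ae ?_
      filter_upwards [ae_restrict_of_ae_restrict_of_subset (Ioc_subset_Ioc_right h1) (coeFn_expLp n)] with t ht
      rw [ht, mul_assoc, ← Complex.exp_add]
      push_cast
      ring_nf
    rw [this, integral_exp_succ]
    simp only [Complex.ofReal_zero, mul_zero, zero_mul, Complex.exp_zero]
    ring
  simp_rw [h3] at h2
  have h4 := (f.summable_primitive_term θ).hasSum.sub (f.summable_primitive_term 0).hasSum
  exact h2.unique h4

theorem H2.tendsto_radial (f : H2) {θ : ℝ} {d : ℂ} (hd : HasDerivAt f.primitive d θ) :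
    Tendsto (fun r : ℝ => f.fn (r * Complex.exp (θ * Complex.I))) (𝓝[<] 1)
      (𝓝 (d / (Complex.I * Complex.exp (θ * Complex.I)))) := by
  set c : ℕ → ℂ := fun k => f (k - 1) / k * Complex.exp (k * θ * Complex.I) with hc
  have hc0 : c 0 = 0 := by simp [hc]
  have hsum : Summable fun k => ‖c k‖ := by
    rw [← summable_nat_add_iff 1]
    refine f.summable_primitive.congr fun n => ?_
    rw [hc]
    simp only [norm_mul, norm_exp_nat_mul_I, norm_div, mul_one, Nat.add_sub_cancel, Complex.norm_natCast]
    push_cast; rfl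
  have hprim : ∀ t : ℝ, ∑' k, c k * Complex.exp (k * t * Complex.I) = f.primitive (θ + t) := by
    intro t
    have hs : Summable fun k => c k * Complex.exp (k * t * Complex.I) := by
      refine Summable.of_norm (hsum.congr fun k => ?_)
      rw [norm_mul (c k), norm_exp_nat_mul_I, mul_one]
    rw [hs.tsum_eq_zero_add, hc0, zero_mul, zero_add, H2.primitive]
    congr 1 with n
    rw [hc]
    simp only [Nat.add_sub_cancel]
    rw [mul_assoc, ← Complex.exp_add]
    push_cast
    ring_nf
  have hd' : HasDerivAt (fun t : ℝ => ∑' k, c k * Complex.exp (k * t * Complex.I)) d 0 := by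
    simp_rw [hprim]
    have := HasDerivAt.comp_const_add θ 0 (by simpa using hd : HasDerivAt f.primitive d (θ + 0))
    exact this
  have h1 := tendsto_poissonAngularDeriv hsum hd'
  have hev : ∀ᶠ r : ℝ in 𝓝[<] 1, (∑' k, c k * (Complex.I * k * (r : ℂ) ^ k)) / (r * (Complex.I * Complex.exp (θ * Complex.I)))
      = f.fn (r * Complex.exp (θ * Complex.I)) := by
    have h0 : ∀ᶠ r : ℝ in 𝓝[<] 1, 0 < r :=
      eventually_nhdsWithin_of_eventually_nhds (lt_mem_nhds (by norm_num))
    filter_upwards [h0, self_mem_nhdsWithin] with r hr0 hr1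
    have hr1 : r < 1 := hr1
    have hz : (r : ℂ) * Complex.exp (θ * Complex.I) ∈ disc := by
      rw [mem_disc, norm_mul, Complex.norm_exp_ofReal_mul_I, mul_one, Complex.norm_real,
        Real.norm_eq_abs, abs_of_pos hr0]
      exact hr1
    have hr0' : (r : ℂ) ≠ 0 := by exact_mod_cast hr0.ne'
    have h2 := (f.hasSum_fn hz).mul_left (r * (Complex.I * Complex.exp (θ * Complex.I)))
    have h3 : HasSum (fun k => c k * (Complex.I * k * (r : ℂ) ^ k))
        (r * (Complex.I * Complex.exp (θ * Complex.I)) * f.fn (r * Complex.exp (θ * Complex.I))) := by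
      rw [← hasSum_nat_add_iff' 1]
      simp only [Finset.range_one, Finset.sum_singleton, hc0, zero_mul, sub_zero]
      refine Eq.mp (congrArg (fun g : ℕ → _ => HasSum g _) (funext fun n => ?_)) h2
      rw [hc]
      simp only [Nat.add_sub_cancel]
      have hn : ((n + 1 : ℕ) : ℂ) ≠ 0 := by exact_mod_cast n.succ_ne_zero
      have he : Complex.exp ((n + 1 : ℕ) * θ * Complex.I) = Complex.exp (θ * Complex.I) ^ (n + 1) := by
        rw [← Complex.exp_nat_mul]; ring_nf
      rw [he, mul_pow, pow_succ, pow_succ]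
      field_simp
    rw [h3.tsum_eq]
    have := Complex.exp_ne_zero (θ * Complex.I)
    have := Complex.I_ne_zero
    field_simp
  have h2 : Tendsto (fun r : ℝ => (r : ℂ) * (Complex.I * Complex.exp (θ * Complex.I))) (𝓝[<] 1)
      (𝓝 (Complex.I * Complex.exp (θ * Complex.I))) := by
    have : Tendsto (fun r : ℝ => (r : ℂ) * (Complex.I * Complex.exp (θ * Complex.I))) (𝓝[<] 1)
      (𝓝 (((1 : ℝ) : ℂ) * (Complex.I * Complex.exp (θ * Complex.I)))) :=
      tendsto_nhdsWithin_of_tendsto_nhds (Continuous.tendsto (by fun_prop) 1)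
    simpa using this
  exact (h1.div h2 (mul_ne_zero Complex.I_ne_zero (Complex.exp_ne_zero _))).congr' hev

/-- Fatou's theorem for `H²`. -/
theorem H2.exists_boundary (f : H2) : ∃ g : ℝ → ℂ, AEMeasurable g arcMeasure ∧
    (∀ᵐ t : ℝ ∂arcMeasure, Tendsto (fun r : ℝ => f.fn (r * Complex.exp (t * Complex.I))) (𝓝[<] 1) (𝓝 (g t))) ∧
    ∫⁻ t, ‖g t‖ₑ ^ 2 ∂arcMeasure = ENNReal.ofReal (2 * Real.pi) * ‖f‖ₑ ^ 2 := by
  obtain ⟨g, hg, hn⟩ := f.exists_sum_expLp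
  refine ⟨g, (Lp.aestronglyMeasurable g).aemeasurable, ?_, ?_⟩
  · have hint : IntervalIntegrable (fun t : ℝ => Complex.I * Complex.exp (t * Complex.I) * g t) volume 0 (2 * Real.pi) := by
      rw [intervalIntegrable_iff_integrableOn_Ioc_of_le (by positivity)]
      have h1 : Integrable g arcMeasure := (Lp.memLp g).integrable (by norm_num)
      refine Integrable.bdd_mul (c := 1) h1 (Continuous.aestronglyMeasurable (by fun_prop)) (Eventually.of_forall fun t => ?_)
      rw [norm_mul, Complex.norm_I, Complex.norm_exp_ofReal_mul_I, one_mul]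
    have h2 := hint.ae_hasDerivAt_integral
    have h3 : ∀ᵐ t ∂arcMeasure, t ≠ 2 * Real.pi := by
      refine ae_restrict_of_ae ?_
      simp [ae_iff, measure_singleton]
    filter_upwards [ae_restrict_of_ae h2, h3, ae_restrict_mem measurableSet_Ioc] with t h2 h3 h4
    have h5 : t ∈ Ioo 0 (2 * Real.pi) := ⟨h4.1, lt_of_le_of_ne h4.2 h3⟩
    have hu : uIcc 0 (2 * Real.pi) = Icc 0 (2 * Real.pi) := uIcc_of_le (by positivity)
    have h6 := h2 (hu ▸ Ioo_subset_Icc_self h5) 0 (by simp)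
    have h7 : HasDerivAt f.primitive (Complex.I * Complex.exp (t * Complex.I) * g t) t := by
      have h8 := h6.add_const (f.primitive 0)
      refine h8.congr_of_eventuallyEq ?_
      filter_upwards [isOpen_Ioo.mem_nhds h5] with x hx
      rw [f.primitive_eq_integral hg hx.1.le hx.2.le]; ring
    have h8 := f.tendsto_radial h7
    rwa [mul_div_cancel_left₀ _ (mul_ne_zero Complex.I_ne_zero (Complex.exp_ne_zero _))] at h8
  · have h1 := Lp.enorm_def g
    have h2 : ‖g‖ₑ ^ 2 = ∫⁻ t, ‖g t‖ₑ ^ 2 ∂arcMeasure := by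
      rw [h1, eLpNorm_eq_lintegral_rpow_enorm_toReal (by norm_num) (by norm_num)]
      simp only [ENNReal.toReal_ofNat, ENNReal.rpow_ofNat, one_div]
      rw [← ENNReal.rpow_natCast, ← ENNReal.rpow_mul]
      simp
    rw [← h2, ← ofReal_norm, ← ofReal_norm, ← ENNReal.ofReal_pow (norm_nonneg _),
      ← ENNReal.ofReal_pow (norm_nonneg _), hn, ENNReal.ofReal_mul (by positivity)]

theorem H2.tendsto_boundaryFn (f : H2) : ∀ᵐ t : ℝ ∂arcMeasure,
    Tendsto (fun r : ℝ => f.fn (r * Complex.exp (t * Complex.I))) (𝓝[<] 1)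
      (𝓝 (boundaryFn f.fn (Complex.exp (t * Complex.I)))) := by
  obtain ⟨g, -, hg, -⟩ := f.exists_boundary
  filter_upwards [hg] with t ht
  exact tendsto_nhds_limUnder ⟨_, ht⟩

theorem H2.aemeasurable_boundaryFn (f : H2) :
    AEMeasurable (fun t : ℝ => boundaryFn f.fn (Complex.exp (t * Complex.I))) arcMeasure := by
  obtain ⟨g, hm, hg, -⟩ := f.exists_boundary
  refine hm.congr ?_
  filter_upwards [hg] with t ht
  exact ht.limUnder_eq.symm

theorem H2.lintegral_boundaryFn (f : H2) :
    ∫⁻ t : ℝ, ‖boundaryFn f.fn (Complex.exp (t * Complex.I))‖ₑ ^ 2 ∂arcMeasure =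
      ENNReal.ofReal (2 * Real.pi) * ‖f‖ₑ ^ 2 := by
  obtain ⟨g, -, hg, hn⟩ := f.exists_boundary
  rw [← hn]
  refine lintegral_congr_ae ?_
  filter_upwards [hg] with t ht
  rw [boundaryFn, ht.limUnder_eq]

theorem ofReal_mul_mem_disc {ζ : ℂ} (hζ : ‖ζ‖ ≤ 1) {r : ℝ} (h0 : 0 ≤ r) (h1 : r < 1) :
    (r : ℂ) * ζ ∈ disc := by
  rw [mem_disc, norm_mul, Complex.norm_real, Real.norm_eq_abs, abs_of_nonneg h0]
  nlinarith [norm_nonneg ζ]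

theorem eventually_radial_mem_disc {ζ : ℂ} (hζ : ‖ζ‖ ≤ 1) :
    ∀ᶠ r : ℝ in 𝓝[<] 1, (r : ℂ) * ζ ∈ disc := by
  have h0 : ∀ᶠ r : ℝ in 𝓝[<] 1, 0 < r :=
    eventually_nhdsWithin_of_eventually_nhds (lt_mem_nhds (by norm_num))
  filter_upwards [h0, self_mem_nhdsWithin] with r hr0 hr1
  exact ofReal_mul_mem_disc hζ hr0.le hr1

theorem tendsto_radial (ζ : ℂ) : Tendsto (fun r : ℝ => (r : ℂ) * ζ) (𝓝[<] 1) (𝓝 ζ) := by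
  have : Tendsto (fun r : ℝ => (r : ℂ) * ζ) (𝓝[<] 1) (𝓝 (((1 : ℝ) : ℂ) * ζ)) :=
    tendsto_nhdsWithin_of_tendsto_nhds (Continuous.tendsto (by fun_prop) 1)
  simpa using this

/-- Dilations of an analytic function on the disc belong to `H²`. -/
theorem exists_dilation {F : ℂ → ℂ} {c : ℕ → ℂ}
    (hc : ∀ z ∈ disc, HasSum (fun n => c n * z ^ n) (F z)) {r : ℝ} (h0 : 0 ≤ r) (h1 : r < 1) :
    ∃ h : H2, (∀ n, h n = c n * r ^ n) ∧ ∀ z ∈ disc, h.fn z = F (r * z) := by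
  have hr : (r : ℂ) ∈ disc := by simpa using ofReal_mul_mem_disc (ζ := 1) (by simp) h0 h1
  have hs : Summable fun n => ‖c n * (r : ℂ) ^ n‖ := (hc r hr).summable.norm
  have hm : Memℓp (fun n => c n * (r : ℂ) ^ n) 1 := memℓp_gen (by simpa using hs)
  refine ⟨⟨fun n => c n * (r : ℂ) ^ n, hm.of_exponent_ge (by norm_num)⟩, fun n => rfl, fun z hz => ?_⟩
  have h2 := (hc (r * z) (ofReal_mul_mem_disc (mem_disc.1 hz).le h0 h1)).tsum_eq
  rw [← h2, H2.fn]
  congr 1 with n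
  change c n * (r : ℂ) ^ n * z ^ n = _
  rw [mul_pow, mul_assoc]

theorem lintegral_circle {F : ℂ → ℂ} (hF : ContinuousOn F disc) {r : ℝ} (h0 : 0 ≤ r) (h1 : r < 1)
    {h : H2} (hh : ∀ z ∈ disc, h.fn z = F (r * z)) :
    ∫⁻ t : ℝ, ‖F (r * Complex.exp (t * Complex.I))‖ₑ ^ 2 ∂arcMeasure =
      ENNReal.ofReal (2 * Real.pi) * ‖h‖ₑ ^ 2 := by
  rw [← h.lintegral_boundaryFn]
  congr 1 with t
  congr 2
  set ζ := Complex.exp (t * Complex.I) with hζ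
  have hn : ‖ζ‖ = 1 := Complex.norm_exp_ofReal_mul_I t
  have hd : (r : ℂ) * ζ ∈ disc := ofReal_mul_mem_disc hn.le h0 h1
  have h2 : Tendsto (fun ρ : ℝ => F (r * (ρ * ζ))) (𝓝[<] 1) (𝓝 (F (r * ζ))) := by
    have := (hF.continuousAt (Metric.isOpen_ball.mem_nhds hd)).tendsto
    exact this.comp ((tendsto_radial ζ).const_mul (r : ℂ))
  have h3 : Tendsto (fun ρ : ℝ => h.fn (ρ * ζ)) (𝓝[<] 1) (𝓝 (F (r * ζ))) := by
    refine h2.congr' ?_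
    filter_upwards [eventually_radial_mem_disc hn.le] with ρ hρ
    rw [hh _ hρ]
  rw [boundaryFn, h3.limUnder_eq]

theorem H2.lintegral_circle_le (f : H2) {r : ℝ} (h0 : 0 ≤ r) (h1 : r < 1) :
    ∫⁻ t : ℝ, ‖f.fn (r * Complex.exp (t * Complex.I))‖ₑ ^ 2 ∂arcMeasure ≤
      ENNReal.ofReal (2 * Real.pi) * ‖f‖ₑ ^ 2 := by
  obtain ⟨h, hn, hh⟩ := exists_dilation (fun z hz => f.hasSum_fn hz) h0 h1
  rw [lintegral_circle f.differentiableOn.continuousOn h0 h1 hh]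
  have h2 : ‖h‖ ≤ ‖f‖ := by
    refine (sq_le_sq₀ (norm_nonneg _) (norm_nonneg _)).1 ?_
    rw [H2.norm_sq_eq, H2.norm_sq_eq]
    refine h.summable_norm_sq.tsum_le_tsum (fun n => ?_) f.summable_norm_sq
    rw [hn, norm_mul, norm_pow, Complex.norm_real, Real.norm_eq_abs, abs_of_nonneg h0]
    have := pow_le_one₀ (n := n) h0 h1.le
    exact pow_le_pow_left₀ (by positivity) (mul_le_of_le_one_right (norm_nonneg _) this) 2
  gcongr
  exact enorm_le_iff_norm_le.2 h2

/-- An analytic function with bounded circle means belongs to `H²`. -/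
theorem exists_H2_of_circle_le {F : ℂ → ℂ} (hF : DifferentiableOn ℂ F disc) {M : ℝ} (hM : 0 ≤ M)
    (hb : ∀ r : ℝ, 0 ≤ r → r < 1 → ∫⁻ t : ℝ, ‖F (r * Complex.exp (t * Complex.I))‖ₑ ^ 2 ∂arcMeasure ≤
      ENNReal.ofReal (2 * Real.pi) * ENNReal.ofReal M) :
    ∃ h : H2, (∀ z ∈ disc, h.fn z = F z) ∧ ‖h‖ ^ 2 ≤ M := by
  obtain ⟨c, hc⟩ := exists_taylor hF
  have hpi : ENNReal.ofReal (2 * Real.pi) ≠ 0 := by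
    rw [Ne, ENNReal.ofReal_eq_zero, not_le]; positivity
  have h1 : ∀ (N : ℕ) (r : ℝ), 0 ≤ r → r < 1 → ∑ n ∈ Finset.range N, (‖c n‖ * r ^ n) ^ 2 ≤ M := by
    intro N r h0 h1
    obtain ⟨h, hn, hh⟩ := exists_dilation hc h0 h1
    have h2 := hb r h0 h1
    rw [lintegral_circle hF.continuousOn h0 h1 hh, ENNReal.mul_le_mul_iff_right hpi ENNReal.ofReal_ne_top,
      ← ofReal_norm, ← ENNReal.ofReal_pow (norm_nonneg _), ENNReal.ofReal_le_ofReal_iff hM] at h2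
    refine le_trans ?_ h2
    rw [H2.norm_sq_eq]
    refine le_trans (le_of_eq (Finset.sum_congr rfl fun n _ => ?_)) (h.summable_norm_sq.sum_le_tsum (Finset.range N) fun _ _ => by positivity)
    rw [hn, norm_mul, norm_pow, Complex.norm_real, Real.norm_eq_abs, abs_of_nonneg h0]
  have h2 : ∀ N : ℕ, ∑ n ∈ Finset.range N, ‖c n‖ ^ 2 ≤ M := by
    intro N
    have hl : Tendsto (fun r : ℝ => ∑ n ∈ Finset.range N, (‖c n‖ * r ^ n) ^ 2) (𝓝[<] 1)
        (𝓝 (∑ n ∈ Finset.range N, (‖c n‖ * 1 ^ n) ^ 2)) :=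
      tendsto_nhdsWithin_of_tendsto_nhds (Continuous.tendsto (by fun_prop) 1)
    have h0 : ∀ᶠ r : ℝ in 𝓝[<] 1, 0 < r :=
      eventually_nhdsWithin_of_eventually_nhds (lt_mem_nhds (by norm_num))
    have := le_of_tendsto hl (by
      filter_upwards [h0, self_mem_nhdsWithin] with r hr0 hr1
      exact h1 N r hr0.le hr1)
    simpa using this
  have hs := summable_of_sum_range_le (fun n => sq_nonneg ‖c n‖) h2
  obtain ⟨h, hh⟩ := H2.exists_of_summable c hs
  refine ⟨h, fun z hz => ?_, ?_⟩
  · rw [← (hc z hz).tsum_eq, H2.fn]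
    simp_rw [hh]
  · rw [H2.norm_sq_eq]
    simp_rw [hh]
    exact Real.tsum_le_of_sum_range_le (fun n => sq_nonneg _) h2

/-- Bounded analytic functions are multipliers of `H²`. -/
theorem H2.exists_mul {ψ : ℂ → ℂ} (hψ : DifferentiableOn ℂ ψ disc) {C : ℝ} (hC : 0 ≤ C)
    (hb : ∀ z ∈ disc, ‖ψ z‖ ≤ C) (f : H2) :
    ∃ h : H2, (∀ z ∈ disc, h.fn z = ψ z * f.fn z) ∧ ‖h‖ ≤ C * ‖f‖ := by
  have hmean : ∀ r : ℝ, 0 ≤ r → r < 1 →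
      ∫⁻ t : ℝ, ‖(fun z => ψ z * f.fn z) (r * Complex.exp (t * Complex.I))‖ₑ ^ 2 ∂arcMeasure ≤
        ENNReal.ofReal (2 * Real.pi) * ENNReal.ofReal ((C * ‖f‖) ^ 2) := by
    intro r h0 h1
    calc ∫⁻ t : ℝ, ‖ψ (r * Complex.exp (t * Complex.I)) * f.fn (r * Complex.exp (t * Complex.I))‖ₑ ^ 2 ∂arcMeasure
        ≤ ∫⁻ t : ℝ, ENNReal.ofReal C ^ 2 * ‖f.fn (r * Complex.exp (t * Complex.I))‖ₑ ^ 2 ∂arcMeasure := by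
          refine lintegral_mono fun t => ?_
          rw [enorm_mul, mul_pow]
          gcongr
          rw [← ofReal_norm]
          exact ENNReal.ofReal_le_ofReal (hb _ (ofReal_mul_mem_disc (Complex.norm_exp_ofReal_mul_I t).le h0 h1))
      _ = ENNReal.ofReal C ^ 2 * ∫⁻ t : ℝ, ‖f.fn (r * Complex.exp (t * Complex.I))‖ₑ ^ 2 ∂arcMeasure :=
          lintegral_const_mul' _ _ (by simp)
      _ ≤ ENNReal.ofReal C ^ 2 * (ENNReal.ofReal (2 * Real.pi) * ‖f‖ₑ ^ 2) := by
          gcongr; exact f.lintegral_circle_le h0 h1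
      _ = _ := by
          rw [← ofReal_norm, mul_pow, ENNReal.ofReal_mul (sq_nonneg C), ENNReal.ofReal_pow hC,
            ENNReal.ofReal_pow (norm_nonneg _)]
          ring
  obtain ⟨h, hh, hn⟩ := exists_H2_of_circle_le (hψ.mul f.differentiableOn) (sq_nonneg _) hmean
  exact ⟨h, hh, (sq_le_sq₀ (norm_nonneg _) (by positivity)).1 hn⟩

theorem H2.exists_mul_poly (p : ℂ[X]) (f : H2) : ∃ h : H2, ∀ z ∈ disc, h.fn z = p.eval z * f.fn z := by
  obtain ⟨C, hC⟩ := (isCompact_closedBall (0 : ℂ) 1).exists_bound_of_continuousOn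
    (p.continuous.continuousOn)
  have hC' : ∀ z ∈ disc, ‖p.eval z‖ ≤ C := fun z hz => hC z (Metric.ball_subset_closedBall hz)
  have h0 : 0 ≤ C := (norm_nonneg _).trans (hC 0 (by simp))
  obtain ⟨h, hh, -⟩ := f.exists_mul p.differentiable.differentiableOn h0 hC'
  exact ⟨h, hh⟩

theorem ae_exp_ne (ζ : ℂ) : ∀ᵐ t : ℝ, Complex.exp (t * Complex.I) ≠ ζ := by
  by_cases h : ∃ t₀ : ℝ, Complex.exp (t₀ * Complex.I) = ζ
  · obtain ⟨t₀, rfl⟩ := h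
    rw [ae_iff]
    refine (Set.Countable.mono (fun t ht => ?_) (countable_range fun n : ℤ => t₀ + n * (2 * Real.pi))).measure_zero _
    simp only [ne_eq, not_not, mem_ofPred_eq] at ht
    obtain ⟨n, hn⟩ := Complex.exp_eq_exp_iff_exists_int.1 ht
    refine ⟨n, ?_⟩
    have h2 : ((t : ℝ) : ℂ) * Complex.I = ((t₀ + n * (2 * Real.pi) : ℝ) : ℂ) * Complex.I := by
      rw [hn]; push_cast; ring
    exact_mod_cast (mul_right_cancel₀ Complex.I_ne_zero h2).symm
  · push Not at h
    exact Eventually.of_forall h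

theorem ae_eval_exp_ne_zero {p : ℂ[X]} (hp : p ≠ 0) :
    ∀ᵐ t : ℝ ∂arcMeasure, p.eval (Complex.exp (t * Complex.I)) ≠ 0 := by
  have h : ∀ᵐ t : ℝ, ∀ ζ ∈ p.roots.toFinset, Complex.exp (t * Complex.I) ≠ ζ :=
    (Finset.eventually_all _).2 fun ζ _ => ae_exp_ne ζ
  filter_upwards [ae_restrict_of_ae h] with t ht h0
  exact ht _ (by simp [hp, h0]) rfl

theorem tendsto_radial_of_continuousAt {ψ : ℂ → ℂ} {ζ : ℂ} (h : ContinuousAt ψ ζ) :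
    Tendsto (fun r : ℝ => ψ (r * ζ)) (𝓝[<] 1) (𝓝 (ψ ζ)) :=
  h.tendsto.comp (tendsto_radial ζ)

/-- Smirnov's theorem for quotients by a polynomial with zeros on the circle. -/
theorem H2.exists_div {S : Finset ℂ} (hS : ∀ ζ ∈ S, ‖ζ‖ = 1) (m : ℂ → ℕ) (V : H2)
    (hI : ∫⁻ t : ℝ, ‖boundaryFn V.fn (Complex.exp (t * Complex.I)) /
      ∏ ζ ∈ S, (Complex.exp (t * Complex.I) - ζ) ^ m ζ‖ₑ ^ 2 ∂arcMeasure ≠ ⊤) :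
    ∃ W : H2, ∀ z ∈ disc, (∏ ζ ∈ S, (z - ζ) ^ m ζ) * W.fn z = V.fn z := by
  set I := ∫⁻ t : ℝ, ‖boundaryFn V.fn (Complex.exp (t * Complex.I)) /
      ∏ ζ ∈ S, (Complex.exp (t * Complex.I) - ζ) ^ m ζ‖ₑ ^ 2 ∂arcMeasure with hIdef
  set N := ∑ ζ ∈ S, m ζ with hN
  have hlow : ∀ ε : ℝ, 0 < ε → ∀ ζ ∈ S, ∀ z : ℂ, ‖z‖ ≤ 1 → ε ≤ ‖z - (1 + ε) * ζ‖ := by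
    intro ε hε ζ hζ z hz
    have h1 : ‖((1 + ε : ℝ) : ℂ) * ζ‖ = 1 + ε := by
      rw [norm_mul, hS ζ hζ, Complex.norm_real, Real.norm_eq_abs, abs_of_pos (by linarith), mul_one]
    have h2 := norm_sub_norm_le (((1 + ε : ℝ) : ℂ) * ζ) z
    rw [h1, norm_sub_rev] at h2
    push_cast at h2
    linarith
  have hcmp : ∀ ε : ℝ, 0 < ε → ∀ z : ℂ, ‖z‖ ≤ 1 →
      ‖∏ ζ ∈ S, (z - ζ) ^ m ζ‖ ≤ 2 ^ N * ‖∏ ζ ∈ S, (z - (1 + ε) * ζ) ^ m ζ‖ := by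
    intro ε hε z hz
    rw [norm_prod, norm_prod, hN, ← Finset.prod_pow_eq_pow_sum, ← Finset.prod_mul_distrib]
    refine Finset.prod_le_prod (fun _ _ => norm_nonneg _) fun ζ hζ => ?_
    rw [norm_pow, norm_pow, ← mul_pow]
    refine pow_le_pow_left₀ (norm_nonneg _) ?_ _
    have h1 := hlow ε hε ζ hζ z hz
    have h2 : z - ζ = (z - (1 + ε) * ζ) + ε * ζ := by ring
    have h3 : ‖(ε : ℂ) * ζ‖ = ε := by
      rw [norm_mul, hS ζ hζ, Complex.norm_real, Real.norm_eq_abs, abs_of_pos hε, mul_one]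
    calc ‖z - ζ‖ ≤ ‖z - (1 + ε) * ζ‖ + ‖(ε : ℂ) * ζ‖ := by rw [h2]; exact norm_add_le _ _
      _ ≤ _ := by rw [h3]; linarith
  have hne : ∀ ε : ℝ, 0 < ε → ∀ z : ℂ, ‖z‖ ≤ 1 → ∏ ζ ∈ S, (z - (1 + ε) * ζ) ^ m ζ ≠ 0 := by
    intro ε hε z hz
    refine Finset.prod_ne_zero_iff.2 fun ζ hζ => pow_ne_zero _ fun h => ?_
    have := hlow ε hε ζ hζ z hz
    rw [h, norm_zero] at this
    linarith
  have hne0 : ∀ z ∈ disc, ∏ ζ ∈ S, (z - ζ) ^ m ζ ≠ 0 := by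
    intro z hz
    refine Finset.prod_ne_zero_iff.2 fun ζ hζ => pow_ne_zero _ (sub_ne_zero.2 fun h => ?_)
    have h1 := mem_disc.1 hz
    rw [h, hS ζ hζ] at h1
    exact lt_irrefl _ h1
  have hdiff : ∀ z : ℂ, Differentiable ℂ fun z : ℂ => ∏ ζ ∈ S, (z - ζ) ^ m ζ := by
    intro z; fun_prop
  have hne_ae : ∀ᵐ t : ℝ ∂arcMeasure, ∏ ζ ∈ S, (Complex.exp (t * Complex.I) - ζ) ^ m ζ ≠ 0 := by
    have h : ∀ᵐ t : ℝ, ∀ ζ ∈ S, Complex.exp (t * Complex.I) ≠ ζ :=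
      (Finset.eventually_all _).2 fun ζ _ => ae_exp_ne ζ
    filter_upwards [ae_restrict_of_ae h] with t ht
    exact Finset.prod_ne_zero_iff.2 fun ζ hζ => pow_ne_zero _ (sub_ne_zero.2 (ht ζ hζ))
  have hmean : ∀ ε : ℝ, 0 < ε → ∀ r : ℝ, 0 ≤ r → r < 1 →
      ∫⁻ t : ℝ, ‖V.fn (r * Complex.exp (t * Complex.I)) /
        ∏ ζ ∈ S, (r * Complex.exp (t * Complex.I) - (1 + ε) * ζ) ^ m ζ‖ₑ ^ 2 ∂arcMeasure ≤ (2 ^ N) ^ 2 * I := by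
    intro ε hε r h0 h1
    have hd : Differentiable ℂ fun z : ℂ => ∏ ζ ∈ S, (z - (1 + ε) * ζ) ^ m ζ := by fun_prop
    obtain ⟨C, hC⟩ := (isCompact_closedBall (0 : ℂ) 1).exists_bound_of_continuousOn
      (f := fun z : ℂ => (∏ ζ ∈ S, (z - (1 + ε) * ζ) ^ m ζ)⁻¹)
      (hd.continuous.continuousOn.inv₀ fun z hz => hne ε hε z (by simpa using hz))
    have hC0 : 0 ≤ C := (norm_nonneg _).trans (hC 0 (by simp))
    obtain ⟨h, hh, -⟩ := V.exists_mul (ψ := fun z : ℂ => (∏ ζ ∈ S, (z - (1 + ε) * ζ) ^ m ζ)⁻¹)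
      (hd.differentiableOn.inv fun z hz => hne ε hε z (mem_disc.1 hz).le) hC0
      (fun z hz => hC z (Metric.ball_subset_closedBall hz))
    have h2 := h.lintegral_circle_le h0 h1
    have h3 : ∀ t : ℝ, h.fn (r * Complex.exp (t * Complex.I)) = V.fn (r * Complex.exp (t * Complex.I)) /
        ∏ ζ ∈ S, (r * Complex.exp (t * Complex.I) - (1 + ε) * ζ) ^ m ζ := by
      intro t
      rw [hh _ (ofReal_mul_mem_disc (Complex.norm_exp_ofReal_mul_I t).le h0 h1)]
      ring
    simp_rw [h3] at h2
    refine h2.trans ?_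
    rw [← h.lintegral_boundaryFn, hIdef, ← lintegral_const_mul' _ _ (by simp)]
    refine lintegral_mono_ae ?_
    filter_upwards [h.tendsto_boundaryFn, V.tendsto_boundaryFn, hne_ae] with t ht hVt hat
    set ζ₀ := Complex.exp (t * Complex.I) with hζ₀
    have hn : ‖ζ₀‖ = 1 := Complex.norm_exp_ofReal_mul_I t
    have h4 := (tendsto_radial_of_continuousAt (hd.continuous.continuousAt (x := ζ₀))).inv₀ (hne ε hε ζ₀ hn.le)
    have h5 := h4.mul hVt
    have h6 := tendsto_nhds_unique (ht.congr' (by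
      filter_upwards [eventually_radial_mem_disc hn.le] with ρ hρ
      exact hh _ hρ)) h5
    rw [h6, ← mul_pow]
    gcongr
    have h7 : (2 : ENNReal) ^ N = ‖(2 ^ N : ℂ)‖ₑ := by
      rw [enorm_pow]; congr 1; rw [← ofReal_norm]; simp
    rw [h7, ← enorm_mul, enorm_le_iff_norm_le, norm_mul, norm_mul, norm_div, norm_inv]
    have h8 := hcmp ε hε ζ₀ hn.le
    have h9 : 0 < ‖∏ ζ ∈ S, (ζ₀ - ζ) ^ m ζ‖ := norm_pos_iff.2 hat
    have h10 : 0 < ‖∏ ζ ∈ S, (ζ₀ - (1 + ε) * ζ) ^ m ζ‖ := norm_pos_iff.2 (hne ε hε ζ₀ hn.le)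
    have h11 : ‖(2 ^ N : ℂ)‖ = 2 ^ N := by simp
    rw [h11, inv_mul_eq_div, ← mul_div_assoc, div_le_div_iff₀ h10 h9]
    calc _ ≤ ‖boundaryFn V.fn ζ₀‖ * (2 ^ N * ‖∏ ζ ∈ S, (ζ₀ - (1 + ε) * ζ) ^ m ζ‖) :=
          mul_le_mul_of_nonneg_left h8 (norm_nonneg _)
      _ = _ := by ring
  have hlim : ∀ r : ℝ, 0 ≤ r → r < 1 → ∫⁻ t : ℝ, ‖V.fn (r * Complex.exp (t * Complex.I)) /
        ∏ ζ ∈ S, (r * Complex.exp (t * Complex.I) - ζ) ^ m ζ‖ₑ ^ 2 ∂arcMeasure ≤ (2 ^ N) ^ 2 * I := by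
    intro r h0 h1
    have hVc : Continuous fun t : ℝ => V.fn (r * Complex.exp (t * Complex.I)) := by
      refine V.differentiableOn.continuousOn.comp_continuous (by fun_prop) fun t =>
        ofReal_mul_mem_disc (Complex.norm_exp_ofReal_mul_I t).le h0 h1
    have hfat := lintegral_liminf_le' (u := atTop) (μ := arcMeasure) (f := fun (n : ℕ) (t : ℝ) =>
      ‖V.fn (r * Complex.exp (t * Complex.I)) /
        ∏ ζ ∈ S, (r * Complex.exp (t * Complex.I) - (1 + (1 / ((n : ℝ) + 1) : ℝ)) * ζ) ^ m ζ‖ₑ ^ 2) (fun n => by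
          refine (Continuous.div hVc (by fun_prop) fun t => ?_).aemeasurable.enorm.pow_const 2
          exact hne _ (by positivity) _ (mem_disc.1 (ofReal_mul_mem_disc (Complex.norm_exp_ofReal_mul_I t).le h0 h1)).le)
    refine le_trans (le_trans (le_of_eq ?_) hfat) ?_
    · congr 1 with t
      symm
      refine Tendsto.liminf_eq ?_
      have hd := ofReal_mul_mem_disc (Complex.norm_exp_ofReal_mul_I t).le h0 h1
      have hc : Tendsto (fun n : ℕ => ∏ ζ ∈ S, (r * Complex.exp (t * Complex.I) - (1 + (1 / ((n : ℝ) + 1) : ℝ)) * ζ) ^ m ζ)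
          atTop (𝓝 (∏ ζ ∈ S, (r * Complex.exp (t * Complex.I) - ζ) ^ m ζ)) := by
        have h2 : Continuous fun ε : ℝ => ∏ ζ ∈ S, (r * Complex.exp (t * Complex.I) - (1 + ε) * ζ) ^ m ζ := by fun_prop
        have h3 := (h2.tendsto 0).comp tendsto_one_div_add_atTop_nhds_zero_nat
        simpa [Function.comp_def] using h3
      have h4 := (tendsto_const_nhds (x := V.fn (r * Complex.exp (t * Complex.I)))).div hc (hne0 _ hd)
      exact (ENNReal.continuous_pow 2).continuousAt.tendsto.comp h4.enorm
    · refine Filter.liminf_le_of_le (by isBoundedDefault) fun b hb => ?_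
      obtain ⟨n, hn⟩ := hb.exists
      exact hn.trans (hmean _ (by positivity) r h0 h1)
  have hpi : ENNReal.ofReal (2 * Real.pi) ≠ 0 := by
    rw [Ne, ENNReal.ofReal_eq_zero, not_le]; positivity
  obtain ⟨W, hW, -⟩ := exists_H2_of_circle_le (F := fun z => V.fn z / ∏ ζ ∈ S, (z - ζ) ^ m ζ)
    (V.differentiableOn.div (hdiff 0).differentiableOn hne0)
    (M := ((2 ^ N) ^ 2 * I / ENNReal.ofReal (2 * Real.pi)).toReal) ENNReal.toReal_nonneg (fun r h0 h1 => by
      refine (hlim r h0 h1).trans (le_of_eq ?_)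
      rw [ENNReal.ofReal_toReal (ENNReal.div_ne_top (ENNReal.mul_ne_top (by simp) hI) hpi),
        ENNReal.mul_div_cancel hpi ENNReal.ofReal_ne_top])
  exact ⟨W, fun z hz => by rw [hW z hz, mul_div_cancel₀ _ (hne0 z hz)]⟩

/-- Bounded analytic functions on the disc. -/
def BddAnalytic (ψ : ℂ → ℂ) : Prop :=
  DifferentiableOn ℂ ψ disc ∧ ∃ C : ℝ, 0 ≤ C ∧ ∀ z ∈ disc, ‖ψ z‖ ≤ C

namespace BddAnalytic

theorem mul {ψ χ : ℂ → ℂ} (h : BddAnalytic ψ) (h' : BddAnalytic χ) :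
    BddAnalytic (fun z => ψ z * χ z) := by
  obtain ⟨h1, C, hC, h2⟩ := h
  obtain ⟨h3, D, hD, h4⟩ := h'
  refine ⟨h1.mul h3, C * D, by positivity, fun z hz => ?_⟩
  rw [norm_mul]
  exact mul_le_mul (h2 z hz) (h4 z hz) (norm_nonneg _) hC

theorem const (c : ℂ) : BddAnalytic (fun _ => c) :=
  ⟨differentiableOn_const c, ‖c‖, norm_nonneg _, fun _ _ => le_rfl⟩

theorem pow {ψ : ℂ → ℂ} (h : BddAnalytic ψ) (n : ℕ) : BddAnalytic (fun z => ψ z ^ n) := by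
  induction n with
  | zero => simpa using const 1
  | succ n ih => simpa only [pow_succ] using ih.mul h

theorem add {ψ χ : ℂ → ℂ} (h : BddAnalytic ψ) (h' : BddAnalytic χ) :
    BddAnalytic (fun z => ψ z + χ z) := by
  obtain ⟨h1, C, hC, h2⟩ := h
  obtain ⟨h3, D, hD, h4⟩ := h'
  exact ⟨h1.add h3, C + D, by positivity, fun z hz =>
    (norm_add_le _ _).trans (add_le_add (h2 z hz) (h4 z hz))⟩

theorem of_continuousOn {ψ : ℂ → ℂ} (h : DifferentiableOn ℂ ψ disc)
    (hc : ContinuousOn ψ (Metric.closedBall 0 1)) : BddAnalytic ψ := by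
  obtain ⟨C, hC⟩ := (isCompact_closedBall (0 : ℂ) 1).exists_bound_of_continuousOn hc
  exact ⟨h, C, (norm_nonneg _).trans (hC 0 (by simp)),
    fun z hz => hC z (Metric.ball_subset_closedBall hz)⟩

theorem poly (p : ℂ[X]) : BddAnalytic (fun z => p.eval z) :=
  of_continuousOn p.differentiable.differentiableOn p.continuous.continuousOn

theorem div_poly (p : ℂ[X]) {q : ℂ[X]} (hq : ∀ z : ℂ, ‖z‖ ≤ 1 → q.eval z ≠ 0) :
    BddAnalytic (fun z => p.eval z / q.eval z) :=
  of_continuousOn (p.differentiable.differentiableOn.div q.differentiable.differentiableOn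
    fun z hz => hq z (mem_disc.1 hz).le)
    (p.continuous.continuousOn.div q.continuous.continuousOn fun z hz => hq z (by simpa using hz))

theorem exists_mul {ψ : ℂ → ℂ} (h : BddAnalytic ψ) (f : H2) :
    ∃ g : H2, ∀ z ∈ disc, g.fn z = ψ z * f.fn z := by
  obtain ⟨h1, C, hC, h2⟩ := h
  obtain ⟨g, hg, -⟩ := f.exists_mul h1 hC h2
  exact ⟨g, hg⟩

end BddAnalytic

/-! ### Toeplitz operators -/

theorem toeplitz_fn {ψ : ℂ → ℂ} (h : BddAnalytic ψ) (f : H2) {z : ℂ} (hz : z ∈ disc) :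
    (toeplitz ψ f).fn z = ψ z * f.fn z := by
  have h1 : ∃ T : H2 →L[ℂ] H2, ∀ f : H2, ∀ z ∈ disc, (T f).fn z = ψ z * f.fn z :=
    H2.isFunSpace.exists_weightedComp H2.isFunSpace (φ := id) (mapsTo_id _) fun f => h.exists_mul f
  rw [toeplitz, dif_pos h1]
  exact h1.choose_spec f z hz

theorem toeplitz_comp {ψ χ ω : ℂ → ℂ} (hψ : BddAnalytic ψ) (hχ : BddAnalytic χ) (hω : BddAnalytic ω)
    (h : ∀ z ∈ disc, ψ z * χ z = ω z) : toeplitz ψ * toeplitz χ = toeplitz ω := by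
  ext1 f
  refine H2.ext_of_fn fun z hz => ?_
  rw [mul_apply_eq_comp, toeplitz_fn hψ _ hz, toeplitz_fn hχ _ hz, toeplitz_fn hω _ hz,
    ← mul_assoc, h z hz]

theorem toeplitz_one : toeplitz (fun _ => 1) = 1 := by
  ext1 f
  refine H2.ext_of_fn fun z hz => ?_
  rw [toeplitz_fn (BddAnalytic.const 1) _ hz, one_mul]; rfl

theorem boundaryFn_toeplitz {ψ : ℂ → ℂ} (h : BddAnalytic ψ)
    (hc : ∀ z : ℂ, ‖z‖ = 1 → ContinuousAt ψ z) (f : H2) : ∀ᵐ t : ℝ ∂arcMeasure,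
    boundaryFn (toeplitz ψ f).fn (Complex.exp (t * Complex.I)) =
      ψ (Complex.exp (t * Complex.I)) * boundaryFn f.fn (Complex.exp (t * Complex.I)) := by
  filter_upwards [(toeplitz ψ f).tendsto_boundaryFn, f.tendsto_boundaryFn] with t h1 h2
  have hn := Complex.norm_exp_ofReal_mul_I t
  refine tendsto_nhds_unique (h1.congr' ?_) ((tendsto_radial_of_continuousAt (hc _ hn)).mul h2)
  filter_upwards [eventually_radial_mem_disc hn.le] with ρ hρ
  exact toeplitz_fn h f hρ

theorem H2.norm_sq_eq_of_lintegral {x : ℝ} {f : H2} (h : ENNReal.ofReal (2 * Real.pi) * ‖f‖ₑ ^ 2 = ENNReal.ofReal (2 * Real.pi) * ENNReal.ofReal x) (hx : 0 ≤ x) : ‖f‖ ^ 2 = x := by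
  have hpi : ENNReal.ofReal (2 * Real.pi) ≠ 0 := by
    rw [Ne, ENNReal.ofReal_eq_zero, not_le]; positivity
  rw [ENNReal.mul_right_inj hpi ENNReal.ofReal_ne_top, ← ofReal_norm,
    ← ENNReal.ofReal_pow (norm_nonneg _), ENNReal.ofReal_eq_ofReal_iff (by positivity) hx] at h
  exact h

theorem lintegral_enorm_add_sq (f g : H2) :
    ∫⁻ t : ℝ, (‖boundaryFn f.fn (Complex.exp (t * Complex.I))‖ₑ ^ 2 +
      ‖boundaryFn g.fn (Complex.exp (t * Complex.I))‖ₑ ^ 2) ∂arcMeasure =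
    ENNReal.ofReal (2 * Real.pi) * ENNReal.ofReal (‖f‖ ^ 2 + ‖g‖ ^ 2) := by
  rw [lintegral_add_left' (f.aemeasurable_boundaryFn.enorm.pow_const 2), f.lintegral_boundaryFn,
    g.lintegral_boundaryFn, ← ofReal_norm, ← ofReal_norm, ← ENNReal.ofReal_pow (norm_nonneg _),
    ← ENNReal.ofReal_pow (norm_nonneg _), ← mul_add, ← ENNReal.ofReal_add (by positivity) (by positivity)]

theorem enorm_sq_eq_ofReal (z : ℂ) : ‖z‖ₑ ^ 2 = ENNReal.ofReal (‖z‖ ^ 2) := by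
  rw [← ofReal_norm, ENNReal.ofReal_pow (norm_nonneg _)]

theorem norm_sq_toeplitz_add {ψ χ : ℂ → ℂ} (hψ : BddAnalytic ψ) (hχ : BddAnalytic χ)
    (hψc : ∀ z : ℂ, ‖z‖ = 1 → ContinuousAt ψ z) (hχc : ∀ z : ℂ, ‖z‖ = 1 → ContinuousAt χ z)
    (h : ∀ z : ℂ, ‖z‖ = 1 → ‖χ z‖ ^ 2 + ‖ψ z‖ ^ 2 = 1) (f : H2) :
    ‖toeplitz ψ f‖ ^ 2 + ‖toeplitz χ f‖ ^ 2 = ‖f‖ ^ 2 := by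
  symm
  refine H2.norm_sq_eq_of_lintegral ?_ (by positivity)
  rw [← lintegral_enorm_add_sq, ← f.lintegral_boundaryFn]
  refine lintegral_congr_ae ?_
  filter_upwards [boundaryFn_toeplitz hψ hψc f, boundaryFn_toeplitz hχ hχc f] with t h1 h2
  rw [h1, h2, enorm_sq_eq_ofReal, enorm_sq_eq_ofReal, enorm_sq_eq_ofReal,
    ← ENNReal.ofReal_add (by positivity) (by positivity), norm_mul, norm_mul]
  congr 1
  linear_combination (-‖boundaryFn f.fn (Complex.exp (t * Complex.I))‖ ^ 2) *
    h _ (Complex.norm_exp_ofReal_mul_I t)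

theorem norm_toeplitz_add_sq_le {ψ χ : ℂ → ℂ} (hψ : BddAnalytic ψ) (hχ : BddAnalytic χ)
    (hψc : ∀ z : ℂ, ‖z‖ = 1 → ContinuousAt ψ z) (hχc : ∀ z : ℂ, ‖z‖ = 1 → ContinuousAt χ z)
    (h : ∀ z : ℂ, ‖z‖ = 1 → ‖χ z‖ ^ 2 + ‖ψ z‖ ^ 2 = 1) (f g : H2) :
    ‖toeplitz ψ f + toeplitz χ g‖ ^ 2 ≤ ‖f‖ ^ 2 + ‖g‖ ^ 2 := by
  have hpi : ENNReal.ofReal (2 * Real.pi) ≠ 0 := by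
    rw [Ne, ENNReal.ofReal_eq_zero, not_le]; positivity
  have key : ENNReal.ofReal (2 * Real.pi) * ‖toeplitz ψ f + toeplitz χ g‖ₑ ^ 2 ≤
      ENNReal.ofReal (2 * Real.pi) * ENNReal.ofReal (‖f‖ ^ 2 + ‖g‖ ^ 2) := by
    rw [← lintegral_enorm_add_sq, ← H2.lintegral_boundaryFn]
    refine lintegral_mono_ae ?_
    filter_upwards [boundaryFn_toeplitz hψ hψc f, boundaryFn_toeplitz hχ hχc g,
      (toeplitz ψ f).tendsto_boundaryFn, (toeplitz χ g).tendsto_boundaryFn,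
      (toeplitz ψ f + toeplitz χ g).tendsto_boundaryFn] with t h1 h2 h3 h4 h5
    have hn := Complex.norm_exp_ofReal_mul_I t
    have h6 := tendsto_nhds_unique (h5.congr' (by
      filter_upwards [eventually_radial_mem_disc hn.le] with ρ hρ
      exact H2.fn_add _ _ hρ)) (h3.add h4)
    rw [h6, h1, h2, enorm_sq_eq_ofReal, enorm_sq_eq_ofReal, enorm_sq_eq_ofReal,
      ← ENNReal.ofReal_add (by positivity) (by positivity)]
    refine ENNReal.ofReal_le_ofReal ?_
    set ζ := Complex.exp (t * Complex.I)
    have h7 := norm_add_le (ψ ζ * boundaryFn f.fn ζ) (χ ζ * boundaryFn g.fn ζ)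
    have h8 := h ζ hn
    rw [norm_mul, norm_mul] at h7
    set x := ‖boundaryFn f.fn ζ‖
    set y := ‖boundaryFn g.fn ζ‖
    refine (pow_le_pow_left₀ (norm_nonneg _) h7 2).trans ?_
    have h9 : (‖ψ ζ‖ * x + ‖χ ζ‖ * y) ^ 2 = (‖χ ζ‖ ^ 2 + ‖ψ ζ‖ ^ 2) * (x ^ 2 + y ^ 2) -
      (‖ψ ζ‖ * y - ‖χ ζ‖ * x) ^ 2 := by ring
    rw [h9, h8]
    linarith [sq_nonneg (‖ψ ζ‖ * y - ‖χ ζ‖ * x)]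
  rw [ENNReal.mul_le_mul_iff_right hpi ENNReal.ofReal_ne_top, ← ofReal_norm,
    ← ENNReal.ofReal_pow (norm_nonneg _), ENNReal.ofReal_le_ofReal_iff (by positivity)] at key
  exact key

/-! ### Non-tangential approach -/

theorem tendsto_radial_nonTangential {ζ : ℂ} (hζ : ‖ζ‖ = 1) :
    Tendsto (fun r : ℝ => (r : ℂ) * ζ) (𝓝[<] 1) (nonTangential ζ) := by
  refine Tendsto.mono_right ?_ (le_iSup _ (2 : ℝ))
  refine tendsto_nhdsWithin_iff.2 ⟨tendsto_radial ζ, ?_⟩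
  have h0 : ∀ᶠ r : ℝ in 𝓝[<] 1, 0 < r :=
    eventually_nhdsWithin_of_eventually_nhds (lt_mem_nhds (by norm_num))
  filter_upwards [h0, self_mem_nhdsWithin] with r hr0 hr1
  have hr1 : r < 1 := hr1
  have h1 : ‖(r : ℂ) * ζ‖ = r := by
    rw [norm_mul, hζ, mul_one, Complex.norm_real, Real.norm_eq_abs, abs_of_pos hr0]
  have h2 : (r : ℂ) * ζ - ζ = ((r - 1 : ℝ) : ℂ) * ζ := by push_cast; ring
  refine ⟨by rwa [h1], ?_⟩
  rw [h1, h2, norm_mul, hζ, mul_one, Complex.norm_real, Real.norm_eq_abs, abs_of_neg (by linarith)]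
  linarith

theorem nonTangential_neBot {ζ : ℂ} (hζ : ‖ζ‖ = 1) : (nonTangential ζ).NeBot :=
  (tendsto_radial_nonTangential hζ).neBot

theorem nonTangential_le (ζ : ℂ) : nonTangential ζ ≤ 𝓝 ζ :=
  iSup_le fun _ => nhdsWithin_le_nhds

theorem eventually_nonTangential_mem_disc (ζ : ℂ) : ∀ᶠ z in nonTangential ζ, z ∈ disc := by
  rw [nonTangential, eventually_iSup]
  intro M
  filter_upwards [self_mem_nhdsWithin] with z hz
  exact mem_disc.2 hz.1

theorem tendsto_nonTangential_of_continuousAt {ψ : ℂ → ℂ} {ζ : ℂ} (h : ContinuousAt ψ ζ) :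
    Tendsto ψ (nonTangential ζ) (𝓝 (ψ ζ)) := h.tendsto.mono_left (nonTangential_le ζ)

theorem H2.tendsto_sub_mul (g : H2) {ζ : ℂ} (hζ : ‖ζ‖ = 1) :
    Tendsto (fun z => (z - ζ) * g.fn z) (nonTangential ζ) (𝓝 0) := by
  rw [nonTangential, tendsto_iSup]
  intro M
  have h1 : Tendsto (fun z : ℂ => Real.sqrt (M ^ 2 * ‖g‖ ^ 2 * (1 - ‖z‖)))
      (𝓝[{z : ℂ | ‖z‖ < 1 ∧ ‖z - ζ‖ < M * (1 - ‖z‖)}] ζ) (𝓝 0) := by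
    have : Tendsto (fun z : ℂ => Real.sqrt (M ^ 2 * ‖g‖ ^ 2 * (1 - ‖z‖))) (𝓝 ζ)
        (𝓝 (Real.sqrt (M ^ 2 * ‖g‖ ^ 2 * (1 - ‖ζ‖)))) := Continuous.tendsto (by fun_prop) ζ
    rw [hζ] at this
    simp only [sub_self, mul_zero, Real.sqrt_zero] at this
    exact this.mono_left nhdsWithin_le_nhds
  refine squeeze_zero_norm' ?_ h1
  filter_upwards [self_mem_nhdsWithin] with z hz
  refine Real.le_sqrt_of_sq_le ?_
  have h2 := g.norm_fn_sq_le (mem_disc.2 hz.1)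
  have h3 : 0 < 1 - ‖z‖ := by linarith [hz.1]
  have h4 : (1 - ‖z‖ ^ 2)⁻¹ ≤ (1 - ‖z‖)⁻¹ := by
    refine inv_anti₀ h3 ?_
    nlinarith [norm_nonneg z]
  have h5 : ‖z - ζ‖ ^ 2 ≤ (M * (1 - ‖z‖)) ^ 2 := pow_le_pow_left₀ (norm_nonneg _) hz.2.le 2
  rw [norm_mul, mul_pow]
  calc ‖z - ζ‖ ^ 2 * ‖g.fn z‖ ^ 2 ≤ (M * (1 - ‖z‖)) ^ 2 * (‖g‖ ^ 2 * (1 - ‖z‖)⁻¹) :=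
        mul_le_mul h5 (h2.trans (mul_le_mul_of_nonneg_left h4 (sq_nonneg _))) (sq_nonneg _) (sq_nonneg _)
    _ = _ := by field_simp

/-- A polynomial identity on the disc between elements of `q + c H²` and bounded multiples of
elements of `c (p + H²)` forces divisibility by the polynomial `c` with zeros on the circle. -/
theorem prod_dvd_of_boundary {φ : ℂ → ℂ} {C : ℝ} (hφ : ∀ z ∈ disc, ‖φ z‖ ≤ C) (s : Multiset ℂ)
    (hs : ∀ ζ ∈ s, ‖ζ‖ = 1) (p a q : ℂ[X]) (g h : H2)
    (H : ∀ z ∈ disc, q.eval z + (s.map fun ζ => X - Polynomial.C ζ).prod.eval z * a.eval z * h.fn z =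
      φ z * ((s.map fun ζ => X - Polynomial.C ζ).prod.eval z * (p.eval z + a.eval z * g.fn z))) :
    (s.map fun ζ => X - Polynomial.C ζ).prod ∣ q := by
  induction s using Multiset.induction_on generalizing q with
  | empty => simp
  | cons ζ s ih =>
    rw [Multiset.map_cons, Multiset.prod_cons] at H ⊢
    set c := (s.map fun ζ => X - Polynomial.C ζ).prod with hc
    have hζ : ‖ζ‖ = 1 := hs ζ (Multiset.mem_cons_self _ _)
    have := nonTangential_neBot hζ
    have hq : q.eval ζ = 0 := by
      have t1 := tendsto_nonTangential_of_continuousAt (q.continuous.continuousAt (x := ζ))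
      have tc := tendsto_nonTangential_of_continuousAt (c.continuous.continuousAt (x := ζ))
      have ta := tendsto_nonTangential_of_continuousAt (a.continuous.continuousAt (x := ζ))
      have tp := tendsto_nonTangential_of_continuousAt (p.continuous.continuousAt (x := ζ))
      have tX : Tendsto (fun z => z - ζ) (nonTangential ζ) (𝓝 0) := by
        have := tendsto_nonTangential_of_continuousAt (ψ := fun z => z - ζ) (ζ := ζ) (by fun_prop)
        simpa using this
      have tg := g.tendsto_sub_mul hζ
      have th := h.tendsto_sub_mul hζ
      have t2 : Tendsto (fun z => c.eval z * ((z - ζ) * p.eval z + a.eval z * ((z - ζ) * g.fn z)))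
          (nonTangential ζ) (𝓝 0) := by
        have := tc.mul ((tX.mul tp).add (ta.mul tg))
        simpa using this
      have t3 : Tendsto (fun z => φ z * (c.eval z * ((z - ζ) * p.eval z + a.eval z * ((z - ζ) * g.fn z))))
          (nonTangential ζ) (𝓝 0) := by
        refine squeeze_zero_norm' ?_ (by
          have := t2.norm.const_mul C
          rwa [norm_zero, mul_zero] at this)
        filter_upwards [eventually_nonTangential_mem_disc ζ] with z hz
        rw [norm_mul]
        exact mul_le_mul_of_nonneg_right (hφ z hz) (norm_nonneg _)
      have t4 : Tendsto (fun z => c.eval z * a.eval z * ((z - ζ) * h.fn z)) (nonTangential ζ) (𝓝 0) := by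
        have := (tc.mul ta).mul th
        simpa using this
      have t5 := t3.sub t4
      rw [sub_zero] at t5
      refine tendsto_nhds_unique t1 (t5.congr' ?_)
      filter_upwards [eventually_nonTangential_mem_disc ζ] with z hz
      have := H z hz
      simp only [eval_mul, eval_sub, eval_X, eval_C] at this
      linear_combination -this
    obtain ⟨q', rfl⟩ := dvd_iff_isRoot.2 hq
    refine mul_dvd_mul_left _ (ih (fun ζ hζ => hs ζ (Multiset.mem_cons_of_mem hζ)) q' fun z hz => ?_)
    have h1 := H z hz
    simp only [eval_mul, eval_sub, eval_X, eval_C] at h1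
    have hne : z - ζ ≠ 0 := sub_ne_zero.2 fun h => by
      have := mem_disc.1 hz
      rw [h, hζ] at this
      exact lt_irrefl _ this
    refine mul_left_cancel₀ hne ?_
    linear_combination h1

/-! ### The polynomial `a` and the space `a H² ⊕ P_{N-1}` -/

/-- The polynomial `a`. -/
noncomputable def aPoly (A : RatFunc ℂ) : ℂ[X] := ∏ ζ ∈ circleZeros A, (X - C ζ) ^ zeroMult A ζ

theorem norm_of_mem_circleZeros {A : RatFunc ℂ} {ζ : ℂ} (h : ζ ∈ circleZeros A) : ‖ζ‖ = 1 := by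
  classical
  exact (Finset.mem_filter.1 h).2

theorem aPoly_eval (A : RatFunc ℂ) (z : ℂ) : (aPoly A).eval z = aFn A z := by
  simp [aPoly, aFn, eval_prod]

theorem aPoly_monic (A : RatFunc ℂ) : (aPoly A).Monic :=
  monic_prod_of_monic _ _ fun ζ _ => (monic_X_sub_C ζ).pow _

theorem aPoly_natDegree (A : RatFunc ℂ) : (aPoly A).natDegree = aDeg A := by
  rw [aPoly, natDegree_prod_of_monic _ _ fun ζ _ => (monic_X_sub_C ζ).pow _]
  simp [aDeg]

theorem aPoly_degree (A : RatFunc ℂ) : (aPoly A).degree = aDeg A := by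
  rw [degree_eq_natDegree (aPoly_monic A).ne_zero, aPoly_natDegree]

theorem aPoly_eval_eq_zero {A : RatFunc ℂ} {z : ℂ} (h : (aPoly A).eval z = 0) : z ∈ circleZeros A := by
  rw [aPoly_eval, aFn, Finset.prod_eq_zero_iff] at h
  obtain ⟨ζ, hζ, h⟩ := h
  rwa [sub_eq_zero.1 (eq_zero_of_pow_eq_zero h)]

theorem aFn_ne_zero (A : RatFunc ℂ) {z : ℂ} (hz : z ∈ disc) : aFn A z ≠ 0 := by
  rw [← aPoly_eval]
  intro h
  have := mem_disc.1 hz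
  rw [norm_of_mem_circleZeros (aPoly_eval_eq_zero h)] at this
  exact lt_irrefl _ this

theorem pow_zeroMult_dvd_aPoly {A : RatFunc ℂ} {ζ : ℂ} (h : ζ ∈ circleZeros A) :
    (X - C ζ) ^ zeroMult A ζ ∣ aPoly A := Finset.dvd_prod_of_mem _ h

theorem aPoly_dvd_of {A : RatFunc ℂ} {q : ℂ[X]}
    (h : ∀ ζ ∈ circleZeros A, (X - C ζ) ^ zeroMult A ζ ∣ q) : aPoly A ∣ q := by
  refine Finset.prod_dvd_of_coprime (fun ζ _ ξ _ hne => ?_) h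
  exact (isCoprime_X_sub_C_of_isUnit_sub (sub_ne_zero.2 hne).isUnit).pow

/-- Divisors of `a` are products of linear factors with zeros on the circle. -/
theorem dvd_of_dvd_aPoly {A : RatFunc ℂ} {c : ℂ[X]} (hc : c ∣ aPoly A) {φ : ℂ → ℂ} {B : ℝ}
    (hφ : ∀ z ∈ disc, ‖φ z‖ ≤ B) (p a q : ℂ[X]) (g h : H2)
    (H : ∀ z ∈ disc, q.eval z + c.eval z * a.eval z * h.fn z =
      φ z * (c.eval z * (p.eval z + a.eval z * g.fn z))) : c ∣ q := by
  have hc0 : c ≠ 0 := ne_zero_of_dvd_ne_zero (aPoly_monic A).ne_zero hc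
  have hl : c.leadingCoeff ≠ 0 := leadingCoeff_ne_zero.2 hc0
  have h1 := (IsAlgClosed.splits c).eq_prod_roots
  set s := c.roots with hs
  set c' := (s.map fun ζ => X - C ζ).prod with hc'
  have hcirc : ∀ ζ ∈ s, ‖ζ‖ = 1 := by
    intro ζ hζ
    have h2 := (mem_roots hc0).1 hζ
    exact norm_of_mem_circleZeros (aPoly_eval_eq_zero (h2.dvd hc))
  have h2 : c' ∣ q := by
    refine prod_dvd_of_boundary hφ s hcirc (C c.leadingCoeff * p) (C c.leadingCoeff * a) q g h fun z hz => ?_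
    have h3 := H z hz
    rw [h1] at h3
    simp only [eval_mul, eval_C, ← hc'] at h3 ⊢
    linear_combination h3
  rw [h1]
  exact (IsUnit.mul_left_dvd (isUnit_C.2 hl.isUnit)).2 h2

theorem aPoly_dvd {A : RatFunc ℂ} {q : ℂ[X]} {h : H2}
    (H : ∀ z ∈ disc, q.eval z + aFn A z * h.fn z = 0) : aPoly A ∣ q := by
  refine dvd_of_dvd_aPoly dvd_rfl (φ := fun _ => 0) (B := 0) (by simp) 0 1 q 0 h fun z hz => ?_
  have := H z hz
  rw [aPoly_eval]; simp [this]

namespace HbSum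

variable {A : RatFunc ℂ}

/-- The polynomial part of an element of `a H² ⊕ P_{N-1}`. -/
noncomputable def poly (f : HbSum A) : ℂ[X] := ∑ k : Fin (aDeg A), C (f.snd k) * X ^ (k : ℕ)

theorem fn_eq (f : HbSum A) (z : ℂ) : f.fn z = aFn A z * f.fst.fn z + f.poly.eval z := by
  simp [HbSum.fn, poly, eval_finsetSum]

theorem degree_poly_lt (f : HbSum A) : f.poly.degree < aDeg A := by
  refine (degree_sum_le _ _).trans_lt ?_
  rw [Finset.sup_lt_iff (WithBot.bot_lt_coe _)]
  intro k _
  exact (degree_C_mul_X_pow_le _ _).trans_lt (by exact_mod_cast k.2)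

theorem poly_coeff (f : HbSum A) (k : Fin (aDeg A)) : f.poly.coeff k = f.snd k := by
  rw [poly, finsetSum_coeff, Finset.sum_eq_single k]
  · simp
  · intro j _ hj
    rw [coeff_C_mul_X_pow, if_neg fun h => hj (Fin.ext h.symm)]
  · simp

theorem exists_poly_eq (g : H2) {p : ℂ[X]} (hp : p.degree < aDeg A) :
    ∃ f : HbSum A, f.fst = g ∧ f.poly = p := by
  refine ⟨WithLp.toLp 2 (g, WithLp.toLp 2 fun k => p.coeff k), rfl, ?_⟩
  ext n
  by_cases hn : n < aDeg A
  · exact poly_coeff _ ⟨n, hn⟩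
  · have hn' : (aDeg A : WithBot ℕ) ≤ n := by exact_mod_cast not_lt.1 hn
    rw [coeff_eq_zero_of_degree_lt ((degree_poly_lt _).trans_le hn'),
      coeff_eq_zero_of_degree_lt (hp.trans_le hn')]

theorem isFunSpace : IsFunSpace (HbSum.fn (A := A)) where
  add f g z hz := by
    simp only [HbSum.fn, WithLp.add_fst, WithLp.add_snd, H2.fn_add _ _ hz, PiLp.add_apply, add_mul,
      Finset.sum_add_distrib]
    ring
  smul c f z hz := by
    simp only [HbSum.fn, WithLp.smul_fst, WithLp.smul_snd, H2.fn_smul, PiLp.smul_apply, smul_eq_mul,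
      mul_assoc, ← Finset.mul_sum]
    ring
  bound z hz := by
    obtain ⟨M, hM⟩ := H2.isFunSpace.bound z hz
    refine ⟨‖aFn A z‖ * |M| + aDeg A, fun f => ?_⟩
    have h1 : ‖f.fst‖ ≤ ‖f‖ := WithLp.norm_fst_le _ f
    have h2 : ‖f.snd‖ ≤ ‖f‖ := WithLp.norm_snd_le _ f
    have h3 : ‖f.fst.fn z‖ ≤ |M| * ‖f‖ := (hM _).trans
      (mul_le_mul (le_abs_self M) h1 (norm_nonneg _) (abs_nonneg _))
    have h4 : ‖∑ k : Fin (aDeg A), f.snd k * z ^ (k : ℕ)‖ ≤ ∑ k : Fin (aDeg A), ‖f‖ := by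
      refine norm_sum_le_of_le _ fun k _ => ?_
      rw [norm_mul, norm_pow]
      have h5 : ‖f.snd k‖ ≤ ‖f.snd‖ := PiLp.norm_apply_le _ _
      have h6 := pow_le_one₀ (n := (k : ℕ)) (norm_nonneg z) (mem_disc.1 hz).le
      exact (mul_le_of_le_one_right (norm_nonneg _) h6).trans (h5.trans h2)
    rw [Finset.sum_const, Finset.card_univ, Fintype.card_fin, nsmul_eq_mul] at h4
    refine (norm_add_le _ _).trans ?_
    rw [norm_mul, add_mul, mul_assoc]
    exact add_le_add (mul_le_mul_of_nonneg_left h3 (norm_nonneg _)) h4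
  inj f hf := by
    have h1 : aPoly A ∣ f.poly := aPoly_dvd (h := f.fst) fun z hz => by
      have := hf z hz
      rw [fn_eq] at this
      rw [add_comm]; exact this
    have h2 : f.poly = 0 := eq_zero_of_dvd_of_degree_lt h1 (by rw [aPoly_degree]; exact f.degree_poly_lt)
    have h3 : f.fst = 0 := H2.isFunSpace.inj _ fun z hz => by
      have := hf z hz
      rw [fn_eq, h2, eval_zero, add_zero] at this
      exact (mul_eq_zero.1 this).resolve_left (aFn_ne_zero A hz)
    have h4 : f.snd = 0 := by
      ext k
      rw [← poly_coeff, h2]; simp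
    refine WithLp.ofLp_injective 2 (Prod.ext h3 h4)

/-- Functions of the form `a g + p` with `p` any polynomial belong to `a H² ⊕ P_{N-1}`. -/
theorem exists_of (g : H2) (p : ℂ[X]) :
    ∃ f : HbSum A, (∀ z ∈ disc, f.fn z = aFn A z * g.fn z + p.eval z) ∧ f.poly = p %ₘ aPoly A := by
  obtain ⟨f, hf1, hf2⟩ := exists_poly_eq (A := A) (g + H2.ofPoly (p /ₘ aPoly A)) (p := p %ₘ aPoly A)
    (by rw [← aPoly_degree]; exact degree_modByMonic_lt _ (aPoly_monic A))
  refine ⟨f, fun z hz => ?_, hf2⟩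
  rw [fn_eq, hf1, hf2, H2.fn_add _ _ hz, H2.fn_ofPoly]
  have := congrArg (fun q => q.eval z) (modByMonic_add_div p (aPoly A))
  simp only [eval_add, eval_mul, aPoly_eval] at this
  linear_combination this

theorem exists_toH2 (f : HbSum A) : ∃ g : H2, ∀ z ∈ disc, g.fn z = f.fn z := by
  obtain ⟨g, hg⟩ := f.fst.exists_mul_poly (aPoly A)
  refine ⟨g + H2.ofPoly f.poly, fun z hz => ?_⟩
  rw [fn_eq, H2.fn_add _ _ hz, hg z hz, H2.fn_ofPoly, aPoly_eval]

variable (A) in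
theorem exists_embedding : ∃ T : HbSum A →L[ℂ] H2, ∀ f, ∀ z ∈ disc, (T f).fn z = f.fn z := by
  obtain ⟨T, hT⟩ := isFunSpace.exists_weightedComp H2.isFunSpace (fn := HbSum.fn (A := A)) (u := fun _ => 1)
    (φ := id) (mapsTo_id _) (by simpa using exists_toH2)
  exact ⟨T, fun f z hz => by simpa using hT f z hz⟩

end HbSum

/-! ### The shift -/

/-- The shift operator on `H²`. -/
noncomputable abbrev shift : H2 →L[ℂ] H2 := toeplitz (fun z => z)

theorem bddAnalytic_id : BddAnalytic (fun z => z) := by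
  simpa using BddAnalytic.poly X

theorem H2.apply_eq_inner (f : H2) (n : ℕ) : f n = inner ℂ (basis n) f :=
  basis.repr_apply_apply f n

theorem shift_basis (n : ℕ) : shift (H2.basis n) = H2.basis (n + 1) :=
  H2.ext_of_fn fun z hz => by
    rw [toeplitz_fn bddAnalytic_id _ hz, H2.fn_basis, H2.fn_basis, pow_succ, mul_comm]

theorem star_shift_apply (f : H2) (n : ℕ) : (star shift f) n = f (n + 1) := by
  rw [H2.apply_eq_inner, ContinuousLinearMap.star_eq_adjoint,
    ContinuousLinearMap.adjoint_inner_right, shift_basis, ← H2.apply_eq_inner]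

theorem star_shift_pow_apply (d : ℕ) (f : H2) (n : ℕ) : ((star shift ^ d) f) n = f (n + d) := by
  induction d generalizing n with
  | zero => rfl
  | succ d ih =>
    rw [pow_succ', mul_apply_eq_comp, star_shift_apply, ih, add_right_comm, add_assoc]

theorem star_shift_mul_shift : star shift * shift = 1 := by
  have h : ∀ n, (star shift * shift) (H2.basis n) = H2.basis n := by
    intro n
    rw [mul_apply_eq_comp, shift_basis]
    ext k
    rw [star_shift_apply, H2.basis_apply, H2.basis_apply, H2.ofPoly_apply, H2.ofPoly_apply,
      coeff_X_pow, coeff_X_pow]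
    simp
  refine ContinuousLinearMap.ext_on (s := range H2.basis) (dense_iff_closure_eq.2 ?_) ?_
  · have := H2.basis.dense_span
    rw [← Submodule.topologicalClosure_coe, this]; rfl
  · rintro _ ⟨n, rfl⟩
    exact h n

theorem star_shift_pow_mul_shift_pow (n : ℕ) : star shift ^ n * shift ^ n = 1 := by
  induction n with
  | zero => simp
  | succ n ih =>
    rw [pow_succ, pow_succ', mul_assoc, ← mul_assoc (star shift), star_shift_mul_shift, one_mul, ih]

theorem aeval_shift (p : ℂ[X]) : aeval shift p = toeplitz (fun z => p.eval z) := by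
  ext1 f
  refine H2.ext_of_fn fun z hz => ?_
  rw [toeplitz_fn (.poly p) f hz]
  induction p using Polynomial.induction_on' with
  | add p q hp hq => rw [map_add, add_apply, H2.fn_add _ _ hz, hp, hq, eval_add, add_mul]
  | monomial n c =>
    rw [aeval_monomial, eval_monomial]
    have h : ∀ n : ℕ, ((shift ^ n) f).fn z = z ^ n * f.fn z := by
      intro n
      induction n with
      | zero => simp
      | succ n ih => rw [pow_succ', mul_apply_eq_comp, toeplitz_fn bddAnalytic_id _ hz, ih]; ring
    rw [mul_apply_eq_comp, Algebra.algebraMap_eq_smul_one, smul_apply, one_apply_eq_self, H2.fn_smul, h, mul_assoc]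

/-- The polynomial `z ^ d * conj (q (1 / conj z))`. -/
noncomputable def conjReverse (d : ℕ) (q : ℂ[X]) : ℂ[X] :=
  ∑ i ∈ Finset.range (d + 1), C (starRingEnd ℂ (q.coeff i)) * X ^ (d - i)

theorem conjReverse_eval {d : ℕ} {q : ℂ[X]} (hq : q.natDegree < d + 1) {ζ : ℂ} (hζ : ‖ζ‖ = 1) :
    (conjReverse d q).eval ζ = ζ ^ d * starRingEnd ℂ (q.eval ζ) := by
  rw [conjReverse, eval_finsetSum, eval_eq_sum_range' hq, map_sum, Finset.mul_sum]
  refine Finset.sum_congr rfl fun i hi => ?_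
  have hi' : i ≤ d := by simpa [Nat.lt_succ_iff] using hi
  have h1 : ζ * starRingEnd ℂ ζ = 1 := by rw [Complex.mul_conj, Complex.normSq_eq_norm_sq, hζ]; simp
  have h2 : ζ ^ i * starRingEnd ℂ ζ ^ i = 1 := by rw [← mul_pow, h1, one_pow]
  simp only [eval_mul, eval_C, eval_pow, eval_X, map_mul, map_pow]
  have h3 : ζ ^ d = ζ ^ (d - i) * ζ ^ i := by rw [← pow_add, Nat.sub_add_cancel hi']
  rw [h3]
  linear_combination (-(starRingEnd ℂ (q.coeff i)) * ζ ^ (d - i)) * h2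

theorem star_shift_pow_mul_aeval {d : ℕ} {q : ℂ[X]} (hq : q.natDegree < d + 1) :
    star shift ^ d * aeval shift q = star (aeval shift (conjReverse d q)) := by
  rw [aeval_eq_sum_range' hq, conjReverse, map_sum, star_sum, Finset.mul_sum]
  refine Finset.sum_congr rfl fun i hi => ?_
  have hi' : i ≤ d := by simpa [Nat.lt_succ_iff] using hi
  rw [map_mul, aeval_C, map_pow, aeval_X, star_mul, star_pow, Algebra.algebraMap_eq_smul_one, star_smul,
    star_one, mul_smul_comm, mul_smul_comm, mul_one]
  have h3 : star shift ^ d = star shift ^ (d - i) * star shift ^ i := by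
    rw [← pow_add, Nat.sub_add_cancel hi']
  rw [h3, mul_assoc, star_shift_pow_mul_shift_pow, mul_one]
  simp

theorem eq_ofPoly_of_star_shift_pow {d : ℕ} {f : H2} (h : (star shift ^ d) f = 0) :
    ∃ p : ℂ[X], p.degree < d ∧ f = H2.ofPoly p := by
  refine ⟨∑ i ∈ Finset.range d, C (f i) * X ^ i, ?_, ?_⟩
  · refine (degree_sum_le _ _).trans_lt ?_
    rw [Finset.sup_lt_iff (WithBot.bot_lt_coe _)]
    intro k hk
    exact (degree_C_mul_X_pow_le _ _).trans_lt (by exact_mod_cast Finset.mem_range.1 hk)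
  · ext n
    rw [H2.ofPoly_apply, finsetSum_coeff]
    simp only [coeff_C_mul_X_pow]
    by_cases hn : n < d
    · rw [Finset.sum_eq_single n]
      · simp
      · intro j _ hj; rw [if_neg (Ne.symm hj)]
      · intro h; exact absurd (Finset.mem_range.2 hn) h
    · rw [Finset.sum_eq_zero fun j hj => if_neg (by have := Finset.mem_range.1 hj; omega)]
      have := star_shift_pow_apply d f (n - d)
      rw [h, Nat.sub_add_cancel (by omega)] at this
      exact this.symm

theorem star_shift_pow_ofPoly {d : ℕ} {p : ℂ[X]} (h : p.degree < d) :
    (star shift ^ d) (H2.ofPoly p) = 0 := by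
  ext n
  rw [star_shift_pow_apply, H2.ofPoly_apply, coeff_eq_zero_of_degree_lt]
  · rfl
  · exact h.trans_le (by exact_mod_cast Nat.le_add_left d n)

theorem finiteDimensional_ker_star_shift_pow (d : ℕ) :
    FiniteDimensional ℂ (star shift ^ d : H2 →L[ℂ] H2).ker := by
  have h : (star shift ^ d : H2 →L[ℂ] H2).ker ≤ (degreeLT ℂ d).map H2.ofPoly := by
    intro f hf
    obtain ⟨p, hp, rfl⟩ := eq_ofPoly_of_star_shift_pow hf
    exact Submodule.mem_map_of_mem (mem_degreeLT.2 hp)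
  have : FiniteDimensional ℂ (degreeLT ℂ d) := (degreeLTEquiv ℂ d).symm.finiteDimensional
  exact Submodule.finiteDimensional_of_le h

/-! ### Rational symbols -/

theorem ratFn_eq (r : RatFunc ℂ) (z : ℂ) : ratFn r z = r.num.eval z / r.denom.eval z := by
  simp [ratFn, RatFunc.eval, eval₂_id]

theorem num_denom_not_both_zero (r : RatFunc ℂ) (z : ℂ) (h1 : r.num.eval z = 0) :
    r.denom.eval z ≠ 0 := by
  obtain ⟨u, v, huv⟩ := RatFunc.isCoprime_num_denom r
  intro h2
  have := congrArg (fun p => p.eval z) huv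
  simp [h1, h2] at this

theorem denom_ne_zero_of_bounded {b : RatFunc ℂ} (hb_an : ∀ z ∈ disc, b.denom.eval z ≠ 0)
    (hb : ∀ z ∈ disc, ‖ratFn b z‖ ≤ 1) (z : ℂ) (hz : ‖z‖ ≤ 1) : b.denom.eval z ≠ 0 := by
  rcases hz.lt_or_eq with h | h
  · exact hb_an z (mem_disc.2 h)
  · intro h0
    have t1 := (tendsto_radial_of_continuousAt (b.num.continuous.continuousAt (x := z))).norm
    have t2 := (tendsto_radial_of_continuousAt (b.denom.continuous.continuousAt (x := z))).norm
    rw [h0, norm_zero] at t2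
    have h1 : ‖b.num.eval z‖ ≤ 0 := by
      refine le_of_tendsto_of_tendsto t1 t2 ?_
      filter_upwards [eventually_radial_mem_disc hz] with r hr
      have h2 := hb _ hr
      rw [ratFn_eq, norm_div, div_le_one (norm_pos_iff.2 (hb_an _ hr))] at h2
      exact h2
    exact num_denom_not_both_zero b z (norm_le_zero_iff.1 h1) h0

theorem bddAnalytic_ratFn {r : RatFunc ℂ} (h : ∀ z : ℂ, ‖z‖ ≤ 1 → r.denom.eval z ≠ 0) :
    BddAnalytic (ratFn r) := by
  have := BddAnalytic.div_poly r.num h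
  simpa only [← ratFn_eq] using this

theorem continuousAt_ratFn {r : RatFunc ℂ} {z : ℂ} (h : r.denom.eval z ≠ 0) :
    ContinuousAt (ratFn r) z := by
  have : ratFn r = fun z => r.num.eval z / r.denom.eval z := funext (ratFn_eq r)
  rw [this]
  exact r.num.continuous.continuousAt.div r.denom.continuous.continuousAt h

theorem exists_num_eq_aPoly_mul {b A : RatFunc ℂ} (hA : IsPythagoreanMate b A) :
    ∃ c : ℂ[X], A.num = aPoly A * c ∧ ∀ z : ℂ, ‖z‖ ≤ 1 → c.eval z ≠ 0 := by
  classical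
  have hnum : ∀ z ∈ disc, A.num.eval z ≠ 0 := fun z hz h => by
    have := hA.no_zeros z hz
    rw [ratFn_eq, h, zero_div] at this
    exact this rfl
  have hn0 : A.num ≠ 0 := fun h => hnum 0 (mem_disc.2 (by simp)) (by simp [h])
  have h1 := (IsAlgClosed.splits A.num).eq_prod_roots
  rw [Finset.prod_multiset_map_count, ← Finset.prod_filter_mul_prod_filter_not _ (fun ζ => ‖ζ‖ = 1)] at h1
  refine ⟨C A.num.leadingCoeff * ∏ ζ ∈ A.num.roots.toFinset.filter (fun ζ => ¬ ‖ζ‖ = 1),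
    (X - C ζ) ^ A.num.roots.count ζ, ?_, fun z hz => ?_⟩
  · have h2 : ∏ ζ ∈ A.num.roots.toFinset.filter (fun ζ => ‖ζ‖ = 1), (X - C ζ) ^ A.num.roots.count ζ =
        aPoly A := by
      refine Finset.prod_congr ?_ fun ζ _ => ?_
      · simp only [circleZeros]
      · rw [count_roots]; rfl
    rw [h2, mul_left_comm] at h1
    exact h1
  · rw [eval_mul, eval_C, eval_prod]
    refine mul_ne_zero (leadingCoeff_ne_zero.2 hn0) (Finset.prod_ne_zero_iff.2 fun ζ hζ => ?_)
    rw [Finset.mem_filter, Multiset.mem_toFinset, mem_roots hn0] at hζ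
    rw [eval_pow, eval_sub, eval_X, eval_C]
    refine pow_ne_zero _ (sub_ne_zero.2 fun h => ?_)
    subst h
    rcases hz.lt_or_eq with h | h
    · exact hnum z (mem_disc.2 h) hζ.1
    · exact hζ.2 h

/-! ### Ranges of operators -/

/-- A vector belongs to the range of `T` as soon as pairing with it is dominated by `T†`. -/
theorem exists_eq_of_adjoint_bound {E F : Type} [NormedAddCommGroup E] [InnerProductSpace ℂ E]
    [CompleteSpace E] [NormedAddCommGroup F] [InnerProductSpace ℂ F] [CompleteSpace F]
    (T : E →L[ℂ] F) (y : F) {M : ℝ} (h : ∀ x : F, ‖inner ℂ y x‖ ≤ M * ‖T.adjoint x‖) :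
    ∃ x : E, T x = y := by
  let L : F →ₗ[ℂ] E := T.adjoint.toLinearMap
  have hker : L.ker ≤ (innerSL ℂ y).toLinearMap.ker := by
    intro x hx
    have h1 := h x
    have h2 : T.adjoint x = 0 := hx
    rw [h2, norm_zero, mul_zero] at h1
    exact norm_le_zero_iff.1 h1
  let ℓ₀ : L.range →ₗ[ℂ] ℂ := (L.ker.liftQ (innerSL ℂ y).toLinearMap hker) ∘ₗ L.quotKerEquivRange.symm.toLinearMap
  have hℓ : ∀ x : F, ℓ₀ ⟨L x, x, rfl⟩ = inner ℂ y x := by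
    intro x
    have : L.quotKerEquivRange.symm ⟨L x, x, rfl⟩ = L.ker.mkQ x := by
      rw [LinearEquiv.symm_apply_eq]; rfl
    simp only [ℓ₀, LinearMap.comp_apply, LinearEquiv.coe_coe, this]
    rfl
  have hbd : ∀ v : L.range, ‖ℓ₀ v‖ ≤ M * ‖v‖ := by
    rintro ⟨_, x, rfl⟩
    rw [hℓ]; exact h x
  obtain ⟨g, hg, -⟩ := exists_extension_norm_eq (𝕜 := ℂ) L.range (ℓ₀.mkContinuous M hbd)
  refine ⟨(InnerProductSpace.toDual ℂ E).symm g, ext_inner_right ℂ fun x => ?_⟩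
  rw [← ContinuousLinearMap.adjoint_inner_right, InnerProductSpace.toDual_symm_apply]
  exact (hg ⟨L x, x, rfl⟩).trans (hℓ x)

theorem opSqrt_isSelfAdjoint {H : Type} [NormedAddCommGroup H] [InnerProductSpace ℂ H] [CompleteSpace H]
    (R : H →L[ℂ] H) : IsSelfAdjoint (opSqrt R) :=
  (CFC.sqrt_nonneg R).isSelfAdjoint

theorem opSqrt_mul_opSqrt {H : Type} [NormedAddCommGroup H] [InnerProductSpace ℂ H] [CompleteSpace H]
    {R : H →L[ℂ] H} (h : 0 ≤ R) : opSqrt R * opSqrt R = R :=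
  CFC.sqrt_mul_sqrt_self R h

section Defect

variable {H : Type} [NormedAddCommGroup H] [InnerProductSpace ℂ H] [CompleteSpace H] {T : H →L[ℂ] H}

theorem one_sub_nonneg (hT : ‖T‖ ≤ 1) : 0 ≤ 1 - T * T.adjoint := by
  rw [ContinuousLinearMap.nonneg_iff_isPositive]
  refine ⟨?_, fun x => ?_⟩
  · have : IsSelfAdjoint (1 - T * T.adjoint) := by
      rw [← ContinuousLinearMap.star_eq_adjoint]
      exact (IsSelfAdjoint.one _).sub (IsSelfAdjoint.mul_star_self T)
    exact this.isSymmetric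
  · have h1 : ‖T.adjoint x‖ ≤ ‖x‖ := by
      refine (T.adjoint.le_opNorm x).trans ?_
      rw [LinearIsometryEquiv.norm_map]
      exact mul_le_of_le_one_left (norm_nonneg _) hT
    have h2 : (1 - T * T.adjoint).reApplyInnerSelf x = ‖x‖ ^ 2 - ‖T.adjoint x‖ ^ 2 := by
      rw [ContinuousLinearMap.reApplyInnerSelf_apply, sub_apply, one_apply_eq_self, inner_sub_left,
        mul_apply_eq_comp, ← ContinuousLinearMap.adjoint_inner_right, map_sub,
        inner_self_eq_norm_sq, inner_self_eq_norm_sq]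
    have h3 := pow_le_pow_left₀ (norm_nonneg _) h1 2
    change 0 ≤ (1 - T * T.adjoint).reApplyInnerSelf x
    rw [h2]; linarith

theorem opSqrt_mul_self (hT : ‖T‖ ≤ 1) :
    opSqrt (1 - T * T.adjoint) * opSqrt (1 - T * T.adjoint) = 1 - T * T.adjoint :=
  opSqrt_mul_opSqrt (one_sub_nonneg hT)

theorem opSqrt_adjoint (R : H →L[ℂ] H) : (opSqrt R).adjoint = opSqrt R := by
  rw [← ContinuousLinearMap.star_eq_adjoint]
  exact opSqrt_isSelfAdjoint R

theorem norm_opSqrt_sq (hT : ‖T‖ ≤ 1) (x : H) :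
    ‖opSqrt (1 - T * T.adjoint) x‖ ^ 2 = ‖x‖ ^ 2 - ‖T.adjoint x‖ ^ 2 := by
  set D := opSqrt (1 - T * T.adjoint) with hD
  have h1 : inner ℂ (D x) (D x) = inner ℂ x x - inner ℂ (T.adjoint x) (T.adjoint x) := by
    rw [← ContinuousLinearMap.adjoint_inner_right, opSqrt_adjoint, ← hD, ← mul_apply_eq_comp, hD,
      opSqrt_mul_self hT, sub_apply, one_apply_eq_self, inner_sub_right, mul_apply_eq_comp,
      ContinuousLinearMap.adjoint_inner_left]
  simp only [inner_self_eq_norm_sq_to_K] at h1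
  exact_mod_cast h1

/-- If `T` and `R` form a contractive row, then the range of `R` lies in the range of the defect
operator of `T`. -/
theorem exists_opSqrt_eq_of_row (hT : ‖T‖ ≤ 1) {R : H →L[ℂ] H}
    (hrow : ∀ f g : H, ‖T f + R g‖ ^ 2 ≤ ‖f‖ ^ 2 + ‖g‖ ^ 2) (g : H) :
    ∃ x, opSqrt (1 - T * T.adjoint) x = R g := by
  refine exists_eq_of_adjoint_bound _ _ (M := ‖g‖) fun h => ?_
  rw [opSqrt_adjoint, ← ContinuousLinearMap.adjoint_inner_right]
  refine (norm_inner_le_norm _ _).trans (mul_le_mul_of_nonneg_left ?_ (norm_nonneg _))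
  refine (sq_le_sq₀ (norm_nonneg _) (norm_nonneg _)).1 ?_
  rw [norm_opSqrt_sq hT]
  set s := ‖T.adjoint h‖ ^ 2 + ‖R.adjoint h‖ ^ 2 with hs
  have h1 : inner ℂ h (T (T.adjoint h) + R (R.adjoint h)) = (s : ℂ) := by
    rw [inner_add_right, ← ContinuousLinearMap.adjoint_inner_left T,
      ← ContinuousLinearMap.adjoint_inner_left R, inner_self_eq_norm_sq_to_K,
      inner_self_eq_norm_sq_to_K, hs]
    push_cast; rfl
  have h2 := norm_inner_le_norm (𝕜 := ℂ) h (T (T.adjoint h) + R (R.adjoint h))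
  have hs0 : 0 ≤ s := by positivity
  rw [h1, Complex.norm_real, Real.norm_eq_abs, abs_of_nonneg hs0] at h2
  have h3 := hrow (T.adjoint h) (R.adjoint h)
  rw [← hs] at h3
  have h4 : s ^ 2 ≤ ‖h‖ ^ 2 * s := by
    calc s ^ 2 ≤ (‖h‖ * ‖T (T.adjoint h) + R (R.adjoint h)‖) ^ 2 := pow_le_pow_left₀ hs0 h2 2
      _ = ‖h‖ ^ 2 * ‖T (T.adjoint h) + R (R.adjoint h)‖ ^ 2 := mul_pow _ _ _
      _ ≤ _ := mul_le_mul_of_nonneg_left h3 (sq_nonneg _)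
  rcases hs0.eq_or_lt with h5 | h5
  · nlinarith [sq_nonneg ‖h‖, sq_nonneg ‖T.adjoint h‖]
  · have : s ≤ ‖h‖ ^ 2 := by
      rw [sq] at h4
      exact le_of_mul_le_mul_right h4 h5
    linarith

/-- If `T` and `R` form an isometric column, and `T† p` lies in the range of `R†`, then `p` lies in
the range of the defect operator of `T`. -/
theorem exists_opSqrt_eq_of_column (hT : ‖T‖ ≤ 1) {R : H →L[ℂ] H}
    (hcol : ∀ f : H, ‖T f‖ ^ 2 + ‖R f‖ ^ 2 = ‖f‖ ^ 2) {p g : H} (hp : T.adjoint p = R.adjoint g) :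
    ∃ x, opSqrt (1 - T * T.adjoint) x = p := by
  set D := opSqrt (1 - T * T.adjoint) with hD
  refine exists_eq_of_adjoint_bound _ _ (M := ‖g‖ * ‖T‖ + ‖p‖ * ‖D‖) fun h => ?_
  rw [opSqrt_adjoint, ← hD]
  have hDD : D (D h) = h - T (T.adjoint h) := by
    rw [← mul_apply_eq_comp, hD, opSqrt_mul_self hT]; rfl
  have hcomm : T.adjoint (D (D h)) = T.adjoint h - T.adjoint (T (T.adjoint h)) := by
    rw [hDD, map_sub]
  have h1 : inner ℂ p h = inner ℂ g (R (T.adjoint h)) + inner ℂ p (D (D h)) := by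
    rw [hDD, inner_sub_right, ← ContinuousLinearMap.adjoint_inner_left T, hp,
      ContinuousLinearMap.adjoint_inner_left]
    ring
  set k := T.adjoint h with hk
  have h2 : ‖R k‖ ^ 2 ≤ (‖T‖ * ‖D h‖) ^ 2 := by
    have e1 : ‖T.adjoint (D h)‖ ≤ ‖T‖ * ‖D h‖ := by
      have := T.adjoint.le_opNorm (D h)
      rwa [LinearIsometryEquiv.norm_map] at this
    have e2 : ‖D h‖ ^ 2 = ‖h‖ ^ 2 - ‖k‖ ^ 2 := norm_opSqrt_sq hT h
    have e3 : ‖D (D h)‖ ^ 2 = ‖D h‖ ^ 2 - ‖T.adjoint (D h)‖ ^ 2 := norm_opSqrt_sq hT (D h)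
    have e4 : ‖h - T k‖ ^ 2 = ‖h‖ ^ 2 - 2 * ‖k‖ ^ 2 + ‖T k‖ ^ 2 := by
      rw [norm_sub_sq (𝕜 := ℂ), ← ContinuousLinearMap.adjoint_inner_left T, ← hk,
        inner_self_eq_norm_sq]
    rw [hDD, e4] at e3
    have e5 := hcol k
    have e6 : ‖R k‖ ^ 2 = ‖T.adjoint (D h)‖ ^ 2 := by linarith
    rw [e6]
    exact pow_le_pow_left₀ (norm_nonneg _) e1 2
  have h3 := (sq_le_sq₀ (norm_nonneg _) (by positivity)).1 h2
  rw [h1]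
  calc _ ≤ ‖inner ℂ g (R k)‖ + ‖inner ℂ p (D (D h))‖ := norm_add_le _ _
    _ ≤ ‖g‖ * ‖R k‖ + ‖p‖ * ‖D (D h)‖ := add_le_add (norm_inner_le_norm _ _) (norm_inner_le_norm _ _)
    _ ≤ ‖g‖ * (‖T‖ * ‖D h‖) + ‖p‖ * (‖D‖ * ‖D h‖) := by
        gcongr
        exact D.le_opNorm _
    _ = _ := by ring

/-- If `1 - T T†` is dominated by `X X†` up to a selfadjoint operator with values in a finite-dimensional
subspace of the range of `X`, then the range of the defect operator lies in the range of `X`. -/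
theorem exists_eq_opSqrt {E : Type} [NormedAddCommGroup E] [InnerProductSpace ℂ E] [CompleteSpace E]
    (hT : ‖T‖ ≤ 1) (X : E →L[ℂ] H) {R : H →L[ℂ] H} {Y : H →L[ℂ] E} (hR : ∀ f, R f = X (Y f))
    (V : Submodule ℂ H) [FiniteDimensional ℂ V] (hV : ∀ v ∈ V, ∃ x, X x = v)
    (hF : ∀ h, (1 - T * T.adjoint - R * R.adjoint) h ∈ V) (x : H) :
    ∃ e, X e = opSqrt (1 - T * T.adjoint) x := by
  set D := opSqrt (1 - T * T.adjoint) with hD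
  set F := 1 - T * T.adjoint - R * R.adjoint with hFdef
  have hFs : ∀ f g, inner ℂ (F f) g = inner ℂ f (F g) := by
    have : IsSelfAdjoint F := by
      rw [hFdef, ← ContinuousLinearMap.star_eq_adjoint, ← ContinuousLinearMap.star_eq_adjoint]
      exact ((IsSelfAdjoint.one _).sub (IsSelfAdjoint.mul_star_self T)).sub (IsSelfAdjoint.mul_star_self R)
    exact this.isSymmetric
  have hproj : ∃ B : ℝ, 0 ≤ B ∧ ∀ h, ‖V.starProjection h‖ ≤ B * ‖X.adjoint h‖ := by
    let v := stdOrthonormalBasis ℂ V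
    choose e he using fun i => hV (v i) (v i).2
    refine ⟨∑ i, ‖e i‖, by positivity, fun h => ?_⟩
    have h1 := v.sum_repr (V.orthogonalProjectionOnto h)
    have h2 : V.starProjection h = ∑ i, v.repr (V.orthogonalProjectionOnto h) i • (v i : H) := by
      rw [Submodule.starProjection_apply]
      conv_lhs => rw [← h1]
      simp
    rw [h2, Finset.sum_mul]
    refine norm_sum_le_of_le _ fun i _ => ?_
    have h3 : ‖(v i : H)‖ = 1 := v.orthonormal.1 i
    rw [norm_smul, h3, mul_one, OrthonormalBasis.repr_apply_apply, Submodule.inner_orthogonalProjectionOnto_eq_of_mem_left,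
      ← he, ← ContinuousLinearMap.adjoint_inner_right]
    exact norm_inner_le_norm _ _
  obtain ⟨B, hB, hproj⟩ := hproj
  have hFbound : ∀ h, ‖inner ℂ h (F h)‖ ≤ ‖F‖ * (B * ‖X.adjoint h‖) ^ 2 := by
    intro h
    set P := V.starProjection h with hP
    have hort : ∀ w ∈ V, inner ℂ h w = inner ℂ P w := by
      intro w hw
      have h1 : inner ℂ (h - P) w = 0 :=
        Submodule.inner_left_of_mem_orthogonal hw (Submodule.sub_starProjection_mem_orthogonal h)
      rwa [inner_sub_left, sub_eq_zero] at h1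
    have h2 : F h = F P := by
      refine ext_inner_right ℂ fun g => ?_
      rw [hFs, hFs, hort _ (hF g)]
    rw [h2, hort _ (hF P)]
    calc ‖inner ℂ P (F P)‖ ≤ ‖P‖ * (‖F‖ * ‖P‖) :=
          (norm_inner_le_norm _ _).trans (mul_le_mul_of_nonneg_left (F.le_opNorm _) (norm_nonneg _))
      _ = ‖F‖ * ‖P‖ ^ 2 := by ring
      _ ≤ _ := by gcongr; exact hproj h
  have hDbound : ∀ h, ‖D h‖ ^ 2 ≤ (‖Y.adjoint‖ ^ 2 + ‖F‖ * B ^ 2) * ‖X.adjoint h‖ ^ 2 := by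
    intro h
    have h1 := norm_opSqrt_sq hT h
    have h2 : (inner ℂ h (F h)) = (((‖h‖ ^ 2 - ‖T.adjoint h‖ ^ 2 - ‖R.adjoint h‖ ^ 2 : ℝ)) : ℂ) := by
      rw [hFdef, sub_apply, sub_apply, one_apply_eq_self, mul_apply_eq_comp, mul_apply_eq_comp, inner_sub_right,
        inner_sub_right, ← ContinuousLinearMap.adjoint_inner_left T,
        ← ContinuousLinearMap.adjoint_inner_left R, inner_self_eq_norm_sq_to_K,
        inner_self_eq_norm_sq_to_K, inner_self_eq_norm_sq_to_K]
      push_cast; rfl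
    have h3 := hFbound h
    rw [h2, Complex.norm_real, Real.norm_eq_abs] at h3
    have h4 := le_of_abs_le h3
    have h5 : ‖R.adjoint h‖ ≤ ‖Y.adjoint‖ * ‖X.adjoint h‖ := by
      have : R = X ∘L Y := by ext1 f; exact hR f
      rw [this, ContinuousLinearMap.adjoint_comp]
      exact Y.adjoint.le_opNorm _
    have h6 := pow_le_pow_left₀ (norm_nonneg _) h5 2
    rw [← hD] at h1
    rw [h1]
    nlinarith
  refine exists_eq_of_adjoint_bound X _ (M := ‖x‖ * Real.sqrt (‖Y.adjoint‖ ^ 2 + ‖F‖ * B ^ 2)) fun h => ?_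
  rw [← ContinuousLinearMap.adjoint_inner_right, opSqrt_adjoint, ← hD, mul_assoc]
  refine (norm_inner_le_norm _ _).trans (mul_le_mul_of_nonneg_left ?_ (norm_nonneg _))
  refine (sq_le_sq₀ (norm_nonneg _) (by positivity)).1 ?_
  rw [mul_pow, Real.sq_sqrt (by positivity)]
  exact hDbound h

end Defect

/-! ### The range of the defect operator of a rational symbol -/

theorem H2.apply_zero (f : H2) : f 0 = f.fn 0 := by
  have := (f.hasSum_fn (z := 0) (mem_disc.2 (by simp))).tsum_eq
  rw [tsum_eq_single 0 (by intro n hn; simp [hn])] at this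
  simpa using this

theorem eq_zero_of_star_toeplitz {ψ : ℂ → ℂ} (hψ : BddAnalytic ψ) (h0 : ψ 0 ≠ 0) (d : ℕ) {h : H2}
    (hd : (star shift ^ d) h = 0) (hh : star (toeplitz ψ) h = 0) : h = 0 := by
  induction d generalizing h with
  | zero => simpa using hd
  | succ d ih =>
    have hcomm : star (toeplitz ψ) * star shift = star shift * star (toeplitz ψ) := by
      rw [← star_mul, ← star_mul, toeplitz_comp bddAnalytic_id hψ (bddAnalytic_id.mul hψ) fun _ _ => rfl,
        toeplitz_comp hψ bddAnalytic_id (bddAnalytic_id.mul hψ) fun _ _ => mul_comm _ _]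
    have h1 : star shift h = 0 := by
      refine ih ?_ ?_
      · rw [← mul_apply_eq_comp, ← pow_succ]; exact hd
      · rw [← mul_apply_eq_comp, hcomm, mul_apply_eq_comp, hh, map_zero]
    have h2 : h = h 0 • H2.basis 0 := by
      ext n
      rw [lp.coeFn_smul, Pi.smul_apply, H2.basis_apply, H2.ofPoly_apply, coeff_X_pow]
      rcases n with _ | n
      · simp
      · rw [← star_shift_apply, h1]; simp
    have h3 : inner ℂ (star (toeplitz ψ) h) (H2.basis 0) = 0 := by rw [hh, inner_zero_left]
    rw [ContinuousLinearMap.star_eq_adjoint, ContinuousLinearMap.adjoint_inner_left, h2, inner_smul_left,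
      ← H2.apply_eq_inner, H2.apply_zero (toeplitz ψ _), toeplitz_fn hψ _ (mem_disc.2 (by simp)), H2.fn_basis,
      pow_zero, mul_one] at h3
    have h4 : h 0 = 0 := by simpa [h0] using h3
    rw [h2, h4, zero_smul]

theorem exists_star_toeplitz_eq {ψ : ℂ → ℂ} (hψ : BddAnalytic ψ) (h0 : ψ 0 ≠ 0) (d : ℕ) {h : H2}
    (hd : (star shift ^ d) h = 0) : ∃ g : H2, star (toeplitz ψ) g = h := by
  have := finiteDimensional_ker_star_shift_pow d
  set N := (star shift ^ d : H2 →L[ℂ] H2).ker with hN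
  have hcomm : Commute (star (toeplitz ψ)) (star shift) := by
    rw [Commute, SemiconjBy, ← star_mul, ← star_mul,
      toeplitz_comp bddAnalytic_id hψ (bddAnalytic_id.mul hψ) fun _ _ => rfl,
      toeplitz_comp hψ bddAnalytic_id (bddAnalytic_id.mul hψ) fun _ _ => mul_comm _ _]
  have hmaps : ∀ x ∈ N, (star (toeplitz ψ)).toLinearMap x ∈ N := by
    intro x hx
    have hx : (star shift ^ d) x = 0 := hx
    change (star shift ^ d) (star (toeplitz ψ) x) = 0
    rw [← mul_apply_eq_comp, ← (hcomm.pow_right d).eq, mul_apply_eq_comp, hx, map_zero]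
  have hinj : Function.Injective ((star (toeplitz ψ)).toLinearMap.restrict hmaps) := by
    rw [injective_iff_map_eq_zero]
    intro x hx
    exact Subtype.ext (eq_zero_of_star_toeplitz hψ h0 d x.2 (congrArg Subtype.val hx))
  obtain ⟨g, hg⟩ := LinearMap.injective_iff_surjective.1 hinj ⟨h, hd⟩
  exact ⟨g, congrArg Subtype.val hg⟩

/-- If `|q|² = |p|² + |r|²` on the circle, then `q qʳ = p pʳ + r rʳ` for the conjugate reverses. -/
theorem mul_conjReverse_eq {p q r : ℂ[X]} {d : ℕ} (hp : p.natDegree < d + 1) (hq : q.natDegree < d + 1)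
    (hr : r.natDegree < d + 1)
    (h : ∀ ζ : ℂ, ‖ζ‖ = 1 → ‖q.eval ζ‖ ^ 2 = ‖p.eval ζ‖ ^ 2 + ‖r.eval ζ‖ ^ 2) :
    q * conjReverse d q = p * conjReverse d p + r * conjReverse d r := by
  rw [← sub_eq_zero]
  by_contra hne
  have h1 := ae_eval_exp_ne_zero hne
  have hne0 : (ae arcMeasure).NeBot := by
    rw [ae_neBot, Ne, Measure.restrict_eq_zero, Real.volume_Ioc]
    simp [Real.pi_pos]
  obtain ⟨t, ht⟩ := h1.exists
  refine ht ?_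
  have hn := Complex.norm_exp_ofReal_mul_I t
  set ζ := Complex.exp (t * Complex.I)
  rw [eval_sub, eval_add, eval_mul, eval_mul, eval_mul, conjReverse_eval hp hn, conjReverse_eval hq hn,
    conjReverse_eval hr hn]
  have h2 : ∀ w : ℂ, w * starRingEnd ℂ w = ((‖w‖ ^ 2 : ℝ) : ℂ) := fun w => by
    rw [Complex.mul_conj, Complex.normSq_eq_norm_sq]
  have h3 : q.eval ζ * starRingEnd ℂ (q.eval ζ) = p.eval ζ * starRingEnd ℂ (p.eval ζ) +
      r.eval ζ * starRingEnd ℂ (r.eval ζ) := by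
    rw [h2, h2, h2, h ζ hn]; push_cast; rfl
  linear_combination (ζ ^ d) * h3

section Range

variable {b A : RatFunc ℂ}

theorem bddAnalytic_symbol (hb_an : ∀ z ∈ disc, b.denom.eval z ≠ 0)
    (hb : ∀ z ∈ disc, ‖ratFn b z‖ ≤ 1) : BddAnalytic (ratFn b) :=
  bddAnalytic_ratFn (denom_ne_zero_of_bounded hb_an hb)

theorem norm_toeplitz_symbol_le (hb_an : ∀ z ∈ disc, b.denom.eval z ≠ 0)
    (hb : ∀ z ∈ disc, ‖ratFn b z‖ ≤ 1) (hA : IsPythagoreanMate b A) : ‖toeplitz (ratFn b)‖ ≤ 1 := by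
  refine ContinuousLinearMap.opNorm_le_bound _ zero_le_one fun f => ?_
  have h := norm_sq_toeplitz_add (bddAnalytic_symbol hb_an hb) (bddAnalytic_ratFn hA.no_poles)
    (fun z hz => continuousAt_ratFn (denom_ne_zero_of_bounded hb_an hb z hz.le))
    (fun z hz => continuousAt_ratFn (hA.no_poles z hz.le)) hA.sq_add_sq f
  rw [one_mul]
  refine (sq_le_sq₀ (norm_nonneg _) (norm_nonneg _)).1 ?_
  linarith [sq_nonneg ‖toeplitz (ratFn A) f‖]

theorem exists_common_denom (hb_an : ∀ z ∈ disc, b.denom.eval z ≠ 0)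
    (hb : ∀ z ∈ disc, ‖ratFn b z‖ ≤ 1) (hA : IsPythagoreanMate b A) :
    ∃ (q : ℂ[X]) (d : ℕ), (∀ z : ℂ, ‖z‖ ≤ 1 → q.eval z ≠ 0) ∧
      star shift ^ d * (aeval shift q * (1 - toeplitz (ratFn b) * star (toeplitz (ratFn b)) -
        toeplitz (ratFn A) * star (toeplitz (ratFn A)))) = 0 := by
  have hbd := denom_ne_zero_of_bounded hb_an hb
  have hb' := bddAnalytic_symbol hb_an hb
  have hA' := bddAnalytic_ratFn hA.no_poles
  set q := b.denom * A.denom with hq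
  set p := b.num * A.denom with hp
  set r := A.num * b.denom with hr
  have hq0 : ∀ z : ℂ, ‖z‖ ≤ 1 → q.eval z ≠ 0 := fun z hz => by
    rw [hq, eval_mul]; exact mul_ne_zero (hbd z hz) (hA.no_poles z hz)
  have hqb : ∀ z : ℂ, ‖z‖ ≤ 1 → q.eval z * ratFn b z = p.eval z := fun z hz => by
    have := hbd z hz
    rw [hq, hp, ratFn_eq, eval_mul, eval_mul]; field_simp
  have hqA : ∀ z : ℂ, ‖z‖ ≤ 1 → q.eval z * ratFn A z = r.eval z := fun z hz => by
    have := hA.no_poles z hz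
    rw [hq, hr, ratFn_eq, eval_mul, eval_mul]; field_simp
  set d := max q.natDegree (max p.natDegree r.natDegree) with hd
  have hqd : q.natDegree < d + 1 := by omega
  have hpd : p.natDegree < d + 1 := by omega
  have hrd : r.natDegree < d + 1 := by omega
  refine ⟨q, d, hq0, ?_⟩
  have hid := mul_conjReverse_eq hpd hqd hrd fun ζ hζ => by
    rw [← hqb ζ hζ.le, ← hqA ζ hζ.le, norm_mul, norm_mul, mul_pow, mul_pow, ← mul_add, add_comm (‖ratFn b ζ‖ ^ 2),
      hA.sq_add_sq ζ hζ, mul_one]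
  set Tb := toeplitz (ratFn b)
  set TA := toeplitz (ratFn A)
  have e1 : aeval shift q * Tb = aeval shift p := by
    rw [aeval_shift, aeval_shift]
    exact toeplitz_comp (.poly q) hb' (.poly p) fun z hz => hqb z (mem_disc.1 hz).le
  have e2 : aeval shift q * TA = aeval shift r := by
    rw [aeval_shift, aeval_shift]
    exact toeplitz_comp (.poly q) hA' (.poly r) fun z hz => hqA z (mem_disc.1 hz).le
  have e3 : ∀ s : ℂ[X], s.natDegree < d + 1 → star shift ^ d * (aeval shift s * star (aeval shift s)) =
      star (aeval shift (s * conjReverse d s)) := by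
    intro s hs
    rw [← mul_assoc, star_shift_pow_mul_aeval hs, ← star_mul, ← map_mul]
  have hinv := BddAnalytic.div_poly 1 hq0
  have e4 : toeplitz (fun z => (1 : ℂ[X]).eval z / q.eval z) * aeval shift q = 1 := by
    rw [aeval_shift, ← toeplitz_one]
    refine toeplitz_comp hinv (.poly q) (BddAnalytic.const 1) fun z hz => ?_
    have := hq0 z (mem_disc.1 hz).le
    rw [eval_one]; field_simp
  set Q := aeval shift q
  set Qi := toeplitz (fun z => (1 : ℂ[X]).eval z / q.eval z)
  have e5 : star Q * star Qi = 1 := by rw [← star_mul, e4, star_one]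
  have e6 : star shift ^ d * (Q * (1 - Tb * star Tb - TA * star TA)) * star Q = 0 := by
    have : star shift ^ d * (Q * (1 - Tb * star Tb - TA * star TA)) * star Q =
        star shift ^ d * (Q * star Q) - star shift ^ d * ((Q * Tb) * star (Q * Tb)) -
          star shift ^ d * ((Q * TA) * star (Q * TA)) := by
      rw [star_mul, star_mul]; noncomm_ring
    rw [this, e1, e2, e3 q hqd, e3 p hpd, e3 r hrd, hid, map_add, star_add]
    abel
  calc _ = star shift ^ d * (Q * (1 - Tb * star Tb - TA * star TA)) * (star Q * star Qi) := by rw [e5, mul_one]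
    _ = 0 := by rw [← mul_assoc, e6, zero_mul]

/-- Elements of the range of the defect operator are of the form `a g + p`. -/
theorem exists_HbSum_eq_defect (hb_an : ∀ z ∈ disc, b.denom.eval z ≠ 0)
    (hb : ∀ z ∈ disc, ‖ratFn b z‖ ≤ 1) (hA : IsPythagoreanMate b A) (x : H2) :
    ∃ f : HbSum A, ∀ z ∈ disc, f.fn z = (defect (ratFn b) x).fn z := by
  obtain ⟨q, d, hq0, hF⟩ := exists_common_denom hb_an hb hA
  obtain ⟨c, hc, hc0⟩ := exists_num_eq_aPoly_mul hA
  obtain ⟨X, hX⟩ := HbSum.exists_embedding A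
  have hA' := bddAnalytic_ratFn hA.no_poles
  obtain ⟨Y, hY⟩ := H2.isFunSpace.exists_weightedComp (HbSum.isFunSpace (A := A)) (u := ratFn A) (φ := id)
    (mapsTo_id _) fun f => by
      obtain ⟨g, hg⟩ := (BddAnalytic.div_poly c hA.no_poles).exists_mul f
      obtain ⟨F, hF, -⟩ := HbSum.exists_of (A := A) g 0
      refine ⟨F, fun z hz => ?_⟩
      rw [hF z hz, hg z hz, ratFn_eq, hc, eval_mul, aPoly_eval, eval_zero]
      simp only [id]; ring
  let V := (star shift ^ d * aeval shift q : H2 →L[ℂ] H2).ker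
  have hVq : ∀ v ∈ V, ∃ P : ℂ[X], ∀ z ∈ disc, q.eval z * v.fn z = P.eval z := by
    intro v hv
    obtain ⟨P, -, hP⟩ := eq_ofPoly_of_star_shift_pow (d := d) (f := aeval shift q v) hv
    refine ⟨P, fun z hz => ?_⟩
    have := congrArg (fun f : H2 => f.fn z) hP
    simp only [aeval_shift, toeplitz_fn (.poly q) v hz, H2.fn_ofPoly] at this
    exact this
  have hinj : Function.Injective (aeval shift q : H2 →L[ℂ] H2) := by
    rw [injective_iff_map_eq_zero]
    intro f hf
    refine H2.isFunSpace.inj f fun z hz => ?_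
    have := congrArg (fun f : H2 => f.fn z) hf
    simp only [aeval_shift, toeplitz_fn (.poly q) f hz, H2.isFunSpace.zero hz] at this
    exact (mul_eq_zero.1 this).resolve_left (hq0 z (mem_disc.1 hz).le)
  have hVfin : FiniteDimensional ℂ V := by
    have := finiteDimensional_ker_star_shift_pow d
    have hmaps : ∀ v ∈ V, (aeval shift q : H2 →L[ℂ] H2).toLinearMap v ∈ (star shift ^ d : H2 →L[ℂ] H2).ker :=
      fun v hv => hv
    refine FiniteDimensional.of_injective ((aeval shift q : H2 →L[ℂ] H2).toLinearMap.restrict hmaps) ?_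
    intro v w hvw
    exact Subtype.ext (hinj (congrArg Subtype.val hvw))
  have hcop : IsCoprime q (aPoly A) := by
    refine IsCoprime.symm (IsCoprime.prod_left fun ζ hζ => IsCoprime.pow_left ?_)
    refine ((irreducible_X_sub_C ζ).coprime_iff_not_dvd).2 fun h => ?_
    exact hq0 ζ (norm_of_mem_circleZeros hζ).le (dvd_iff_isRoot.1 h)
  have hVX : ∀ v ∈ V, ∃ e, X e = v := by
    intro v hv
    obtain ⟨P, hP⟩ := hVq v hv
    obtain ⟨s, t, hst⟩ := hcop
    obtain ⟨g, hg⟩ := (BddAnalytic.div_poly (P * t) hq0).exists_mul (H2.ofPoly 1)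
    obtain ⟨F, hF, -⟩ := HbSum.exists_of (A := A) g (P * s)
    refine ⟨F, H2.ext_of_fn fun z hz => ?_⟩
    have hqz := hq0 z (mem_disc.1 hz).le
    have h1 := congrArg (fun f => f.eval z) hst
    simp only [eval_add, eval_mul, eval_one, aPoly_eval] at h1
    refine mul_left_cancel₀ hqz ?_
    rw [hX F z hz, hF z hz, hg z hz, hP z hz, H2.fn_ofPoly, eval_mul, eval_mul, eval_one]
    field_simp
    linear_combination (P.eval z) * h1
  obtain ⟨F, hF⟩ := exists_eq_opSqrt (norm_toeplitz_symbol_le hb_an hb hA) X (R := toeplitz (ratFn A)) (Y := Y)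
    (fun f => H2.ext_of_fn fun z hz => by rw [toeplitz_fn hA' f hz, hX _ z hz, hY f z hz]; rfl) V hVX
    (fun h => by
      have := congrArg (fun T : H2 →L[ℂ] H2 => T h) hF
      simp only [← mul_assoc] at this
      exact this) x
  refine ⟨F, fun z hz => ?_⟩
  rw [← hX F z hz, hF]; rfl

/-- Functions of the form `a g + p` are in the range of the defect operator. -/
theorem exists_defect_eq_HbSum (hb_an : ∀ z ∈ disc, b.denom.eval z ≠ 0)
    (hb : ∀ z ∈ disc, ‖ratFn b z‖ ≤ 1) (hA : IsPythagoreanMate b A) (f : HbSum A) :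
    ∃ x : H2, ∀ z ∈ disc, (defect (ratFn b) x).fn z = f.fn z := by
  obtain ⟨c, hc, hc0⟩ := exists_num_eq_aPoly_mul hA
  have hb' := bddAnalytic_symbol hb_an hb
  have hA' := bddAnalytic_ratFn hA.no_poles
  have hbc : ∀ z : ℂ, ‖z‖ = 1 → ContinuousAt (ratFn b) z := fun z hz =>
    continuousAt_ratFn (denom_ne_zero_of_bounded hb_an hb z hz.le)
  have hAc : ∀ z : ℂ, ‖z‖ = 1 → ContinuousAt (ratFn A) z := fun z hz =>
    continuousAt_ratFn (hA.no_poles z hz.le)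
  have hn := norm_toeplitz_symbol_le hb_an hb hA
  obtain ⟨g, hg⟩ := (BddAnalytic.div_poly A.denom hc0).exists_mul f.fst
  obtain ⟨x, hx⟩ := exists_opSqrt_eq_of_row hn
    (norm_toeplitz_add_sq_le hb' hA' hbc hAc hA.sq_add_sq) g
  set d := f.poly.natDegree + 1 with hd
  have hd1 : (star shift ^ d) (H2.ofPoly f.poly) = 0 :=
    star_shift_pow_ofPoly (degree_le_natDegree.trans_lt (by exact_mod_cast Nat.lt_succ_self _))
  have hcomm : Commute (star (toeplitz (ratFn b))) (star shift) := by
    rw [Commute, SemiconjBy, ← star_mul, ← star_mul,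
      toeplitz_comp bddAnalytic_id hb' (bddAnalytic_id.mul hb') fun _ _ => rfl,
      toeplitz_comp hb' bddAnalytic_id (bddAnalytic_id.mul hb') fun _ _ => mul_comm _ _]
  have hd2 : (star shift ^ d) (star (toeplitz (ratFn b)) (H2.ofPoly f.poly)) = 0 := by
    rw [← mul_apply_eq_comp, ← (hcomm.pow_right d).eq, mul_apply_eq_comp, hd1, map_zero]
  obtain ⟨k, hk⟩ := exists_star_toeplitz_eq hA' (hA.no_zeros 0 (mem_disc.2 (by simp))) d hd2
  obtain ⟨y, hy⟩ := exists_opSqrt_eq_of_column hn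
    (norm_sq_toeplitz_add hb' hA' hbc hAc hA.sq_add_sq) hk.symm
  refine ⟨x + y, fun z hz => ?_⟩
  rw [defect, map_add, hx, hy, H2.fn_add _ _ hz, toeplitz_fn hA' _ hz, hg z hz, H2.fn_ofPoly, HbSum.fn_eq,
    ratFn_eq, hc, eval_mul, aPoly_eval]
  have h1 := hc0 z (mem_disc.1 hz).le
  have h2 := hA.no_poles z (mem_disc.1 hz).le
  field_simp

theorem Hb.isFunSpace (β : ℂ → ℂ) : IsFunSpace (Hb.fn (b := β)) where
  add f g z hz := by
    rw [Hb.fn, Submodule.coe_add, map_add, H2.fn_add _ _ hz]; rfl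
  smul c f z hz := by
    rw [Hb.fn, Submodule.coe_smul, map_smul, H2.fn_smul]; rfl
  bound z hz := by
    obtain ⟨C, hC⟩ := H2.isFunSpace.bound z hz
    refine ⟨|C| * ‖defect β‖, fun f => (hC _).trans ?_⟩
    rw [mul_assoc]
    exact mul_le_mul (le_abs_self C) ((defect β).le_opNorm _) (norm_nonneg _) (abs_nonneg _)
  inj f hf := by
    have h1 : (f : H2) ∈ (defect β).ker := H2.isFunSpace.inj _ hf
    have h2 := Submodule.inner_right_of_mem_orthogonal h1 f.2
    exact Subtype.ext (inner_self_eq_zero.1 h2)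

theorem exists_Hb_eq_HbSum (hb_an : ∀ z ∈ disc, b.denom.eval z ≠ 0)
    (hb : ∀ z ∈ disc, ‖ratFn b z‖ ≤ 1) (hA : IsPythagoreanMate b A) (f : HbSum A) :
    ∃ g : Hb (ratFn b), ∀ z ∈ disc, Hb.fn g z = f.fn z := by
  obtain ⟨x, hx⟩ := exists_defect_eq_HbSum hb_an hb hA f
  set K := (defect (ratFn b)).ker
  refine ⟨⟨x - K.starProjection x, Submodule.sub_starProjection_mem_orthogonal x⟩, fun z hz => ?_⟩
  have h1 : defect (ratFn b) (K.starProjection x) = 0 := Submodule.starProjection_apply_mem K x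
  rw [← hx z hz, Hb.fn, map_sub, h1, sub_zero]

end Range

/-! ### Multiplication by polynomials in `φ` -/

theorem exists_eval_sub_eq {φ : ℂ → ℂ} (hφ : BddAnalytic φ) (s Q : ℂ[X]) :
    ∃ ψ : ℂ → ℂ, BddAnalytic ψ ∧
      ∀ z, Q.eval (φ z) - Q.eval (s.eval z) = (φ z - s.eval z) * ψ z := by
  induction Q using Polynomial.induction_on with
  | C c => exact ⟨fun _ => 0, .const 0, by simp⟩
  | add P Q hP hQ =>
    obtain ⟨ψ, h1, h2⟩ := hP
    obtain ⟨χ, h3, h4⟩ := hQ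
    refine ⟨_, h1.add h3, fun z => ?_⟩
    rw [eval_add, eval_add]
    linear_combination h2 z + h4 z
  | monomial n c hQ =>
    obtain ⟨ψ, h1, h2⟩ := hQ
    refine ⟨_, (h1.mul hφ).add (.poly (C c * s ^ n)), fun z => ?_⟩
    have := h2 z
    simp only [eval_mul, eval_C, eval_pow, eval_X] at this ⊢
    linear_combination φ z * this

namespace HbSum

variable {A : RatFunc ℂ} {φ : ℂ → ℂ}

/-- If `u` and `u φ` belong to `a H² ⊕ P_{N-1}` then `φ` is, up to `a H²`, a polynomial `s` where `u`
lives. -/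
theorem exists_mul_sub_eval (hφ : BddAnalytic φ) (F F' : HbSum A)
    (h : ∀ z ∈ disc, F'.fn z = φ z * F.fn z) :
    ∃ (s : ℂ[X]) (G : H2), ∀ z ∈ disc, F.fn z * (φ z - s.eval z) = aFn A z * G.fn z := by
  obtain ⟨-, B, -, hB⟩ := hφ
  have ha := (aPoly_monic A).ne_zero
  obtain ⟨a', ha'⟩ := EuclideanDomain.gcd_dvd_right F.poly (aPoly A)
  obtain ⟨p', hp'⟩ := EuclideanDomain.gcd_dvd_left F.poly (aPoly A)
  have hc : EuclideanDomain.gcd F.poly (aPoly A) ∣ aPoly A := EuclideanDomain.gcd_dvd_right _ _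
  have hc0 : EuclideanDomain.gcd F.poly (aPoly A) ≠ 0 := ne_zero_of_dvd_ne_zero ha hc
  have hco := EuclideanDomain.gcd_eq_gcd_ab F.poly (aPoly A)
  generalize EuclideanDomain.gcdA F.poly (aPoly A) = α at *
  generalize EuclideanDomain.gcdB F.poly (aPoly A) = β at *
  generalize EuclideanDomain.gcd F.poly (aPoly A) = c at *
  have hco' : α * p' + β * a' = 1 := mul_left_cancel₀ hc0 (by
    linear_combination -hco - α * hp' - β * ha')
  have e1 : ∀ z, aFn A z = c.eval z * a'.eval z := fun z => by rw [← aPoly_eval, ← eval_mul, ← ha']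
  have e2 : ∀ z, F.poly.eval z = c.eval z * p'.eval z := fun z => by rw [← eval_mul, ← hp']
  obtain ⟨q', hq'⟩ := dvd_of_dvd_aPoly hc hB p' a' F'.poly F.fst F'.fst fun z hz => by
    have := h z hz
    rw [fn_eq, fn_eq, e1, e2] at this
    linear_combination this
  obtain ⟨g, hg⟩ := F.fst.exists_mul_poly (α * q')
  refine ⟨α * q', F'.fst - g + H2.ofPoly (q' * β), fun z hz => ?_⟩
  have h1 := h z hz
  have h2 := congrArg (eval z) hco'
  have h3 := hg z hz
  rw [H2.fn_add _ _ hz, H2.isFunSpace.sub _ _ hz, h3, H2.fn_ofPoly, e1]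
  rw [fn_eq, fn_eq, e1, e2, hq'] at h1
  rw [fn_eq, e1, e2]
  simp only [eval_mul, eval_add, eval_one] at h1 h2 ⊢
  linear_combination -h1 - c.eval z * q'.eval z * h2

theorem exists_mul_eval_comp (hφ : BddAnalytic φ) {F : HbSum A} {s : ℂ[X]} {G : H2}
    (h : ∀ z ∈ disc, F.fn z * (φ z - s.eval z) = aFn A z * G.fn z) (Q : ℂ[X]) :
    ∃ F' : HbSum A, (∀ z ∈ disc, F'.fn z = F.fn z * Q.eval (φ z)) ∧
      F'.poly = (F.poly * Q.comp s) %ₘ aPoly A := by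
  obtain ⟨ψ, hψ, hψ'⟩ := exists_eval_sub_eq hφ s Q
  obtain ⟨g, hg⟩ := F.fst.exists_mul_poly (Q.comp s)
  obtain ⟨k, hk⟩ := hψ.exists_mul G
  obtain ⟨F', h1, h2⟩ := exists_of (A := A) (g + k) (F.poly * Q.comp s)
  refine ⟨F', fun z hz => ?_, h2⟩
  have h3 := hψ' z
  have h4 := h z hz
  rw [h1 z hz, H2.fn_add _ _ hz, hg z hz, hk z hz, eval_mul, eval_comp]
  rw [fn_eq] at h4 ⊢
  linear_combination (-aFn A z * F.fst.fn z - eval z F.poly) * h3 - ψ z * h4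

/-! ### Non-tangential limits -/

theorem tendsto_of_not_dvd {F : HbSum A} {s : ℂ[X]} {G : H2}
    (h : ∀ z ∈ disc, F.fn z * (φ z - s.eval z) = aFn A z * G.fn z) {ζ : ℂ} (hζ : ζ ∈ circleZeros A)
    (hp : ¬ (X - C ζ) ^ zeroMult A ζ ∣ F.poly) :
    Tendsto φ (nonTangential ζ) (𝓝 (s.eval ζ)) := by
  have hn := norm_of_mem_circleZeros hζ
  have hp0 : F.poly ≠ 0 := by rintro h0; simp [h0] at hp
  have hk : F.poly.rootMultiplicity ζ < zeroMult A ζ :=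
    not_le.1 fun hle => hp ((le_rootMultiplicity_iff hp0).1 hle)
  obtain ⟨p', hp', hnd⟩ := exists_eq_pow_rootMultiplicity_mul_and_not_dvd F.poly hp0 ζ
  generalize F.poly.rootMultiplicity ζ = k at *
  obtain ⟨a2, ha2⟩ := pow_zeroMult_dvd_aPoly hζ
  obtain ⟨d, hd⟩ := Nat.exists_eq_add_of_lt hk
  set b := (X - C ζ) ^ d * a2 with hb
  have e1 : ∀ z, aFn A z = (z - ζ) ^ k * ((z - ζ) * b.eval z) := fun z => by
    rw [← aPoly_eval, ha2, hd, hb]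
    simp only [eval_mul, eval_pow, eval_sub, eval_X, eval_C]
    ring
  have e2 : ∀ z, F.poly.eval z = (z - ζ) ^ k * p'.eval z := fun z => by
    rw [hp']; simp
  have hp'ζ : p'.eval ζ ≠ 0 := fun h0 => hnd (dvd_iff_isRoot.2 h0)
  have hb' : Tendsto (fun z => b.eval z) (nonTangential ζ) (𝓝 (b.eval ζ)) :=
    tendsto_nonTangential_of_continuousAt b.continuousAt
  have hD : Tendsto (fun z => p'.eval z + b.eval z * ((z - ζ) * F.fst.fn z)) (nonTangential ζ)
      (𝓝 (p'.eval ζ)) := by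
    have := (tendsto_nonTangential_of_continuousAt (ζ := ζ) p'.continuousAt).add
      (hb'.mul (F.fst.tendsto_sub_mul hn))
    rwa [mul_zero, add_zero] at this
  have hN : Tendsto (fun z => b.eval z * ((z - ζ) * G.fn z)) (nonTangential ζ) (𝓝 0) := by
    have := hb'.mul (G.tendsto_sub_mul hn)
    rwa [mul_zero] at this
  have hlim := (tendsto_nonTangential_of_continuousAt (ζ := ζ) s.continuousAt).add (hN.div hD hp'ζ)
  rw [zero_div, add_zero] at hlim
  refine hlim.congr' ?_
  filter_upwards [hD.eventually_ne hp'ζ, eventually_nonTangential_mem_disc ζ] with z hz1 hz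
  have hzζ : z - ζ ≠ 0 := by
    rw [sub_ne_zero]
    rintro rfl
    rw [mem_disc, hn] at hz
    exact lt_irrefl _ hz
  have h1 := h z hz
  rw [fn_eq, e1, e2] at h1
  have h2 : (z - ζ) ^ k ≠ 0 := pow_ne_zero _ hzζ
  have h3 : b.eval z * ((z - ζ) * G.fn z) =
      (φ z - s.eval z) * (p'.eval z + b.eval z * ((z - ζ) * F.fst.fn z)) :=
    mul_left_cancel₀ h2 (by linear_combination -h1)
  simp only [Pi.div_apply]
  rw [h3, mul_div_cancel_right₀ _ hz1]
  ring

end HbSum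

theorem pow_dvd_iff_derivative {p : ℂ[X]} {ζ : ℂ} {m : ℕ} :
    (X - C ζ) ^ m ∣ p ↔ ∀ l < m, (derivative^[l] p).eval ζ = 0 := by
  rcases eq_or_ne p 0 with rfl | hp
  · simp
  rw [← le_rootMultiplicity_iff hp]
  constructor
  · exact fun h l hl => isRoot_iterate_derivative_of_lt_rootMultiplicity (hl.trans_le h)
  · intro h
    rcases m with _ | m
    · exact Nat.zero_le _
    · exact lt_rootMultiplicity_of_isRoot_iterate_derivative hp fun l hl => h l (by omega)

theorem Polynomial.iteratedDeriv_eval (p : ℂ[X]) (l : ℕ) :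
    iteratedDeriv l (fun z => p.eval z) = fun z => (derivative^[l] p).eval z := by
  induction l with
  | zero => simp
  | succ l ih =>
    rw [iteratedDeriv_succ, ih, Function.iterate_succ_apply']
    ext z
    exact Polynomial.deriv _

/-- The derivatives of `(z - ζ)^m b g`, of order less than `m`, have non-tangential limit `0`. -/
theorem H2.norm_iteratedDeriv_le (g : H2) (b : ℂ[X]) (m : ℕ) (ζ : ℂ) (M : ℝ) {l : ℕ}
    (hl : l < m) : ∃ K : ℝ, ∀ z : ℂ, ‖z‖ < 1 → ‖z - ζ‖ < M * (1 - ‖z‖) →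
      ‖iteratedDeriv l (fun w => (w - ζ) ^ m * b.eval w * g.fn w) z‖ ≤ K * Real.sqrt ((1 - ‖z‖) / 2) := by
  obtain ⟨-, B, hB0, hB⟩ := BddAnalytic.poly b
  refine ⟨l.factorial * ((2 * M + 1) ^ m * B * ‖g‖), fun z hz1 hz2 => ?_⟩
  set R := (1 - ‖z‖) / 2 with hR
  have hR0 : 0 < R := by rw [hR]; linarith
  have hR1 : R ≤ 1 := by rw [hR]; linarith [norm_nonneg z]
  have hM : 0 < M := by
    by_contra hM
    nlinarith [norm_nonneg (z - ζ)]
  have hball : ∀ w ∈ Metric.closedBall z R, ‖w‖ ≤ 1 - R := fun w hw => by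
    rw [Metric.mem_closedBall, dist_eq_norm] at hw
    have := norm_le_norm_add_norm_sub' w z
    rw [hR] at hw ⊢; linarith
  have hsub : Metric.closedBall z R ⊆ disc := fun w hw => mem_disc.2 (by linarith [hball w hw])
  have hd : DifferentiableOn ℂ (fun w => (w - ζ) ^ m * b.eval w * g.fn w) disc :=
    (((differentiable_id.sub_const ζ).pow m).mul b.differentiable).differentiableOn.mul g.differentiableOn
  have hs0 : 0 < Real.sqrt R := Real.sqrt_pos.2 hR0
  have key := Complex.norm_iteratedDeriv_le_of_forall_mem_sphere_norm_le (c := z)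
    (C := ((2 * M + 1) * R) ^ m * B * (‖g‖ / Real.sqrt R)) l hR0
    (f := fun w => (w - ζ) ^ m * b.eval w * g.fn w)
    ((hd.mono hsub).diffContOnCl_ball subset_rfl) fun w hw => by
      have hw' := Metric.sphere_subset_closedBall hw
      rw [norm_mul, norm_mul, norm_pow]
      have h1 : ‖w - ζ‖ ≤ (2 * M + 1) * R := by
        have h2 : ‖w - ζ‖ ≤ ‖w - z‖ + ‖z - ζ‖ := by simpa using norm_add_le (w - z) (z - ζ)
        rw [mem_sphere_iff_norm] at hw
        have : 2 * R = 1 - ‖z‖ := by rw [hR]; ring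
        rw [← this] at hz2
        linarith
      have h3 : ‖g.fn w‖ ≤ ‖g‖ / Real.sqrt R := by
        refine abs_le_of_sq_le_sq' ?_ (by positivity) |>.2
        rw [div_pow, Real.sq_sqrt hR0.le, div_eq_mul_inv]
        refine (g.norm_fn_sq_le (hsub hw')).trans ?_
        have h4 := hball w hw'
        refine mul_le_mul_of_nonneg_left (inv_anti₀ hR0 ?_) (sq_nonneg _)
        nlinarith [norm_nonneg w]
      gcongr
      exact hB w (hsub hw')
  refine key.trans ?_
  obtain ⟨d, rfl⟩ := Nat.exists_eq_add_of_lt hl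
  have e1 : R / Real.sqrt R = Real.sqrt R := Real.div_sqrt
  calc l.factorial * (((2 * M + 1) * R) ^ (l + d + 1) * B * (‖g‖ / Real.sqrt R)) / R ^ l
      = l.factorial * ((2 * M + 1) ^ (l + d + 1) * B * ‖g‖) * (R ^ d * (R / Real.sqrt R)) := by
        rw [mul_pow]; field_simp; ring
    _ ≤ l.factorial * ((2 * M + 1) ^ (l + d + 1) * B * ‖g‖) * (1 * (R / Real.sqrt R)) := by
        gcongr
        exact pow_le_one₀ hR0.le hR1
    _ = _ := by rw [e1, one_mul]

namespace HbSum

variable {A : RatFunc ℂ} {φ : ℂ → ℂ}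

theorem tendsto_iteratedDeriv (F : HbSum A) {u : ℂ → ℂ} (hu : ∀ z ∈ disc, u z = F.fn z) {ζ : ℂ}
    (hζ : ζ ∈ circleZeros A) {l : ℕ} (hl : l < zeroMult A ζ) :
    Tendsto (iteratedDeriv l u) (nonTangential ζ) (𝓝 ((derivative^[l] F.poly).eval ζ)) := by
  have hn := norm_of_mem_circleZeros hζ
  obtain ⟨b, hb⟩ := pow_zeroMult_dvd_aPoly hζ
  set v : ℂ → ℂ := fun w => (w - ζ) ^ zeroMult A ζ * b.eval w * F.fst.fn w with hv
  have hvd : DifferentiableOn ℂ v disc := (((differentiable_id.sub_const ζ).pow _).mul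
    b.differentiable).differentiableOn.mul F.fst.differentiableOn
  have h0 : Tendsto (iteratedDeriv l v) (nonTangential ζ) (𝓝 0) := by
    rw [nonTangential, tendsto_iSup]
    intro M
    obtain ⟨K, hK⟩ := F.fst.norm_iteratedDeriv_le b (zeroMult A ζ) ζ M hl
    have h1 : Tendsto (fun z : ℂ => K * Real.sqrt ((1 - ‖z‖) / 2))
        (𝓝[{z : ℂ | ‖z‖ < 1 ∧ ‖z - ζ‖ < M * (1 - ‖z‖)}] ζ) (𝓝 0) := by
      have : Tendsto (fun z : ℂ => K * Real.sqrt ((1 - ‖z‖) / 2)) (𝓝 ζ)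
          (𝓝 (K * Real.sqrt ((1 - ‖ζ‖) / 2))) := Continuous.tendsto (by fun_prop) ζ
      rw [hn] at this
      simp only [sub_self, zero_div, mul_zero, Real.sqrt_zero] at this
      exact this.mono_left nhdsWithin_le_nhds
    refine squeeze_zero_norm' ?_ h1
    filter_upwards [self_mem_nhdsWithin] with z hz
    exact hK z hz.1 hz.2
  have h1 := h0.add (tendsto_nonTangential_of_continuousAt (ζ := ζ) (derivative^[l] F.poly).continuousAt)
  rw [zero_add] at h1
  refine h1.congr' ?_
  filter_upwards [eventually_nonTangential_mem_disc ζ] with z hz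
  have hnhds : disc ∈ 𝓝 z := Metric.isOpen_ball.mem_nhds hz
  have h2 : u =ᶠ[𝓝 z] fun w => v w + F.poly.eval w := by
    filter_upwards [hnhds] with w hw
    rw [hu w hw, fn_eq, ← aPoly_eval, hb, hv]
    simp
  rw [h2.iteratedDeriv_eq, iteratedDeriv_fun_add ((hvd.analyticAt hnhds).contDiffAt)
    F.poly.differentiable.contDiff.contDiffAt, Polynomial.iteratedDeriv_eval]

theorem mem_innerZeros_iff {F : HbSum A} {u : ℂ → ℂ} (hu : ∀ z ∈ disc, u z = F.fn z) {s : ℂ[X]} {G : H2}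
    (h : ∀ z ∈ disc, F.fn z * (φ z - s.eval z) = aFn A z * G.fn z) {ζ : ℂ} :
    ζ ∈ innerZeros A u φ ↔
      ζ ∈ circleZeros A ∧ ¬ (X - C ζ) ^ zeroMult A ζ ∣ F.poly ∧ s.eval ζ ∈ disc := by
  classical
  rw [innerZeros, Finset.mem_filter]
  refine and_congr_right fun hζ => ?_
  have := nonTangential_neBot (norm_of_mem_circleZeros hζ)
  have h1 : (∃ l < zeroMult A ζ, ntLim (iteratedDeriv l u) ζ ≠ 0) ↔
      ¬ (X - C ζ) ^ zeroMult A ζ ∣ F.poly := by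
    rw [pow_dvd_iff_derivative]
    push Not
    refine exists_congr fun l => and_congr_right fun hl => ?_
    rw [ntLim, (F.tendsto_iteratedDeriv hu hζ hl).limUnder_eq]
  rw [h1]
  refine and_congr_right fun hp => ?_
  rw [ntLim, (tendsto_of_not_dvd h hζ hp).limUnder_eq]

theorem ntLim_eq {F : HbSum A} {s : ℂ[X]} {G : H2}
    (h : ∀ z ∈ disc, F.fn z * (φ z - s.eval z) = aFn A z * G.fn z) {ζ : ℂ} (hζ : ζ ∈ circleZeros A)
    (hp : ¬ (X - C ζ) ^ zeroMult A ζ ∣ F.poly) : ntLim φ ζ = s.eval ζ := by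
  have := nonTangential_neBot (norm_of_mem_circleZeros hζ)
  rw [ntLim, (tendsto_of_not_dvd h hζ hp).limUnder_eq]

end HbSum

/-! ### Division in `H²` by polynomials with zeros in the disc -/

theorem H2.mul_fn_star_shift_add (h : H2) {z : ℂ} (hz : z ∈ disc) :
    z * (star shift h).fn z + h 0 = h.fn z := by
  rw [H2.fn, H2.fn, (h.hasSum_fn hz).summable.tsum_eq_zero_add, ← tsum_mul_left, pow_zero, mul_one,
    add_comm]
  congr 2
  ext n
  rw [star_shift_apply]
  ring

theorem norm_star_shift_le : ‖star shift‖ ≤ 1 := by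
  have h := CStarRing.norm_star_mul_self (x := shift)
  rw [star_shift_mul_shift] at h
  have h1 : ‖(1 : H2 →L[ℂ] H2)‖ ≤ 1 := ContinuousLinearMap.norm_id_le
  rw [ContinuousLinearMap.star_eq_adjoint, LinearIsometryEquiv.norm_map]
  nlinarith [norm_nonneg shift]

theorem H2.exists_eq_sub_mul_add (f : H2) {c : ℂ} (hc : c ∈ disc) :
    ∃ (g : H2) (r : ℂ), ∀ z ∈ disc, f.fn z = (z - c) * g.fn z + r := by
  have h1 : ‖c • star shift‖ < 1 := by
    rw [norm_smul]
    exact (mul_le_of_le_one_right (norm_nonneg c) norm_star_shift_le).trans_lt (mem_disc.1 hc)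
  obtain ⟨R, hR⟩ := isUnit_one_sub_of_norm_lt_one h1
  have h2 : (1 - c • star shift) ((↑R⁻¹ : H2 →L[ℂ] H2) f) = f := by
    rw [← hR, ← mul_apply_eq_comp, Units.mul_inv, one_apply_eq_self]
  set h := (↑R⁻¹ : H2 →L[ℂ] H2) f
  refine ⟨star shift h, h 0, fun z hz => ?_⟩
  have h3 := h.mul_fn_star_shift_add hz
  rw [← h2, sub_apply, one_apply_eq_self, smul_apply, H2.isFunSpace.sub _ _ hz, H2.fn_smul]
  linear_combination -h3

theorem H2.exists_eq_prod_mul_add (f : H2) (t : Multiset ℂ) (ht : ∀ c ∈ t, c ∈ disc) :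
    ∃ (g : H2) (r : ℂ[X]), r.natDegree ≤ t.card ∧
      ∀ z ∈ disc, f.fn z = (t.map fun c => X - C c).prod.eval z * g.fn z + r.eval z := by
  induction t using Multiset.induction_on with
  | empty => exact ⟨f, 0, by simp, by simp⟩
  | cons c t ih =>
    obtain ⟨g, r, hr, h⟩ := ih fun c hc => ht c (Multiset.mem_cons_of_mem hc)
    obtain ⟨g', r', h'⟩ := g.exists_eq_sub_mul_add (ht c (Multiset.mem_cons_self c t))
    refine ⟨g', (t.map fun c => X - C c).prod * C r' + r, ?_, fun z hz => ?_⟩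
    · rw [Multiset.card_cons]
      refine (natDegree_add_le _ _).trans (max_le ?_ (hr.trans (Nat.le_succ _)))
      refine (natDegree_mul_C_le _ _).trans ?_
      rw [natDegree_multiset_prod_X_sub_C_eq_card]
      exact Nat.le_succ _
    · rw [h z hz, h' z hz]
      simp only [Multiset.map_cons, Multiset.prod_cons, eval_mul, eval_add, eval_sub, eval_X, eval_C]
      ring

theorem H2.exists_eq_monic_mul_add (f : H2) {P : ℂ[X]} (hP : P.Monic) (h : ∀ c, P.eval c = 0 → c ∈ disc) :
    ∃ (g : H2) (r : ℂ[X]), r.natDegree ≤ P.natDegree ∧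
      ∀ z ∈ disc, f.fn z = P.eval z * g.fn z + r.eval z := by
  have hs := IsAlgClosed.splits P
  obtain ⟨g, r, hr, hfg⟩ := f.exists_eq_prod_mul_add P.roots fun c hc => h c ((mem_roots hP.ne_zero).1 hc)
  have h1 := hs.eq_prod_roots
  rw [hP.leadingCoeff, C_1, one_mul] at h1
  rw [← h1] at hfg
  exact ⟨g, r, hr.trans (card_roots' P), hfg⟩

/-- Point evaluations at points of the circle are not bounded in the norm of `H²`. -/
theorem H2.nonpos_of_eval_le {η : ℂ} (hη : ‖η‖ = 1) {c K : ℝ}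
    (h : ∀ g : ℂ[X], c * ‖g.eval η‖ ≤ K * ‖ofPoly g‖) : c ≤ 0 := by
  by_contra hc
  push Not at hc
  obtain ⟨n, hn⟩ := exists_nat_gt (K ^ 2 / c ^ 2)
  have hn0 : (0 : ℝ) < n := lt_of_le_of_lt (by positivity) hn
  set g : ℂ[X] := ∑ j ∈ Finset.range n, C (starRingEnd ℂ η ^ j) * X ^ j with hg
  have h1 : g.eval η = n := by
    rw [hg, eval_finsetSum]
    simp only [eval_mul, eval_C, eval_pow, eval_X, ← mul_pow]
    rw [mul_comm, Complex.mul_conj, Complex.normSq_eq_norm_sq, hη]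
    simp
  have h2 : ∀ k, g.coeff k = if k < n then starRingEnd ℂ η ^ k else 0 := by
    intro k
    simp only [hg, finsetSum_coeff, coeff_C_mul_X_pow]
    simp [Finset.sum_ite_eq]
  have h3 : g.natDegree < n := by
    have hn' : 0 < n := by exact_mod_cast hn0
    refine (Nat.lt_iff_le_pred hn').2 (natDegree_le_iff_coeff_eq_zero.2 fun k hk => ?_)
    rw [h2, if_neg (by omega)]
  have h4 : ‖ofPoly g‖ ^ 2 = n := by
    rw [norm_ofPoly_sq g h3, Finset.sum_congr rfl (g := fun _ => (1 : ℝ))]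
    · simp
    · intro k hk
      rw [h2, if_pos (Finset.mem_range.1 hk), norm_pow, RCLike.norm_conj, hη]
      simp
  have h5 := h g
  rw [h1, Complex.norm_natCast] at h5
  have h6 : (c * n) ^ 2 ≤ (K * ‖ofPoly g‖) ^ 2 := pow_le_pow_left₀ (by positivity) h5 2
  rw [mul_pow, mul_pow, h4] at h6
  have h7 : K ^ 2 < n * c ^ 2 := (div_lt_iff₀ (by positivity)).1 hn
  nlinarith

namespace HbSum

variable {A : RatFunc ℂ} {φ : ℂ → ℂ}

theorem exists_norm_taylor_le (ζ : ℂ) (k : ℕ) :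
    ∃ K : ℝ, 0 ≤ K ∧ ∀ f : HbSum A, ‖(taylor ζ f.poly).coeff k‖ ≤ K * ‖f‖ := by
  refine ⟨∑ j : Fin (aDeg A), ‖(taylor ζ (X ^ (j : ℕ))).coeff k‖, by positivity, fun f => ?_⟩
  rw [poly, map_sum, finsetSum_coeff, Finset.sum_mul]
  refine norm_sum_le_of_le _ fun j _ => ?_
  rw [← smul_eq_C_mul, LinearMap.map_smul, coeff_smul, norm_smul, mul_comm]
  exact mul_le_mul_of_nonneg_left ((PiLp.norm_apply_le _ _).trans (WithLp.norm_snd_le _ f)) (norm_nonneg _)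

theorem taylor_modByMonic {ζ : ℂ} (hζ : ζ ∈ circleZeros A) {k : ℕ} (hk : k < zeroMult A ζ) (R : ℂ[X]) :
    (taylor ζ (R %ₘ aPoly A)).coeff k = (taylor ζ R).coeff k := by
  obtain ⟨b, hb⟩ := pow_zeroMult_dvd_aPoly hζ
  conv_rhs => rw [← modByMonic_add_div R (aPoly A)]
  rw [map_add, coeff_add, hb, mul_assoc, taylor_mul, taylor_pow, map_sub, taylor_X, taylor_C,
    add_sub_cancel_right, coeff_X_pow_mul', if_neg (by omega), add_zero]

end HbSum

/-! ### Comparison of the operators on `a H² ⊕ P_{N-1}` and on `H²` -/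

/-- The polynomial with zeros at the boundary values of `φ` at the points of `innerZeros A u φ`. -/
noncomputable def innerPoly (A : RatFunc ℂ) (u φ : ℂ → ℂ) : ℂ[X] :=
  ∏ ζ ∈ innerZeros A u φ, (X - C (ntLim φ ζ)) ^ zeroMult A ζ

theorem weight_eq (A : RatFunc ℂ) (u φ : ℂ → ℂ) (z : ℂ) :
    weight A u φ z = u z * (aPoly A * innerPoly A u φ).eval (φ z) / aFn A z := by
  rw [weight, eval_mul, aPoly_eval, innerPoly, eval_prod, mul_assoc]
  simp

theorem innerPoly_monic (A : RatFunc ℂ) (u φ : ℂ → ℂ) : (innerPoly A u φ).Monic :=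
  monic_prod_of_monic _ _ fun _ _ => (monic_X_sub_C _).pow _

theorem mem_disc_of_innerPoly_eval_eq_zero {A : RatFunc ℂ} {u φ : ℂ → ℂ} {c : ℂ}
    (h : (innerPoly A u φ).eval c = 0) : c ∈ disc := by
  classical
  rw [innerPoly, eval_prod, Finset.prod_eq_zero_iff] at h
  obtain ⟨ζ, hζ, h⟩ := h
  rw [eval_pow, eval_sub, eval_X, eval_C] at h
  rw [sub_eq_zero.1 (eq_zero_of_pow_eq_zero h)]
  exact (Finset.mem_filter.1 hζ).2.2

namespace HbSum

variable {A : RatFunc ℂ} {u φ : ℂ → ℂ} {F : HbSum A} {s : ℂ[X]} {G : H2}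

variable (A) in
theorem exists_aPoly_mul (J : ℂ[X]) : ∃ E : H2 →L[ℂ] HbSum A, ∀ f, ∀ z ∈ disc,
    (E f).fn z = (aPoly A * J).eval z * f.fn z := by
  refine H2.isFunSpace.exists_weightedComp isFunSpace (φ := id) (mapsTo_id _) fun f => ?_
  obtain ⟨g, hg⟩ := f.exists_mul_poly J
  obtain ⟨F, hF, -⟩ := exists_of (A := A) g 0
  refine ⟨F, fun z hz => ?_⟩
  rw [hF z hz, hg z hz, eval_mul, aPoly_eval, eval_zero, add_zero, mul_assoc]; rfl

theorem poly_weightedComp (hφ : BddAnalytic φ) (hu : ∀ z ∈ disc, u z = F.fn z)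
    (h : ∀ z ∈ disc, F.fn z * (φ z - s.eval z) = aFn A z * G.fn z) {f f' : HbSum A} {Q : ℂ[X]}
    (hφ_maps : MapsTo φ disc disc)
    (hf : ∀ z ∈ disc, f.fn z = Q.eval z) (hf' : ∀ z ∈ disc, f'.fn z = u z * f.fn (φ z)) :
    f'.poly = (F.poly * Q.comp s) %ₘ aPoly A := by
  obtain ⟨F', h1, h2⟩ := exists_mul_eval_comp hφ h Q
  rw [← h2]
  congr 1
  refine isFunSpace.ext fun z hz => ?_
  rw [h1 z hz, hf' z hz, hu z hz, hf _ (hφ_maps hz)]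

theorem aPoly_dvd_poly_mul_comp (hφ : BddAnalytic φ) (hφ_maps : MapsTo φ disc disc)
    (hu : ∀ z ∈ disc, u z = F.fn z)
    (h : ∀ z ∈ disc, F.fn z * (φ z - s.eval z) = aFn A z * G.fn z) {T : HbSum A →L[ℂ] HbSum A}
    (hT : ∀ f, ∀ z ∈ disc, (T f).fn z = u z * f.fn (φ z)) :
    aPoly A ∣ F.poly * (aPoly A * innerPoly A u φ).comp s := by
  refine aPoly_dvd_of fun ζ hζ => ?_
  by_contra hnd
  have hp : ¬ (X - C ζ) ^ zeroMult A ζ ∣ F.poly := fun h0 => hnd (h0.mul_right _)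
  have hn := norm_of_mem_circleZeros hζ
  have hlim := tendsto_of_not_dvd h hζ hp
  have hs1 : ‖s.eval ζ‖ = 1 := by
    have hs2 : s.eval ζ ∉ disc := by
      intro hs
      refine hnd (Dvd.dvd.mul_left ?_ _)
      have h1 : (X - C (s.eval ζ)) ^ zeroMult A ζ ∣ innerPoly A u φ := by
        rw [← ntLim_eq h hζ hp]
        exact Finset.dvd_prod_of_mem (fun ξ => (X - C (ntLim φ ξ)) ^ zeroMult A ξ)
          ((mem_innerZeros_iff hu h).2 ⟨hζ, hp, hs⟩)
      obtain ⟨b, hb⟩ := h1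
      rw [hb, mul_comp, mul_comp, pow_comp, sub_comp, X_comp, C_comp]
      refine Dvd.dvd.mul_left (Dvd.dvd.mul_right (pow_dvd_pow_of_dvd ?_ _) _) _
      exact X_sub_C_dvd_sub_C_eval
    have := nonTangential_neBot hn
    refine le_antisymm (le_of_tendsto hlim.norm ?_) (not_lt.1 fun h0 => hs2 (mem_disc.2 h0))
    filter_upwards [eventually_nonTangential_mem_disc ζ] with z hz
    exact (mem_disc.1 (hφ_maps hz)).le
  obtain ⟨E, hE⟩ := exists_aPoly_mul A (innerPoly A u φ)
  set B := aPoly A * innerPoly A u φ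
  set Q := F.poly * B.comp s with hQ
  have hQ0 : Q ≠ 0 := by rintro h0; simp [h0] at hnd
  have hk : Q.rootMultiplicity ζ < zeroMult A ζ :=
    not_le.1 fun hle => hnd ((le_rootMultiplicity_iff hQ0).1 hle)
  obtain ⟨Q', hQ', hndQ'⟩ := exists_eq_pow_rootMultiplicity_mul_and_not_dvd Q hQ0 ζ
  generalize Q.rootMultiplicity ζ = k at *
  have hQ'ζ : Q'.eval ζ ≠ 0 := fun h0 => hndQ' (dvd_iff_isRoot.2 h0)
  obtain ⟨K, hK0, hK⟩ := exists_norm_taylor_le (A := A) ζ k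
  refine hQ'ζ (norm_le_zero_iff.1 (H2.nonpos_of_eval_le hs1 (K := K * (‖T‖ * ‖E‖)) fun g => ?_))
  have h1 : (T (E (H2.ofPoly g))).poly = (F.poly * (B * g).comp s) %ₘ aPoly A :=
    poly_weightedComp hφ hu h hφ_maps (fun z hz => by rw [hE _ z hz, H2.fn_ofPoly, ← eval_mul]) (hT _)
  have h2 := hK (T (E (H2.ofPoly g)))
  rw [h1, taylor_modByMonic hζ hk, mul_comp, ← mul_assoc, ← hQ, hQ', mul_assoc, taylor_mul, taylor_pow,
    map_sub, taylor_X, taylor_C, add_sub_cancel_right, coeff_X_pow_mul', if_pos le_rfl, Nat.sub_self,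
    taylor_coeff_zero, eval_mul, eval_comp, norm_mul] at h2
  refine h2.trans ?_
  rw [mul_assoc, mul_assoc]
  refine mul_le_mul_of_nonneg_left ((T.le_opNorm _).trans ?_) hK0
  exact mul_le_mul_of_nonneg_left (E.le_opNorm _) (norm_nonneg _)

theorem isHSWeightedComp_weight (hφ : BddAnalytic φ) (hφ_maps : MapsTo φ disc disc)
    (hu : ∀ z ∈ disc, u z = F.fn z)
    (h : ∀ z ∈ disc, F.fn z * (φ z - s.eval z) = aFn A z * G.fn z)
    (H : IsHSWeightedComp (E := HbSum A) HbSum.fn u φ) :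
    IsHSWeightedComp (E := H2) H2.fn (weight A u φ) φ := by
  obtain ⟨T, hT, hHS⟩ := H
  have hdvd := aPoly_dvd_poly_mul_comp hφ hφ_maps hu h hT
  obtain ⟨E, hE⟩ := exists_aPoly_mul A (innerPoly A u φ)
  have h0 : ∀ g : ℂ[X], WithLp.sndL 2 ℂ H2 (EuclideanSpace ℂ (Fin (aDeg A))) (T (E (H2.ofPoly g))) = 0 := by
    intro g
    have h1 : (T (E (H2.ofPoly g))).poly =
        (F.poly * (aPoly A * innerPoly A u φ * g).comp s) %ₘ aPoly A :=
      poly_weightedComp hφ hu h hφ_maps (fun z hz => by rw [hE _ z hz, H2.fn_ofPoly, ← eval_mul]) (hT _)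
    rw [mul_comp, ← mul_assoc, (modByMonic_eq_zero_iff_dvd (aPoly_monic A)).2 (hdvd.mul_right _)] at h1
    change (T (E (H2.ofPoly g))).snd = 0
    ext k
    rw [← poly_coeff, h1]
    simp
  have h1 : ∀ f : H2, (T (E f)).snd = 0 := by
    intro f
    have := H2.dense_ofPoly.equalizer (h := fun _ => 0)
      (g := fun f => WithLp.sndL 2 ℂ H2 (EuclideanSpace ℂ (Fin (aDeg A))) (T (E f)))
      (by fun_prop) continuous_const (_root_.funext h0)
    exact congrFun this f
  refine ⟨WithLp.fstL 2 ℂ H2 (EuclideanSpace ℂ (Fin (aDeg A))) ∘L (T ∘L E), fun f z hz => ?_,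
    HSMap.comp_left (HSMap.comp_right hHS E) _⟩
  have h2 := hT (E f) z hz
  rw [hE f _ (hφ_maps hz), HbSum.fn, h1 f] at h2
  simp only [PiLp.zero_apply, zero_mul, Finset.sum_const_zero, add_zero] at h2
  change (T (E f)).fst.fn z = _
  rw [weight_eq, div_mul_eq_mul_div, eq_div_iff (aFn_ne_zero A hz)]
  linear_combination h2

theorem isHSWeightedComp_of_weight (hφ : BddAnalytic φ) (hφ_maps : MapsTo φ disc disc)
    (hu : ∀ z ∈ disc, u z = F.fn z)
    (h : ∀ z ∈ disc, F.fn z * (φ z - s.eval z) = aFn A z * G.fn z)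
    (H : IsHSWeightedComp (E := H2) H2.fn (weight A u φ) φ) :
    IsHSWeightedComp (E := HbSum A) HbSum.fn u φ := by
  obtain ⟨S, hS, hHS⟩ := H
  obtain ⟨E, hE⟩ := exists_aPoly_mul A (innerPoly A u φ)
  obtain ⟨I, hI⟩ := exists_aPoly_mul A 1
  have hS' : ∀ f, ∀ z ∈ disc, (I (S f)).fn z = u z * (E f).fn (φ z) := fun f z hz => by
    rw [hI _ z hz, hS f z hz, hE f _ (hφ_maps hz), weight_eq, mul_one, aPoly_eval]
    have := aFn_ne_zero A hz
    field_simp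
  set n := aDeg A + (innerPoly A u φ).natDegree + 1 with hn
  have hdiv : ∀ f : HbSum A, ∃ (g : H2) (Q : ℂ[X]), Q.natDegree < n ∧
      ∀ z ∈ disc, f.fn z = (E g).fn z + Q.eval z := by
    intro f
    obtain ⟨g, r, hr, hg⟩ := f.fst.exists_eq_monic_mul_add (innerPoly_monic A u φ)
      fun c => mem_disc_of_innerPoly_eval_eq_zero
    refine ⟨g, aPoly A * r + f.poly, ?_, fun z hz => ?_⟩
    · have h1 : (aPoly A * r).natDegree ≤ aDeg A + (innerPoly A u φ).natDegree :=
        natDegree_mul_le.trans (add_le_add (aPoly_natDegree A).le hr)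
      have h2 : f.poly.natDegree ≤ aDeg A := natDegree_le_of_degree_le f.degree_poly_lt.le
      have h3 := natDegree_add_le (aPoly A * r) f.poly
      omega
    · rw [fn_eq, hE g z hz, hg z hz, eval_add, eval_mul, eval_mul, aPoly_eval]
      ring
  obtain ⟨T, hT⟩ := isFunSpace.exists_weightedComp (isFunSpace (A := A)) (u := u) hφ_maps fun f => by
    obtain ⟨g, Q, -, hg⟩ := hdiv f
    obtain ⟨F', hF', -⟩ := exists_mul_eval_comp hφ h Q
    refine ⟨I (S g) + F', fun z hz => ?_⟩
    rw [isFunSpace.add _ _ z hz, hS' g z hz, hF' z hz, hg _ (hφ_maps hz), ← hu z hz]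
    ring
  have he : ∀ k : ℕ, ∃ e : HbSum A, ∀ z ∈ disc, e.fn z = z ^ k := fun k => by
    obtain ⟨e, he, -⟩ := exists_of (A := A) 0 (X ^ k)
    exact ⟨e, fun z hz => by rw [he z hz, H2.isFunSpace.zero hz]; simp⟩
  choose e he using he
  let P : EuclideanSpace ℂ (Fin n) →L[ℂ] HbSum A := ∑ k : Fin n, (EuclideanSpace.proj k).smulRight (e k)
  have hP : ∀ v, P v = ∑ k : Fin n, v k • e k := fun v => by simp [P]
  let π₁ := WithLp.fstL 2 ℂ H2 (EuclideanSpace ℂ (Fin n))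
  let π₂ := WithLp.sndL 2 ℂ H2 (EuclideanSpace ℂ (Fin n))
  refine ⟨T, hT, HSMap.of_comp_surjective (Y := E ∘L π₁ + P ∘L π₂) (fun f => ?_) ?_⟩
  · obtain ⟨g, Q, hQ, hg⟩ := hdiv f
    refine ⟨WithLp.toLp 2 (g, WithLp.toLp 2 fun k => Q.coeff k), isFunSpace.ext fun z hz => ?_⟩
    change (E g + P (WithLp.toLp 2 fun k : Fin n => Q.coeff k)).fn z = _
    rw [isFunSpace.add _ _ z hz, hg z hz, hP, isFunSpace.sum _ _ hz,
      eval_eq_sum_range' hQ, ← Fin.sum_univ_eq_sum_range (fun k => Q.coeff k * z ^ k)]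
    congr 1
    refine Finset.sum_congr rfl fun k _ => ?_
    rw [isFunSpace.smul _ _ z hz, he _ z hz]
  · have h1 : T ∘L (E ∘L π₁ + P ∘L π₂) = I ∘L (S ∘L π₁) + (T ∘L P) ∘L π₂ := by
      rw [ContinuousLinearMap.comp_add]
      congr 1
      ext1 x
      refine isFunSpace.ext fun z hz => ?_
      exact (hT (E (π₁ x)) z hz).trans (hS' (π₁ x) z hz).symm
    rw [h1]
    exact ((HSMap.comp_right hHS π₁).comp_left I).add ((HSMap.of_finiteDimensional π₂).comp_left _)

end HbSum

/-! ### The integral criterion -/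

theorem ae_boundaryFn_eq_of_tendsto {f : H2} {w : ℂ → ℂ} (h : ∀ z ∈ disc, f.fn z = w z) :
    ∀ᵐ t : ℝ ∂arcMeasure, Tendsto (fun r : ℝ => w (r * Complex.exp (t * Complex.I))) (𝓝[<] 1)
      (𝓝 (boundaryFn w (Complex.exp (t * Complex.I)))) := by
  filter_upwards [f.tendsto_boundaryFn] with t ht
  have h1 : Tendsto (fun r : ℝ => w (r * Complex.exp (t * Complex.I))) (𝓝[<] 1)
      (𝓝 (boundaryFn f.fn (Complex.exp (t * Complex.I)))) := by
    refine ht.congr' ?_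
    filter_upwards [eventually_radial_mem_disc (Complex.norm_exp_ofReal_mul_I t).le] with r hr
    exact h _ hr
  rwa [boundaryFn, h1.limUnder_eq]

theorem BddAnalytic.ae_tendsto {φ : ℂ → ℂ} (hφ : BddAnalytic φ) :
    ∀ᵐ t : ℝ ∂arcMeasure, Tendsto (fun r : ℝ => φ (r * Complex.exp (t * Complex.I))) (𝓝[<] 1)
      (𝓝 (boundaryFn φ (Complex.exp (t * Complex.I)))) := by
  obtain ⟨f, hf⟩ := hφ.exists_mul (H2.ofPoly 1)
  exact ae_boundaryFn_eq_of_tendsto (f := f) fun z hz => by rw [hf z hz, H2.fn_ofPoly]; simp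

theorem ae_boundaryFn_eq {f : H2} {g : ℂ → ℂ} {L : ℝ → ℂ} (h : ∀ z ∈ disc, f.fn z = g z)
    (hg : ∀ᵐ t : ℝ ∂arcMeasure, Tendsto (fun r : ℝ => g (r * Complex.exp (t * Complex.I))) (𝓝[<] 1)
      (𝓝 (L t))) :
    ∀ᵐ t : ℝ ∂arcMeasure, boundaryFn f.fn (Complex.exp (t * Complex.I)) = L t := by
  filter_upwards [hg, f.tendsto_boundaryFn] with t h1 h2
  refine tendsto_nhds_unique (h2.congr' ?_) h1
  filter_upwards [eventually_radial_mem_disc (Complex.norm_exp_ofReal_mul_I t).le] with r hr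
  exact h _ hr

theorem ofReal_div_ofReal_eq (w c : ℂ) :
    ENNReal.ofReal (‖w‖ ^ 2) / ENNReal.ofReal (1 - ‖c‖ ^ 2) = ∑' n : ℕ, ‖w * c ^ n‖ₑ ^ 2 := by
  have : ∀ n : ℕ, ‖w * c ^ n‖ₑ ^ 2 = ‖w‖ₑ ^ 2 * (‖c‖ₑ ^ 2) ^ n := fun n => by
    rw [enorm_mul, mul_pow, enorm_pow, ← pow_mul, ← pow_mul, mul_comm n]
  simp_rw [this]
  rw [ENNReal.tsum_mul_left, ENNReal.tsum_geometric, ENNReal.ofReal_sub _ (sq_nonneg _), ENNReal.ofReal_one,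
    ← enorm_sq_eq_ofReal, ← enorm_sq_eq_ofReal, div_eq_mul_inv]

theorem hsIntegral_eq {w φ : ℂ → ℂ} (hφ : BddAnalytic φ) {W : ℕ → H2}
    (hW : ∀ n, ∀ z ∈ disc, (W n).fn z = w z * φ z ^ n) :
    hsIntegral w φ = ∑' n, ‖W n‖ₑ ^ 2 := by
  have hpi : ENNReal.ofReal (2 * Real.pi) ≠ 0 := by
    rw [Ne, ENNReal.ofReal_eq_zero, not_le]; positivity
  have h1 : ∀ n, ∀ᵐ t : ℝ ∂arcMeasure, boundaryFn (W n).fn (Complex.exp (t * Complex.I)) =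
      boundaryFn w (Complex.exp (t * Complex.I)) * boundaryFn φ (Complex.exp (t * Complex.I)) ^ n := by
    intro n
    refine ae_boundaryFn_eq (hW n) ?_
    filter_upwards [hφ.ae_tendsto, ae_boundaryFn_eq_of_tendsto (f := W 0) (w := w)
      fun z hz => by simpa using hW 0 z hz] with t h2 h3
    exact h3.mul (h2.pow n)
  rw [hsIntegral]
  have h2 : ∫⁻ t : ℝ in Ioc (0 : ℝ) (2 * Real.pi),
      ENNReal.ofReal (‖boundaryFn w (Complex.exp (t * Complex.I))‖ ^ 2) /
        ENNReal.ofReal (1 - ‖boundaryFn φ (Complex.exp (t * Complex.I))‖ ^ 2) =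
      ∫⁻ t : ℝ, ∑' n, ‖boundaryFn (W n).fn (Complex.exp (t * Complex.I))‖ₑ ^ 2 ∂arcMeasure := by
    refine lintegral_congr_ae ?_
    filter_upwards [ae_all_iff.2 h1] with t ht
    rw [ofReal_div_ofReal_eq]
    simp_rw [ht]
  rw [h2, lintegral_tsum fun n => (W n).aemeasurable_boundaryFn.enorm.pow_const 2]
  simp_rw [H2.lintegral_boundaryFn]
  rw [ENNReal.tsum_mul_left, ← mul_assoc, ENNReal.inv_mul_cancel hpi ENNReal.ofReal_ne_top, one_mul]

theorem hsIntegral_lt_top {w φ : ℂ → ℂ} (hφ : BddAnalytic φ)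
    (H : IsHSWeightedComp (E := H2) H2.fn w φ) : hsIntegral w φ < ⊤ := by
  obtain ⟨S, hS, hHS⟩ := H
  rw [hsIntegral_eq hφ (W := fun n => S (H2.basis n)) fun n z hz => by rw [hS _ z hz, H2.fn_basis],
    lt_top_iff_ne_top, ← summable_norm_sq_iff]
  exact HSMap.summable hHS H2.basis

theorem isHSWeightedComp_of_summable {w φ : ℂ → ℂ} (hφ_maps : MapsTo φ disc disc) {W : ℕ → H2}
    (hW : ∀ n, ∀ z ∈ disc, (W n).fn z = w z * φ z ^ n) (hs : Summable fun n => ‖W n‖ ^ 2) :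
    IsHSWeightedComp (E := H2) H2.fn w φ := by
  obtain ⟨T, hT⟩ := H2.isFunSpace.exists_weightedComp H2.isFunSpace (u := w) hφ_maps fun f => by
    have h1 : Summable fun n => f n • W n := by
      refine Summable.of_norm_bounded (f.summable_norm_sq.add hs) fun n => ?_
      rw [norm_smul]
      nlinarith [sq_nonneg (‖f n‖ - ‖W n‖), sq_nonneg (‖f n‖), sq_nonneg (‖W n‖)]
    refine ⟨∑' n, f n • W n, fun z hz => ?_⟩
    obtain ⟨ℓ, hℓ⟩ := H2.isFunSpace.exists_eval hz
    rw [← hℓ, ℓ.map_tsum h1, H2.fn, ← tsum_mul_left]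
    congr 1
    ext n
    rw [hℓ, H2.fn_smul, hW n z hz]
    ring
  refine ⟨T, hT, HSMap.of_basis H2.basis ?_⟩
  have h2 : ∀ n, T (H2.basis n) = W n := fun n =>
    H2.ext_of_fn fun z hz => by rw [hT _ z hz, H2.fn_basis, hW n z hz]
  simp_rw [h2]
  exact hs

/-- Here `v` is `a w`. -/
theorem isHSWeightedComp_of_hsIntegral_lt_top {A : RatFunc ℂ} {w φ : ℂ → ℂ} (hφ : BddAnalytic φ)
    (hφ_maps : MapsTo φ disc disc) {v : H2} (hv : ∀ z ∈ disc, v.fn z = aFn A z * w z)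
    (H : hsIntegral w φ < ⊤) : IsHSWeightedComp (E := H2) H2.fn w φ := by
  have hpi : (ENNReal.ofReal (2 * Real.pi))⁻¹ ≠ 0 := ENNReal.inv_ne_zero.2 ENNReal.ofReal_ne_top
  have hI : ∫⁻ t : ℝ, (∑' n : ℕ, ‖boundaryFn w (Complex.exp (t * Complex.I)) *
      boundaryFn φ (Complex.exp (t * Complex.I)) ^ n‖ₑ ^ 2) ∂arcMeasure ≠ ⊤ := by
    simp_rw [← ofReal_div_ofReal_eq]
    intro h
    rw [hsIntegral, h, ENNReal.mul_top hpi] at H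
    exact lt_irrefl _ H
  have haw : ∀ᵐ t : ℝ ∂arcMeasure, aFn A (Complex.exp (t * Complex.I)) ≠ 0 ∧
      Tendsto (fun r : ℝ => w (r * Complex.exp (t * Complex.I))) (𝓝[<] 1)
        (𝓝 (boundaryFn w (Complex.exp (t * Complex.I)))) := by
    filter_upwards [ae_eval_exp_ne_zero (aPoly_monic A).ne_zero, v.tendsto_boundaryFn] with t h1 h2
    rw [aPoly_eval] at h1
    refine ⟨h1, ?_⟩
    have h3 : Tendsto (fun r : ℝ => aFn A (r * Complex.exp (t * Complex.I))) (𝓝[<] 1)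
        (𝓝 (aFn A (Complex.exp (t * Complex.I)))) := by
      simp_rw [← aPoly_eval]
      exact tendsto_radial_of_continuousAt (aPoly A).continuousAt
    have h4 : Tendsto (fun r : ℝ => w (r * Complex.exp (t * Complex.I))) (𝓝[<] 1)
        (𝓝 (boundaryFn v.fn (Complex.exp (t * Complex.I)) / aFn A (Complex.exp (t * Complex.I)))) := by
      refine (h2.div h3 h1).congr' ?_
      filter_upwards [eventually_radial_mem_disc (Complex.norm_exp_ofReal_mul_I t).le] with r hr
      simp only [Pi.div_apply]
      rw [hv _ hr, mul_div_cancel_left₀ _ (aFn_ne_zero A hr)]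
    rwa [boundaryFn, h4.limUnder_eq]
  have hW : ∀ n : ℕ, ∃ W : H2, ∀ z ∈ disc, W.fn z = w z * φ z ^ n := by
    intro n
    obtain ⟨V, hV⟩ := (hφ.pow n).exists_mul v
    have hVb : ∀ᵐ t : ℝ ∂arcMeasure, boundaryFn V.fn (Complex.exp (t * Complex.I)) =
        boundaryFn φ (Complex.exp (t * Complex.I)) ^ n * (aFn A (Complex.exp (t * Complex.I)) *
          boundaryFn w (Complex.exp (t * Complex.I))) := by
      refine ae_boundaryFn_eq (g := fun z => φ z ^ n * (aFn A z * w z))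
        (fun z hz => by rw [hV z hz, hv z hz]) ?_
      filter_upwards [haw, hφ.ae_tendsto] with t h1 h2
      refine (h2.pow n).mul (Tendsto.mul ?_ h1.2)
      simp_rw [← aPoly_eval]
      exact tendsto_radial_of_continuousAt (aPoly A).continuousAt
    obtain ⟨W, hW⟩ := H2.exists_div (S := circleZeros A) (fun ζ hζ => norm_of_mem_circleZeros hζ)
      (zeroMult A) V (by
        refine ne_top_of_le_ne_top hI (lintegral_mono_ae ?_)
        filter_upwards [haw, hVb] with t h1 h2
        change ‖_ / aFn A _‖ₑ ^ 2 ≤ _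
        refine le_trans (le_of_eq ?_) (ENNReal.le_tsum n)
        rw [h2]
        congr 2
        field_simp [h1.1])
    refine ⟨W, fun z hz => mul_left_cancel₀ (aFn_ne_zero A hz) ?_⟩
    have h1 : aFn A z * W.fn z = V.fn z := hW z hz
    rw [h1, hV z hz, hv z hz]
    ring
  choose W hW using hW
  refine isHSWeightedComp_of_summable hφ_maps hW ?_
  rwa [summable_norm_sq_iff, ← hsIntegral_eq hφ hW, ← lt_top_iff_ne_top]

/-- The Hilbert–Schmidt property of weighted composition operators does not depend on the choice of
the Hilbert space structure on a space of functions. -/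
theorem IsHSWeightedComp.congr_space {E F : Type} [NormedAddCommGroup E] [InnerProductSpace ℂ E]
    [CompleteSpace E] [NormedAddCommGroup F] [InnerProductSpace ℂ F] [CompleteSpace F]
    {fn : E → ℂ → ℂ} {gn : F → ℂ → ℂ} (hE : IsFunSpace fn) (hF : IsFunSpace gn)
    (hEF : ∀ f, ∃ g, ∀ z ∈ disc, gn g z = fn f z) (hFE : ∀ g, ∃ f, ∀ z ∈ disc, fn f z = gn g z)
    {u φ : ℂ → ℂ} (hφ : MapsTo φ disc disc) (H : IsHSWeightedComp fn u φ) :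
    IsHSWeightedComp gn u φ := by
  obtain ⟨T, hT, hHS⟩ := H
  obtain ⟨I, hI⟩ := hE.exists_weightedComp hF (u := fun _ => 1) (φ := id) (mapsTo_id _)
    (by simpa using hEF)
  obtain ⟨J, hJ⟩ := hF.exists_weightedComp hE (u := fun _ => 1) (φ := id) (mapsTo_id _)
    (by simpa using hFE)
  refine ⟨I ∘L (T ∘L J), fun f z hz => ?_, (HSMap.comp_right hHS J).comp_left I⟩
  change gn (I (T (J f))) z = _
  rw [hI _ z hz, id, hT _ z hz, hJ _ _ (hφ hz), one_mul, one_mul, id]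

theorem theorem8p2 (b A : RatFunc ℂ)
    (hb_an : ∀ z ∈ disc, b.denom.eval z ≠ 0)
    (hb_norm : IsLUB ((fun z => ‖ratFn b z‖) '' disc) 1)
    (hb_not_inner : ∃ z : ℂ, ‖z‖ = 1 ∧ ‖ratFn b z‖ ≠ 1)
    (hA : IsPythagoreanMate b A)
    (u φ : ℂ → ℂ)
    (hφ : DifferentiableOn ℂ φ disc) (hφ_maps : MapsTo φ disc disc)
    (hu : MemHb (ratFn b) u)
    (huφ : MemHb (ratFn b) (fun z => u z * φ z)) :
    List.TFAE [
      IsHSWeightedComp (E := Hb (ratFn b)) Hb.fn u φ,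
      IsHSWeightedComp (E := HbSum A) HbSum.fn u φ,
      IsHSWeightedComp (E := H2) H2.fn (weight A u φ) φ,
      hsIntegral (weight A u φ) φ < ⊤] := by
  have hb : ∀ z ∈ disc, ‖ratFn b z‖ ≤ 1 := fun z hz => hb_norm.1 (mem_image_of_mem _ hz)
  have hφb : BddAnalytic φ := ⟨hφ, 1, zero_le_one, fun z hz => (mem_disc.1 (hφ_maps hz)).le⟩
  have h1 : ∀ f : Hb (ratFn b), ∃ g : HbSum A, ∀ z ∈ disc, g.fn z = f.fn z :=
    fun f => exists_HbSum_eq_defect hb_an hb hA f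
  have h2 : ∀ f : HbSum A, ∃ g : Hb (ratFn b), ∀ z ∈ disc, g.fn z = f.fn z :=
    fun f => exists_Hb_eq_HbSum hb_an hb hA f
  obtain ⟨f, hf⟩ := hu
  obtain ⟨f', hf'⟩ := huφ
  obtain ⟨F, hF⟩ := h1 f
  obtain ⟨F', hF'⟩ := h1 f'
  have huF : ∀ z ∈ disc, u z = F.fn z := fun z hz => by rw [hf z hz, hF z hz]
  obtain ⟨s, G, h⟩ := HbSum.exists_mul_sub_eval hφb F F' fun z hz => by
    rw [hF' z hz, ← hf' z hz, ← huF z hz, mul_comm]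
  tfae_have 1 → 2 := IsHSWeightedComp.congr_space (Hb.isFunSpace _) HbSum.isFunSpace h1 h2 hφ_maps
  tfae_have 2 → 1 := IsHSWeightedComp.congr_space HbSum.isFunSpace (Hb.isFunSpace _) h2 h1 hφ_maps
  tfae_have 2 → 3 := HbSum.isHSWeightedComp_weight hφb hφ_maps huF h
  tfae_have 3 → 2 := HbSum.isHSWeightedComp_of_weight hφb hφ_maps huF h
  tfae_have 3 → 4 := hsIntegral_lt_top hφb
  tfae_have 4 → 3 := fun H => by
    obtain ⟨K, hK, -⟩ := HbSum.exists_mul_eval_comp hφb h (aPoly A * innerPoly A u φ)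
    obtain ⟨v, hv⟩ := K.exists_toH2
    refine isHSWeightedComp_of_hsIntegral_lt_top (A := A) hφb hφ_maps (v := v) (fun z hz => ?_) H
    rw [hv z hz, hK z hz, weight_eq, mul_div_cancel₀ _ (aFn_ne_zero A hz), huF z hz]
  tfae_finish
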